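/- **Setting.** Consider the infinite chain with single-particle space $\ell^2(\mathbb Z)\otimes\mathbb C^d$, with basis $|j,a\rangle$ ($j\in\mathbb Z$, $a=1,\dots,d$). A translation-invariant lattice Hamiltonian is a bounded self-adjoint operator $H$ with $\langle j+m|H|j'+m\rangle=\langle j|H|j'\rangle$ (as $d\times d$ blocks) and absolutely summable hopping amplitudes $H_n=\langle 0|H|n\rangle$; its Bloch Hamiltonian is $H(k)=\sum_{n\in\mathbb Z}e^{ikn}H_n$. Let $H_0$ (initial) and $H$ (post-quench) be two such Hamiltonians in class D: there is a unitary $d\times d$ matrix $W$ with $W\overline W=1$ such that $W\,\overline{H_0(k)}\,W^\dagger=-H_0(-k)$ and $W\,\overline{H(k)}\,W^\dagger=-H(-k)$ for all real $k$ (particle-hole symmetry $\mathcal C=W\mathcal K$, $\mathcal C^2=1$). Suppose that $H_0$ is gapped, i.e. $0$ is not an eigenvalue of $H_0(k)$ for any real $k$, and topologically nontrivial, i.e. $\operatorname{Pf}(H_0(0)W)\,/\operatorname{Pf}(H_0(\pi)W)<0$ (this ratio is real; for $W=1$, $H_0(k)=iR(k)$, it says that $\operatorname{Pf}R(0)$ and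 $\operatorname{Pf}R(\pi)$ have opposite signs). The initial state is the ground state of $H_0$: $P_{0<}$ is the spectral projector of $H_0$ onto the negative energies, $P_{0<}(k)$ is that of $H_0(k)$ for real $k$, and $P_<(t)=e^{-iHt}P_{0<}e^{iHt}$ for $t\ge 0$. For the segment $S=\{1,\dots,l\}$, $l\ge1$, of the infinite chain, the single-particle entanglement spectrum $\{\xi_n\}$ consists of the $ld$ eigenvalues of $P_SP_<(t)P_S$ on the single-particle space of $S$, and the single-particle entanglement gap is $\Delta=2\min_n|\xi_n-\tfrac12|$. **Theorem.** Let $\kappa>0$, and assume that (i) $k\mapsto P_{0<}(k)$ has an analytic continuation to the closed strip $|\operatorname{Im}k|\le\kappa$ (analytic on a neighbourhood of it), again denoted $P_{0<}$; (ii) $H(k+i\kappa)=\sum_n e^{ikn-\kappa n}H_n$ converges absolutely and is diagonalizable for all $k\in[-\pi,\pi]$: $H(k+i\kappa)=\sum_{\alpha=1}^d\epsilon_{k+i\kappa,\alpha}|u^{\rm R}_{k+i\kappa,\alpha}\rangle\langle u^{\rm L}_{k+i\kappa,\alpha}|$ with $\langle u^{\rm L}_{k+i\kappa,\alpha}|u^{\rm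 R}_{k+i\kappa,\beta}\rangle=\delta_{\alpha\beta}$. Then the maximum $v=\kappa^{-1}\max_{k\in[-\pi,\pi],\alpha,\beta}\operatorname{Im}(\epsilon_{k+i\kappa,\alpha}-\epsilon_{k+i\kappa,\beta})$ is attained, and for all $l\ge1$ and $t\ge0$ $$\Delta\le \frac{2}{\sinh\kappa}\,C\,e^{-\kappa(l-vt)},\qquad C=\int_{-\pi}^{\pi}\frac{dk}{2\pi}\Big(\sum_{\alpha=1}^d\|u^{\rm R}_{k+i\kappa,\alpha}\|\,\|u^{\rm L}_{k+i\kappa,\alpha}\|\Big)^2\|P_{0<}(k+i\kappa)\|\in[0,\infty],$$ where $\|\cdot\|$ is the Euclidean norm of vectors and the operator norm of matrices. In particular neither $C$ nor $v$ depends on $l$ or $t$. -/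

import Mathlib

open MeasureTheory Set
open scoped Matrix Matrix.Norms.L2Operator ENNReal

noncomputable section

namespace FreeFermion

/-- Single-particle Hilbert space `ℓ²(ℤ) ⊗ ℂᵈ` of the infinite chain with `d` internal states
per unit cell. -/
abbrev SingleParticle (d : ℕ) : Type := lp (fun _ : ℤ × Fin d => ℂ) 2

/-- The normalized state `|j, a⟩` localized in the unit cell `j`, with internal state `a`. -/
def site {d : ℕ} (j : ℤ) (a : Fin d) : SingleParticle d := lp.single 2 (j, a) 1

/-- The matrix block `⟨j| T |j'⟩` of an operator on the chain. -/
def block {d : ℕ} (T : SingleParticle d →L[ℂ] SingleParticle d) (j j' : ℤ) :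
    Matrix (Fin d) (Fin d) ℂ :=
  Matrix.of fun a a' => inner ℂ (site j a) (T (site j' a'))

/-- A translation-invariant (single-particle) lattice Hamiltonian on the infinite chain, with
absolutely summable hopping amplitudes `Hₙ = ⟨0| H |n⟩` (so that its Bloch Hamiltonian is defined
by an absolutely convergent Fourier series). -/
structure LatticeHamiltonian (d : ℕ) where
  /-- the Hamiltonian as a bounded operator -/
  op : SingleParticle d →L[ℂ] SingleParticle d
  selfAdjoint : IsSelfAdjoint op
  translation_invariant : ∀ m j j' : ℤ, block op (j + m) (j' + m) = block op j j'
  summable_hopping : Summable fun n : ℤ => ‖block op 0 n‖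

namespace LatticeHamiltonian

variable {d : ℕ}

/-- The hopping amplitude `Hₙ = ⟨j| H |j + n⟩`. -/
def hopping (H : LatticeHamiltonian d) (n : ℤ) : Matrix (Fin d) (Fin d) ℂ := block H.op 0 n

/-- The Bloch Hamiltonian `H(k) = ∑ₙ e^{ikn} Hₙ`, at a real or complex wave number `k`. -/
def bloch (H : LatticeHamiltonian d) (k : ℂ) : Matrix (Fin d) (Fin d) ℂ :=
  ∑' n : ℤ, Complex.exp (Complex.I * k * n) • H.hopping n

/-- `H(k + iκ)` is well-defined: its Fourier series converges absolutely. It does not depend on the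
real part of the wave number, and because `H₋ₙ = Hₙ†` it covers the whole strip `|Im k| ≤ κ`. -/
def BlochWellDefined (H : LatticeHamiltonian d) (κ : ℝ) : Prop :=
  Summable fun n : ℤ => Real.exp (-κ * n) * ‖H.hopping n‖

/-- The Hamiltonian is gapped: no band touches the Fermi energy `0`. (The bands are continuous and
`2π`-periodic, so that this makes the gap uniform in `k`.) -/
def Gapped (H : LatticeHamiltonian d) : Prop :=
  ∀ k : ℝ, (0 : ℂ) ∉ spectrum ℂ (H.bloch k)

/-- Particle-hole symmetry `𝒞 H(k) 𝒞⁻¹ = -H(-k)` with the anti-unitary on-site operator `𝒞 = W 𝒦`,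
where `𝒦` is the complex conjugation. -/
def ParticleHoleSymmetric (H : LatticeHamiltonian d) (W : Matrix (Fin d) (Fin d) ℂ) : Prop :=
  ∀ k : ℝ, W * (H.bloch k).map star * Wᴴ = -H.bloch (-k)

end LatticeHamiltonian

/-- `𝒞 = W 𝒦` is anti-unitary and involutory (`𝒞² = W W̄ = 1`), as in class D. -/
def IsInvolutoryConjugation {d : ℕ} (W : Matrix (Fin d) (Fin d) ℂ) : Prop :=
  W ∈ Matrix.unitaryGroup (Fin d) ℂ ∧ W * W.map star = 1

/-- The Pfaffian of a skew-symmetric matrix (zero in odd dimension). -/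
def pfaffian {d : ℕ} (A : Matrix (Fin d) (Fin d) ℂ) : ℂ :=
  if Even d then
    (1 / ((2 : ℂ) ^ (d / 2) * (Nat.factorial (d / 2) : ℂ))) *
      ∑ σ : Equiv.Perm (Fin d), ((Equiv.Perm.sign σ : ℤ) : ℂ) *
        ∏ i : Fin (d / 2),
          A (σ ⟨2 * (i : ℕ), by have := i.isLt; omega⟩)
            (σ ⟨2 * (i : ℕ) + 1, by have := i.isLt; omega⟩)
  else 0

/-- The `ℤ₂` index of a gapped class-D chain is nontrivial. At `k = 0, π` the matrix `H(k) W` is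
skew-symmetric and invertible, and the ratio of the two Pfaffians is real; in a Majorana basis
(`W = 1`, `H(k) = i R(k)`, `R` real at `k = 0, π`) the condition reads
`sgn Pf R(0) · sgn Pf R(π) = -1`. -/
def TopologicallyNontrivial {d : ℕ} (H : LatticeHamiltonian d) (W : Matrix (Fin d) (Fin d) ℂ) :
    Prop :=
  (pfaffian (H.bloch 0 * W) / pfaffian (H.bloch (Real.pi : ℂ) * W)).re < 0

/-- The projector onto the Fermi sea of a self-adjoint `a`: its spectral projection for the
negative energies. For `a` without spectrum at `0` it is the contour integral
`∮ (z - a)⁻¹ dz / (2πi)` around the negative part of the spectrum. -/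
def fermiProjector {A : Type*} [CStarAlgebra A] (a : A) : A :=
  cfc (fun x : ℝ => if x < 0 then (1 : ℝ) else 0) a

/-- The time-evolved Fermi-sea projector `P_<(t) = e^{-iHt} P_{0<} e^{iHt}` after the quench
`H₀ → H` of the infinite chain. -/
def evolvedProjector {d : ℕ} (H₀ H : LatticeHamiltonian d) (t : ℝ) :
    SingleParticle d →L[ℂ] SingleParticle d :=
  NormedSpace.exp ((-(Complex.I * t)) • H.op) * fermiProjector H₀.op *
    NormedSpace.exp ((Complex.I * t) • H.op)

/-- The compression `P_S P P_S` to the segment `S` of the unit cells `1, …, l`, as a matrix on the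
`l d`-dimensional single-particle space of `S`. -/
def segmentMatrix {d : ℕ} (P : SingleParticle d →L[ℂ] SingleParticle d) (l : ℕ) :
    Matrix (Fin l × Fin d) (Fin l × Fin d) ℂ :=
  Matrix.of fun x y => block P ((x.1 : ℤ) + 1) ((y.1 : ℤ) + 1) x.2 y.2

/-- The single-particle entanglement spectrum `{ξₙ}` of the segment. -/
def entanglementSpectrum {d : ℕ} (P : SingleParticle d →L[ℂ] SingleParticle d) (l : ℕ) : Set ℝ :=
  spectrum ℝ (segmentMatrix P l)

/-- The single-particle entanglement gap `2 minₙ |ξₙ - 1/2|`. -/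
def entanglementGap {d : ℕ} (P : SingleParticle d →L[ℂ] SingleParticle d) (l : ℕ) : ℝ :=
  2 * sInf ((fun ξ : ℝ => |ξ - 1 / 2|) '' entanglementSpectrum P l)

/-- The closed strip `|Im k| ≤ κ`. -/
def strip (κ : ℝ) : Set ℂ := {k : ℂ | |k.im| ≤ κ}

/-- A diagonalization `A(k) = ∑_α ε_{k,α} |u^R_{k,α}⟩⟨u^L_{k,α}|` for all `k ∈ [-π, π]`, with right
and left eigenvectors that form dual bases: `⟨u^L_{k,α}|u^R_{k,β}⟩ = δ_{αβ}`. -/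
structure Diagonalization {d : ℕ} (A : ℝ → Matrix (Fin d) (Fin d) ℂ) where
  energy : ℝ → Fin d → ℂ
  right : ℝ → Fin d → EuclideanSpace ℂ (Fin d)
  left : ℝ → Fin d → EuclideanSpace ℂ (Fin d)
  biorthonormal : ∀ k ∈ Icc (-Real.pi) Real.pi, ∀ α β : Fin d,
    inner ℂ (left k α) (right k β) = if α = β then 1 else 0
  decomposition : ∀ k ∈ Icc (-Real.pi) Real.pi,
    A k = ∑ α : Fin d, energy k α • Matrix.of fun a b => right k α a * star (left k α b)

/-- `∫_{-π}^{π} dk/(2π) (∑_α ‖u^R_{k,α}‖ ‖u^L_{k,α}‖)² ‖P(k + iκ)‖`, with values in `[0, ∞]`. -/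
def prefactor {d : ℕ} {A : ℝ → Matrix (Fin d) (Fin d) ℂ} (D : Diagonalization A)
    (P : ℂ → Matrix (Fin d) (Fin d) ℂ) (κ : ℝ) : ℝ≥0∞ :=
  ∫⁻ k in Icc (-Real.pi) Real.pi,
    ENNReal.ofReal ((∑ α : Fin d, ‖D.right k α‖ * ‖D.left k α‖) ^ 2 *
      ‖P (k + Complex.I * κ)‖ / (2 * Real.pi))

/-- The set of all `κ⁻¹ Im (ε_{k,α} - ε_{k,β})`, `k ∈ [-π, π]`. -/
def relativeVelocities {d : ℕ} {A : ℝ → Matrix (Fin d) (Fin d) ℂ} (D : Diagonalization A)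
    (κ : ℝ) : Set ℝ :=
  {x | ∃ k ∈ Icc (-Real.pi) Real.pi, ∃ α β : Fin d,
    x = κ⁻¹ * (D.energy k α - D.energy k β).im}

/-- The velocity `v = κ⁻¹ max_{k,α,β} Im (ε_{k,α} - ε_{k,β})`. -/
def velocity {d : ℕ} {A : ℝ → Matrix (Fin d) (Fin d) ℂ} (D : Diagonalization A) (κ : ℝ) : ℝ :=
  sSup (relativeVelocities D κ)

end FreeFermion

end

/-! Why it is true: the segment matrix is compared with a matrix for which 1/2 is an exact
eigenvalue. Let `p` be the Bloch matrix of the evolved projector, so that the segment matrix is the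
block Toeplitz matrix of the Fourier coefficients of `p`. Close `l` cells to a ring, once with
periodic and once with antiperiodic boundary conditions, and let `ringMean` be the mean of the two
ring projectors.

Closeness. By Poisson summation the entries of `ringMean` are sums of Fourier coefficients of `p`
over images at distance `2 l m`; the term `m = 0` is the Toeplitz entry, and the other images lie
farther than `l` away. Moving the contour to `Im k = κ` bounds the coefficients by a constant times
`exp (-κ |n|)`. The Schur test then gives a distance of at most that constant times `exp (-κ l) /
sinh κ` (`norm_toeplitz_sub_ringMean_le`). In the biorthogonal eigenbasis each pair of bands
contributes a factor `exp (t Im (ε_α - ε_β))`, whence the velocity and the prefactor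
(`norm_evolvedExtension_le`). A self-adjoint matrix that close to one with eigenvalue 1/2 has an
eigenvalue equally near 1/2 (`sInf_abs_sub_le`).

Exact eigenvalue. With `Q = 1 - 2 P` on each ring, `ringMean - 1/2` is `-1/4` times the sum of the
two flat-band Hamiltonians, so this sum has to be singular. In the real structure fixed by the
particle-hole conjugation the two ground states have opposite fermion parities: both flat
Hamiltonians are conjugate to the same matrix `M`, by real intertwiners with determinants of
opposite signs. If `Q + Q' = Q (1 + Q Q')` were invertible, `1 + Q Q'` would be a real intertwiner
of positive determinant between them. That is impossible, since real matrices commuting with `M`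
have nonnegative determinant (`det_add_eq_zero_of_intertwiners`).

Parity. Intertwiners on the rings are assembled from momentum-space ones `V k`. Momenta `k` and `-k`
contribute complex conjugate determinants, and over the two rings together only `k = 0` and `k = π`
stay unpaired. The sign is thus that of a real intertwiner from `k = 0` to `k = π`, which is the
sign of the Pfaffian ratio (`det_re_neg_of_pfaffian_div_neg`). Time evolution at these two momenta
is real with positive determinant and leaves the sign alone. -/

noncomputable section

namespace FreeFermion

/-! ### Pfaffians under congruence. -/

section Pfaffian

variable {d : ℕ}

/-- For even `d`, the pairing `(i, 0) ↦ 2 i`, `(i, 1) ↦ 2 i + 1`. -/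
def pairingEquiv (hd : Even d) : Fin (d / 2) × Fin 2 ≃ Fin d :=
  finProdFinEquiv.trans (finCongr (Nat.div_mul_cancel hd.two_dvd))

lemma pairingEquiv_zero (hd : Even d) (i : Fin (d / 2)) :
    pairingEquiv hd (i, 0) = ⟨2 * (i : ℕ), by have := i.isLt; omega⟩ := by
  ext; simp [pairingEquiv, finProdFinEquiv]

lemma pairingEquiv_one (hd : Even d) (i : Fin (d / 2)) :
    pairingEquiv hd (i, 1) = ⟨2 * (i : ℕ) + 1, by have := i.isLt; omega⟩ := by
  ext; simp [pairingEquiv, finProdFinEquiv]; omega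

lemma pfaffian_eq_sum (hd : Even d) (A : Matrix (Fin d) (Fin d) ℂ) :
    pfaffian A = (1 / ((2 : ℂ) ^ (d / 2) * (Nat.factorial (d / 2) : ℂ))) *
      ∑ σ : Equiv.Perm (Fin d), ((Equiv.Perm.sign σ : ℤ) : ℂ) *
        ∏ i : Fin (d / 2), A (σ (pairingEquiv hd (i, 0))) (σ (pairingEquiv hd (i, 1))) := by
  simp only [pfaffian, if_pos hd, pairingEquiv_zero, pairingEquiv_one]

lemma sum_sign_mul_prod_submatrix (B : Matrix (Fin d) (Fin d) ℂ) (f : Fin d → Fin d) :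
    ∑ σ : Equiv.Perm (Fin d), ((Equiv.Perm.sign σ : ℤ) : ℂ) * ∏ r, B (σ r) (f r) =
      (B.submatrix id f).det := by
  simp [Matrix.det_apply']

/-- A non-injective `f` repeats a column and contributes nothing; a bijective one only permutes the
columns of `B`. This is the Cauchy–Binet step of the congruence formula. -/
lemma sum_mul_det_submatrix (B : Matrix (Fin d) (Fin d) ℂ) (w : (Fin d → Fin d) → ℂ) :
    ∑ f : Fin d → Fin d, w f * (B.submatrix id f).det =
      B.det * ∑ σ : Equiv.Perm (Fin d), ((Equiv.Perm.sign σ : ℤ) : ℂ) * w σ := by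
  classical
  rw [← Finset.sum_filter_of_ne (p := Function.Bijective), Finset.mul_sum]
  · refine Finset.sum_bij (fun f hf => Equiv.ofBijective f (Finset.mem_filter.1 hf).2) (by simp)
      (fun f _ g _ h => ?_) (fun σ _ => ⟨σ, Finset.mem_filter.2 ⟨Finset.mem_univ _, σ.bijective⟩, by ext; rfl⟩) (fun f hf => ?_)
    · exact congrArg (fun e : Equiv.Perm (Fin d) => (e : Fin d → Fin d)) h
    · have := Matrix.det_permute' (Equiv.ofBijective f (Finset.mem_filter.1 hf).2) B
      simp only [Equiv.coe_ofBijective] at this ⊢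
      rw [this]; ring
  · intro f _ hf
    refine Finite.injective_iff_bijective.1 fun i j hij => ?_
    by_contra hne
    exact hf (by rw [Matrix.det_zero_of_column_eq hne (by simp [hij]), mul_zero])

/-- Expanding every entry of `B * A * Bᵀ` collects all inner indices into one function `f`; the
signed sum over `σ` is then the determinant of the columns `f` of `B`. Skewness of `A` plays no role
for the defining sum. -/
theorem pfaffian_mul_mul_transpose (A B : Matrix (Fin d) (Fin d) ℂ) :
    pfaffian (B * A * Bᵀ) = B.det * pfaffian A := by
  by_cases hd : Even d
  swap
  · simp [pfaffian, hd]
  classical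
  rw [pfaffian_eq_sum hd, pfaffian_eq_sum hd, mul_left_comm]
  set e := pairingEquiv hd
  congr 1
  have hentry : ∀ x y : Fin d, (B * A * Bᵀ) x y =
      ∑ p : Fin 2 → Fin d, A (p 0) (p 1) * (B x (p 0) * B y (p 1)) := by
    intro x y
    rw [← (finTwoArrowEquiv (Fin d)).symm.sum_comp, Fintype.sum_prod_type]
    simp only [Matrix.mul_apply, Matrix.transpose_apply, Finset.sum_mul, finTwoArrowEquiv]
    rw [Finset.sum_comm]
    refine Finset.sum_congr rfl fun p _ => Finset.sum_congr rfl fun q _ => ?_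
    simp; ring
  have hfun : ∀ G : (Fin (d / 2) → Fin 2 → Fin d) → ℂ, ∑ F, G F =
      ∑ f : Fin d → Fin d, G (fun i j => f (e (i, j))) := by
    intro G
    rw [← ((e.symm.arrowCongr (Equiv.refl (Fin d))).trans
      (Equiv.curry (Fin (d / 2)) (Fin 2) (Fin d))).sum_comp]
    rfl
  calc _ = ∑ σ : Equiv.Perm (Fin d), ((Equiv.Perm.sign σ : ℤ) : ℂ) *
        ∑ f : Fin d → Fin d, (∏ i, A (f (e (i, 0))) (f (e (i, 1)))) * ∏ r, B (σ r) (f r) := by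
        refine Finset.sum_congr rfl fun σ _ => ?_
        congr 1
        simp only [hentry]
        rw [Finset.prod_univ_sum, Fintype.piFinset_univ, hfun]
        refine Finset.sum_congr rfl fun f _ => ?_
        rw [Finset.prod_mul_distrib, ← e.prod_comp, Fintype.prod_prod_type]
        simp [Fin.prod_univ_two]
    _ = ∑ f : Fin d → Fin d,
        (∏ i, A (f (e (i, 0))) (f (e (i, 1)))) * (B.submatrix id f).det := by
        simp only [Finset.mul_sum, ← sum_sign_mul_prod_submatrix]
        rw [Finset.sum_comm]
        refine Finset.sum_congr rfl fun f _ => Finset.sum_congr rfl fun σ _ => ?_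
        ring
    _ = _ := sum_mul_det_submatrix B fun f => ∏ i, A (f (e (i, 0))) (f (e (i, 1)))

end Pfaffian

/-! ### Real structure of an antiunitary conjugation, and signs of real determinants. -/

section RealStructure

variable {n : Type*} [Fintype n] [DecidableEq n]

/-- The conjugation `X ↦ W X̄ W†` by the antiunitary operator `W 𝒦`. -/
def antiunitaryConj (W : Matrix.unitaryGroup n ℂ) : Matrix n n ℂ →⋆ₐ[ℝ] Matrix n n ℂ where
  toFun X := (W : Matrix n n ℂ) * X.map star * (W : Matrix n n ℂ)ᴴ
  map_one' := by
    rw [Matrix.map_one _ (star_zero _) (star_one _), mul_one]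
    exact Unitary.coe_mul_star_self W
  map_mul' X Y := by
    have h : (W : Matrix n n ℂ)ᴴ * (W : Matrix n n ℂ) = 1 := Unitary.coe_star_mul_self W
    have : (X * Y).map star = X.map star * Y.map star := Matrix.map_mul (f := starRingEnd ℂ)
    rw [this]
    simp only [mul_assoc]
    rw [← mul_assoc (W : Matrix n n ℂ)ᴴ, h, one_mul]
  map_zero' := by simp [Matrix.map_zero]
  map_add' X Y := by
    have : (X + Y).map star = X.map star + Y.map star := Matrix.map_add _ (star_add) X Y
    rw [this, mul_add, add_mul]
  commutes' r := by
    have h : (W : Matrix n n ℂ) * (W : Matrix n n ℂ)ᴴ = 1 := Unitary.coe_mul_star_self W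
    have : (algebraMap ℝ (Matrix n n ℂ) r).map star = algebraMap ℝ (Matrix n n ℂ) r := by
      ext i j
      by_cases hij : i = j <;> simp [Matrix.algebraMap_matrix_apply, hij]
    rw [this, ← Algebra.commutes, mul_assoc, h, mul_one]
  map_star' X := by
    simp only [Matrix.star_eq_conjTranspose, Matrix.conjTranspose_mul,
      Matrix.conjTranspose_conjTranspose, mul_assoc]
    rfl

variable (W : Matrix.unitaryGroup n ℂ)

lemma antiunitaryConj_apply (X : Matrix n n ℂ) :
    antiunitaryConj W X = (W : Matrix n n ℂ) * X.map star * (W : Matrix n n ℂ)ᴴ := rfl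

lemma antiunitaryConj_smul (c : ℂ) (X : Matrix n n ℂ) :
    antiunitaryConj W (c • X) = star c • antiunitaryConj W X := by
  have : (c • X).map star = star c • X.map star := by ext; simp
  rw [antiunitaryConj_apply, this, mul_smul_comm, smul_mul_assoc, antiunitaryConj_apply]

lemma det_antiunitaryConj (X : Matrix n n ℂ) :
    (antiunitaryConj W X).det = star X.det := by
  have h : (W : Matrix n n ℂ) * (W : Matrix n n ℂ)ᴴ = 1 := Unitary.coe_mul_star_self W
  have h' : (X.map star).det = star X.det := by
    have := (RingHom.map_det (starRingEnd ℂ) X)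
    exact this.symm
  rw [antiunitaryConj_apply, Matrix.det_mul_right_comm, h, one_mul, h']

lemma continuous_antiunitaryConj : Continuous (antiunitaryConj W) := by
  have : FiniteDimensional ℝ (Matrix n n ℂ) := Module.Finite.trans ℂ _
  exact (antiunitaryConj W).toAlgHom.toLinearMap.continuous_of_finiteDimensional

variable {W}

lemma antiunitaryConj_antiunitaryConj (hW : (W : Matrix n n ℂ) * (W : Matrix n n ℂ).map star = 1)
    (X : Matrix n n ℂ) : antiunitaryConj W (antiunitaryConj W X) = X := by
  have h : ∀ A B : Matrix n n ℂ, (A * B).map star = A.map star * B.map star :=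
    fun A B => Matrix.map_mul (f := starRingEnd ℂ)
  have h1 : (X.map star).map star = X := by ext; simp
  have h2 : ((W : Matrix n n ℂ)ᴴ).map star * (W : Matrix n n ℂ)ᴴ = 1 := by
    have h3 := congrArg Matrix.conjTranspose hW
    rwa [Matrix.conjTranspose_mul, Matrix.conjTranspose_one] at h3
  rw [antiunitaryConj_apply, antiunitaryConj_apply, h, h, h1]
  rw [show (W : Matrix n n ℂ) * ((W : Matrix n n ℂ).map star * X * ((W : Matrix n n ℂ)ᴴ).map star)
    * (W : Matrix n n ℂ)ᴴ = ((W : Matrix n n ℂ) * (W : Matrix n n ℂ).map star) * X *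
      (((W : Matrix n n ℂ)ᴴ).map star * (W : Matrix n n ℂ)ᴴ) by simp only [mul_assoc]]
  rw [hW, h2, one_mul, mul_one]

lemma det_eq_ofReal_of_antiunitaryConj_eq {X : Matrix n n ℂ} (h : antiunitaryConj W X = X) :
    X.det = (X.det.re : ℂ) :=
  (Complex.conj_eq_iff_re.1 ((det_antiunitaryConj W X).symm.trans (congrArg _ h))).symm

/-- `i M` is a real complex structure, so a real `X` commuting with it is complex linear and its
determinant is the squared modulus of a complex one. Concretely, `X` is the product of its parts on
the two eigenspaces of `M`, each completed by the identity; the conjugation swaps these factors. -/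
lemma det_re_nonneg_of_commute {X M : Matrix n n ℂ} (hM : M * M = 1)
    (hMW : antiunitaryConj W M = -M) (hX : antiunitaryConj W X = X) (hXM : X * M = M * X) :
    0 ≤ X.det.re := by
  set P : Matrix n n ℂ := (2⁻¹ : ℝ) • (1 - M) with hP
  have hPP : P * P = P := by
    rw [hP, smul_mul_smul_comm, sub_mul, mul_sub, mul_sub, hM, mul_one, one_mul, mul_one]
    module
  have hXP : X * P = P * X := by
    simp [hP, mul_sub, sub_mul, hXM]
  have hPW : antiunitaryConj W P = 1 - P := by
    rw [hP, map_smul, map_sub, map_one, hMW]; module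
  have h0 : P * (1 - P) = 0 := by rw [mul_sub, mul_one, hPP, sub_self]
  have h0' : (1 - P) * P = 0 := by rw [sub_mul, one_mul, hPP, sub_self]
  have h1' : (1 - P) * (1 - P) = 1 - P := by rw [sub_mul, one_mul, h0, sub_zero]
  have hXP' : X * (1 - P) = (1 - P) * X := by rw [mul_sub, sub_mul, hXP, one_mul, mul_one]
  have hfac : X = (X * P + (1 - P)) * (X * (1 - P) + P) := by
    rw [add_mul, mul_add, mul_add, h0', hXP', ← mul_assoc (1 - P), h1', mul_assoc X P P, hPP,
      mul_assoc X P, ← mul_assoc P, h0]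
    rw [zero_mul, mul_zero, zero_add, add_zero, hXP]
    noncomm_ring
  have hc : antiunitaryConj W (X * P + (1 - P)) = X * (1 - P) + P := by
    rw [map_add, map_mul, map_sub, map_one, hX, hPW]; abel
  have hd := det_antiunitaryConj W (X * P + (1 - P))
  rw [hc] at hd
  rw [hfac, Matrix.det_mul, hd]
  exact (by simp [Complex.mul_conj, Complex.normSq_nonneg] :
    0 ≤ ((X * P + (1 - P)).det * (starRingEnd ℂ) (X * P + (1 - P)).det).re)

/-- Along `1 + s G` the determinant is real, starts at 1, and cannot vanish for `s < 1` because `‖s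
G‖ < 1`. -/
lemma det_one_add_re_nonneg [Nonempty n] {G : Matrix n n ℂ} (hG : G ∈ Matrix.unitaryGroup n ℂ)
    (hGW : antiunitaryConj W G = G) : 0 ≤ (1 + G).det.re := by
  by_contra! hneg
  set f : ℝ → ℝ := fun s => (1 + s • G).det.re with hf
  have hcont : Continuous f := by
    refine Complex.continuous_re.comp (Continuous.matrix_det ?_)
    fun_prop
  have h0 : f 0 = 1 := by simp [hf]
  have h1 : f 1 < 0 := by simpa [hf] using hneg
  obtain ⟨s, hs, hs0⟩ := intermediate_value_Icc' zero_le_one hcont.continuousOn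
    (show (0 : ℝ) ∈ Icc (f 1) (f 0) from ⟨h1.le, by rw [h0]; exact zero_le_one⟩)
  have hs1 : s < 1 := lt_of_le_of_ne hs.2 fun h => by rw [h] at hs0; exact h1.ne hs0
  have hreal : antiunitaryConj W (1 + s • G) = 1 + s • G := by
    rw [map_add, map_one, map_smul, hGW]
  have hdet : (1 + s • G).det = 0 := by
    rw [det_eq_ofReal_of_antiunitaryConj_eq hreal]
    exact_mod_cast hs0
  have hunit : IsUnit (1 + s • G) := by
    have : ‖-(s • G)‖ < 1 := by
      rw [norm_neg, norm_smul, CStarRing.norm_of_mem_unitary hG, mul_one, Real.norm_eq_abs,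
        abs_of_nonneg hs.1]
      exact hs1
    simpa using isUnit_one_sub_of_norm_lt_one this
  exact ((Matrix.isUnit_iff_isUnit_det _).1 hunit).ne_zero hdet

/-- Two flat-band Hamiltonians that are conjugate to a common one by real intertwiners with
determinants of opposite signs have a singular sum. -/
theorem det_add_eq_zero_of_intertwiners [Nonempty n] {Q Q' M g g' : Matrix n n ℂ}
    (hQ : Q * Q = 1) (hQh : star Q = Q) (hQW : antiunitaryConj W Q = -Q)
    (hQ' : Q' * Q' = 1) (hQh' : star Q' = Q') (hQW' : antiunitaryConj W Q' = -Q')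
    (hM : M * M = 1) (hMW : antiunitaryConj W M = -M)
    (hg : antiunitaryConj W g = g) (hgM : g * M = Q * g)
    (hg' : antiunitaryConj W g' = g') (hgM' : g' * M = Q' * g')
    (hdet : (g.det * g'.det).re < 0) : (Q + Q').det = 0 := by
  set Z := 1 + Q * Q' with hZ
  have hGu : Q * Q' ∈ Matrix.unitaryGroup n ℂ := by
    rw [Matrix.mem_unitaryGroup_iff, star_mul, hQh, hQh', mul_assoc, ← mul_assoc Q', hQ', one_mul,
      hQ]
  have hGW : antiunitaryConj W (Q * Q') = Q * Q' := by
    rw [map_mul, hQW, hQW', neg_mul_neg]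
  have hZpos := det_one_add_re_nonneg hGu hGW
  have hZW : antiunitaryConj W Z = Z := by rw [hZ, map_add, map_one, hGW]
  -- Together with `hZQ` this gives `Q Z = Z Q'`. Hence `g⁻¹ * Z * g'` is real and commutes with
  -- `M`, so its determinant is nonnegative.
  have hQZ : Q * Z = Q + Q' := by rw [hZ, mul_add, mul_one, ← mul_assoc, hQ, one_mul]
  have hZQ : Z * Q' = Q + Q' := by
    rw [hZ, add_mul, one_mul, mul_assoc, hQ', mul_one, add_comm]
  rw [← hQZ, Matrix.det_mul]
  suffices Z.det = 0 by rw [this, mul_zero]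
  have hgr := det_eq_ofReal_of_antiunitaryConj_eq hg
  have hgr' := det_eq_ofReal_of_antiunitaryConj_eq hg'
  have hZr := det_eq_ofReal_of_antiunitaryConj_eq hZW
  rw [hgr, hgr', ← Complex.ofReal_mul, Complex.ofReal_re] at hdet
  have hgu : IsUnit g.det := by
    rw [isUnit_iff_ne_zero, hgr]
    rintro h
    rw [Complex.ofReal_eq_zero] at h
    simp [h] at hdet
  have h1 : g * g⁻¹ = 1 := Matrix.mul_nonsing_inv _ hgu
  have h2 : g⁻¹ * g = 1 := Matrix.nonsing_inv_mul _ hgu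
  have hinvW : antiunitaryConj W g⁻¹ = g⁻¹ := by
    calc antiunitaryConj W g⁻¹ = antiunitaryConj W g⁻¹ * (g * g⁻¹) := by rw [h1, mul_one]
      _ = antiunitaryConj W (g⁻¹ * g) * g⁻¹ := by rw [map_mul, hg, mul_assoc]
      _ = g⁻¹ := by rw [h2, map_one, one_mul]
  have hginv : g⁻¹ * Q = M * g⁻¹ := by
    calc g⁻¹ * Q = g⁻¹ * (Q * g) * g⁻¹ := by rw [mul_assoc, mul_assoc, h1, mul_one]
      _ = M * g⁻¹ := by rw [← hgM, ← mul_assoc, h2, one_mul]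
  have hcomm : (g⁻¹ * Z * g') * M = M * (g⁻¹ * Z * g') := by
    calc (g⁻¹ * Z * g') * M = g⁻¹ * (Z * (g' * M)) := by simp only [mul_assoc]
      _ = g⁻¹ * ((Z * Q') * g') := by rw [hgM', mul_assoc]
      _ = g⁻¹ * Q * Z * g' := by rw [hZQ, ← hQZ]; simp only [mul_assoc]
      _ = _ := by rw [hginv]; simp only [mul_assoc]
  have hnn := det_re_nonneg_of_commute (W := W) hM hMW
    (by rw [map_mul, map_mul, hinvW, hZW, hg'] : antiunitaryConj W (g⁻¹ * Z * g') = _) hcomm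
  have hdetprod : g.det * (g⁻¹ * Z * g').det = Z.det * g'.det := by
    rw [← Matrix.det_mul, ← mul_assoc, ← mul_assoc, h1, one_mul, Matrix.det_mul]
  have hhr := det_eq_ofReal_of_antiunitaryConj_eq
    (by rw [map_mul, map_mul, hinvW, hZW, hg'] : antiunitaryConj W (g⁻¹ * Z * g') = _)
  rw [hgr, hhr, hgr', hZr] at hdetprod
  have hdp : g.det.re * (g⁻¹ * Z * g').det.re = Z.det.re * g'.det.re := by exact_mod_cast hdetprod
  rw [hZr]
  norm_cast
  have hZpos' : 0 ≤ Z.det.re := hZpos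
  generalize g.det.re = a at *
  generalize g'.det.re = b at *
  generalize (g⁻¹ * Z * g').det.re = c at *
  generalize Z.det.re = z at *
  by_contra hz
  have hz' : 0 < z := lt_of_le_of_ne hZpos' (Ne.symm hz)
  -- The left side is nonnegative, while `z > 0` and `a * b < 0` make the right side negative.
  have : a * a * c = z * (a * b) := by linear_combination a * hdp
  nlinarith [mul_nonneg (mul_self_nonneg a) hnn, mul_neg_of_pos_of_neg hz' hdet]

/-- A complex intertwiner can be replaced by a real one. -/
lemma exists_real_intertwiner (hW : (W : Matrix n n ℂ) * (W : Matrix n n ℂ).map star = 1)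
    {M Q V : Matrix n n ℂ} (hMW : antiunitaryConj W M = -M) (hQW : antiunitaryConj W Q = -Q)
    (hV : IsUnit V.det) (hVM : V * M = Q * V) :
    ∃ u : Matrix n n ℂ, IsUnit u.det ∧ antiunitaryConj W u = u ∧ u * M = Q * u := by
  set V' := antiunitaryConj W V with hV'
  have hVM' : V' * M = Q * V' := by
    have := congrArg (antiunitaryConj W) hVM
    rwa [map_mul, map_mul, hMW, hQW, mul_neg, neg_mul, neg_inj] at this
  have hV'W : antiunitaryConj W V' = V := antiunitaryConj_antiunitaryConj hW V
  -- `det (V + w V')` is a nonzero polynomial in `w`, so it has a non-root on the unit circle. A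
  -- square root `z` of that `w` makes `z̄ V + z V'` both invertible and real.
  set p : Polynomial ℂ := (V.map Polynomial.C + (Polynomial.X : Polynomial ℂ) •
    V'.map Polynomial.C).det with hp
  have heval : ∀ w : ℂ, p.eval w = (V + w • V').det := by
    intro w
    rw [hp, ← Polynomial.coe_evalRingHom, RingHom.map_det]
    congr 1
    ext i j
    simp
    exact mul_comm _ _
  have hp0 : p ≠ 0 := by
    intro h
    have := heval 0
    rw [h] at this
    simp at this
    exact hV.ne_zero this.symm
  have hinf : (Metric.sphere (0 : ℂ) 1).Infinite := by
    have hinj : Set.InjOn (fun t : ℝ => Complex.exp (t * Complex.I)) (Ioo 0 1) := by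
      intro x hx y hy hxy
      have := Complex.exp_inj_of_neg_pi_lt_of_le_pi (x := x * Complex.I) (y := y * Complex.I)
        (by simp; linarith [hx.1, Real.pi_pos]) (by simp; linarith [hx.2, Real.pi_gt_three])
        (by simp; linarith [hy.1, Real.pi_pos]) (by simp; linarith [hy.2, Real.pi_gt_three]) hxy
      simpa using this
    refine ((Ioo_infinite zero_lt_one).image hinj).mono ?_
    rintro _ ⟨t, -, rfl⟩
    simp [Complex.norm_exp_ofReal_mul_I]
  obtain ⟨w, hw, hwp⟩ : ∃ w ∈ Metric.sphere (0 : ℂ) 1, w ∉ p.rootSet ℂ :=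
    (hinf.sdiff (p.rootSet_finite ℂ)).nonempty
  have hw1 : ‖w‖ = 1 := by simpa using hw
  have hwdet : (V + w • V').det ≠ 0 := by
    rw [← heval]
    intro h
    exact hwp (by rw [Polynomial.mem_rootSet]; exact ⟨hp0, by simpa using h⟩)
  obtain ⟨z, hz⟩ : ∃ z : ℂ, z ^ 2 = w := IsAlgClosed.exists_pow_nat_eq w (by norm_num)
  have hz1 : ‖z‖ = 1 := by
    have : ‖z‖ ^ 2 = 1 := by rw [← norm_pow, hz, hw1]
    exact (pow_eq_one_iff_of_nonneg (norm_nonneg z) two_ne_zero).1 this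
  have hzz : star z * z = 1 := by
    have := Complex.normSq_eq_conj_mul_self (z := z)
    rw [Complex.normSq_eq_norm_sq, hz1] at this
    simpa using this.symm
  refine ⟨star z • V + z • V', ?_, ?_, ?_⟩
  · have : star z • V + z • V' = star z • (V + w • V') := by
      rw [smul_add, smul_smul, ← hz, sq, ← mul_assoc, hzz, one_mul]
    rw [this, Matrix.det_smul, isUnit_iff_ne_zero]
    refine mul_ne_zero (pow_ne_zero _ ?_) hwdet
    intro h
    rw [h, zero_mul] at hzz
    exact zero_ne_one hzz
  · rw [map_add, antiunitaryConj_smul, antiunitaryConj_smul, hV'W, star_star, ← hV', add_comm]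
  · rw [add_mul, smul_mul_assoc, smul_mul_assoc, hVM, hVM', mul_add, mul_smul_comm, mul_smul_comm]

/-- Continuous families of flat-band Hamiltonians are pointwise conjugate. -/
lemma exists_intertwiner_of_continuous {Q : ℝ → Matrix n n ℂ} (hcont : Continuous Q)
    (hQ : ∀ k, Q k * Q k = 1) (k k' : ℝ) :
    ∃ V : Matrix n n ℂ, IsUnit V.det ∧ V * Q k = Q k' * V := by
  set P : ℝ → ℝ → Prop := fun x y => ∃ V : Matrix n n ℂ, IsUnit V.det ∧ V * Q x = Q y * V
  have : Std.Symm P := by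
    constructor
    rintro x y ⟨V, hV, h⟩
    refine ⟨V⁻¹, Matrix.isUnit_nonsing_inv_det _ hV, ?_⟩
    calc V⁻¹ * Q y = V⁻¹ * (Q y * V) * V⁻¹ := by
          rw [mul_assoc, mul_assoc, Matrix.mul_nonsing_inv _ hV, mul_one]
      _ = Q x * V⁻¹ := by rw [← h, ← mul_assoc, Matrix.nonsing_inv_mul _ hV, one_mul]
  -- For `y` near `x` the matrix `1 + Q y * Q x` is an intertwiner, invertible because it equals 2
  -- at `y = x`. Symmetry, transitivity and connectedness of the line make this global.
  refine PreconnectedSpace.induction₂ P ?_ ⟨?_⟩ k k'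
  · intro x
    have hc : Continuous fun y => (1 + Q y * Q x).det := by
      refine Continuous.matrix_det ?_
      fun_prop
    have hx : (1 + Q x * Q x).det ≠ 0 := by
      rw [hQ x, ← two_smul ℂ, Matrix.det_smul]
      simp
    filter_upwards [hc.continuousAt.eventually_ne hx] with y hy
    refine ⟨1 + Q y * Q x, isUnit_iff_ne_zero.2 hy, ?_⟩
    rw [add_mul, mul_add, mul_assoc, hQ x, ← mul_assoc, hQ y]
    simp [add_comm]
  · rintro x y z ⟨V, hV, h⟩ ⟨V', hV', h'⟩
    refine ⟨V' * V, by rw [Matrix.det_mul]; exact hV'.mul hV, ?_⟩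
    rw [mul_assoc, h, ← mul_assoc, h', mul_assoc]

end RealStructure

/-! ### Spectral projections in the presence of a gap. -/

section FermiProjector

lemma isSelfAdjoint_fermiProjector {A : Type*} [CStarAlgebra A] (a : A) :
    IsSelfAdjoint (fermiProjector a) := cfc_predicate _ _

/-- A gap is what makes the step function continuous on the spectrum; without continuity `cfc` takes
its default value. -/
lemma continuousOn_indicator_neg {s : Set ℝ} (hs : (0 : ℝ) ∉ s) :
    ContinuousOn (fun x : ℝ => if x < 0 then (1 : ℝ) else 0) s := by
  intro x hx
  refine ContinuousAt.continuousWithinAt ?_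
  rcases lt_trichotomy x 0 with h | h | h
  · refine (continuousAt_const (y := (1 : ℝ))).congr ?_
    filter_upwards [eventually_lt_nhds h] with y hy
    rw [if_pos hy]
  · exact absurd (h ▸ hx) hs
  · refine (continuousAt_const (y := (0 : ℝ))).congr ?_
    filter_upwards [eventually_gt_nhds h] with y hy
    rw [if_neg hy.not_gt]

lemma fermiProjector_mul_self {A : Type*} [CStarAlgebra A] {a : A}
    (h0 : (0 : ℝ) ∉ spectrum ℝ a) : fermiProjector a * fermiProjector a = fermiProjector a := by
  have := continuousOn_indicator_neg h0
  rw [fermiProjector, ← cfc_mul _ _ a]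
  congr 1
  ext x
  split_ifs <;> simp

/-- Linearity over `ℝ` is enough for the real functional calculus, so this applies to the antilinear
conjugation as well. -/
lemma map_fermiProjector {A B F : Type*} [CStarAlgebra A] [CStarAlgebra B]
    [FunLike F A B] [AlgHomClass F ℝ A B] [StarHomClass F A B] (φ : F) (hφ : Continuous φ) {a : A}
    (ha : IsSelfAdjoint a) (h0 : (0 : ℝ) ∉ spectrum ℝ a) :
    φ (fermiProjector a) = fermiProjector (φ a) :=
  StarAlgHomClass.map_cfc (S := ℝ) φ _ a (continuousOn_indicator_neg h0) hφ ha (ha.map φ)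

lemma fermiProjector_neg {A : Type*} [CStarAlgebra A] {a : A} (ha : IsSelfAdjoint a)
    (h0 : (0 : ℝ) ∉ spectrum ℝ a) : fermiProjector (-a) = 1 - fermiProjector a := by
  have hc := continuousOn_indicator_neg h0
  have hc' : ContinuousOn (fun x : ℝ => if x < 0 then (1 : ℝ) else 0)
      ((fun x => -x) '' spectrum ℝ a) := by
    refine continuousOn_indicator_neg ?_
    rintro ⟨x, hx, hx0⟩
    exact h0 (by rwa [neg_eq_zero.1 hx0] at hx)
  rw [fermiProjector, fermiProjector, ← cfc_comp_neg _ a hc', ← cfc_const_one ℝ a, ← cfc_sub ..]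
  refine cfc_congr fun x hx => ?_
  have hx0 : x ≠ 0 := fun h => h0 (h ▸ hx)
  rcases hx0.lt_or_gt with h | h
  · simp [h, h.le]
  · simp [h, h.le.not_gt]

end FermiProjector

/-! ### The sign of the Pfaffian depends only on the Fermi sea. -/

section PfaffianSign

variable {n : Type*} [Fintype n] [DecidableEq n]

/-- The spectrum of a matrix is finite, so steps and square roots alike are admissible in its
functional calculus. -/
lemma continuousOn_matrix_spectrum (f : ℝ → ℝ) (A : Matrix n n ℂ) :
    ContinuousOn f (spectrum ℝ A) := (Matrix.finite_real_spectrum (A := A)).continuousOn f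

/-- `1 - 2 P_<`, which flattens the bands of a gapped Hamiltonian. -/
def flatten {A : Type*} [CStarAlgebra A] (a : A) : A := 1 - (2 : ℝ) • fermiProjector a

variable {W : Matrix.unitaryGroup n ℂ}

/-- The conjugation commutes with the functional calculus, and the sign in `-B` exchanges filled and
empty bands. -/
lemma antiunitaryConj_fermiProjector {A B : Matrix n n ℂ} (hA : IsSelfAdjoint A)
    (hA0 : IsUnit A) (hB : antiunitaryConj W A = -B) :
    antiunitaryConj W (fermiProjector A) = 1 - fermiProjector B := by
  have hB' : IsSelfAdjoint B := by
    have := hA.map (antiunitaryConj W)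
    rw [hB] at this
    simpa using this.neg
  have hB0 : IsUnit B := by
    have := hA0.map (antiunitaryConj W)
    rw [hB] at this
    exact (IsUnit.neg_iff B).1 this
  rw [map_fermiProjector _ (continuous_antiunitaryConj W) hA
    ((spectrum.zero_notMem_iff ℝ).2 hA0), hB, fermiProjector_neg hB'
    ((spectrum.zero_notMem_iff ℝ).2 hB0)]

/-- A nonnegative function of `A` is `X† X` with `X` the cfc of its square root, so its determinant
is `|det X|²`. -/
lemma det_cfc_re_nonneg {f : ℝ → ℝ} (hf : ∀ x, 0 ≤ f x) (A : Matrix n n ℂ) :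
    (cfc f A).det = (((cfc f A).det.re : ℝ) : ℂ) ∧ 0 ≤ (cfc f A).det.re := by
  have hsq : cfc f A = star (cfc (fun x => √(f x)) A) * cfc (fun x => √(f x)) A := by
    rw [(cfc_predicate (fun x => √(f x)) A : IsSelfAdjoint _).star_eq,
      ← cfc_mul _ _ A (continuousOn_matrix_spectrum _ _) (continuousOn_matrix_spectrum _ _)]
    simp only [Real.mul_self_sqrt (hf _)]
  rw [hsq, Matrix.det_mul, Matrix.star_eq_conjTranspose, Matrix.det_conjTranspose]
  have := Complex.normSq_eq_conj_mul_self (z := (cfc (fun x => √(f x)) A).det)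
  rw [show star (cfc (fun x => √(f x)) A).det = (starRingEnd ℂ) (cfc (fun x => √(f x)) A).det
    from rfl, ← this]
  simp [Complex.normSq_nonneg]

/-- This turns the congruence `X (A W) Xᵀ` by a real `X` into `(X A X†) W`, to which the Pfaffian
formula applies. `W W̄ = 1` makes the unitary `W` symmetric. -/
lemma conjTranspose_mul_eq (hW : (W : Matrix n n ℂ) * (W : Matrix n n ℂ).map star = 1)
    {X : Matrix n n ℂ} (hX : antiunitaryConj W X = X) :
    Xᴴ * (W : Matrix n n ℂ) = (W : Matrix n n ℂ) * Xᵀ := by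
  have h : (W : Matrix n n ℂ)ᴴ * (W : Matrix n n ℂ) = 1 := Unitary.coe_star_mul_self W
  have h2 : (W : Matrix n n ℂ)ᵀ = (W : Matrix n n ℂ) := by
    have h3 : (W : Matrix n n ℂ).map star = (W : Matrix n n ℂ)ᴴ := by
      calc (W : Matrix n n ℂ).map star
          = (W : Matrix n n ℂ)ᴴ * ((W : Matrix n n ℂ) * (W : Matrix n n ℂ).map star) := by
            rw [← mul_assoc, h, one_mul]
        _ = _ := by rw [hW, mul_one]
    have h4 := congrArg Matrix.conjTranspose h3
    rw [Matrix.conjTranspose_conjTranspose] at h4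
    exact Eq.trans (by ext; simp) h4
  have h5 : (W : Matrix n n ℂ) * X.map star = X * (W : Matrix n n ℂ) := by
    nth_rw 2 [← hX]
    rw [antiunitaryConj_apply, mul_assoc, h, mul_one]
  have h6 := congrArg Matrix.transpose h5
  rw [Matrix.transpose_mul, Matrix.transpose_mul, h2] at h6
  rw [← h6]; congr 1

/-- Up to a congruence by a real matrix with positive determinant, the Pfaffian sees only the
Fermi sea of a gapped Hamiltonian. -/
lemma exists_pos_pfaffian_eq {d : ℕ} {W : Matrix.unitaryGroup (Fin d) ℂ}
    (hW : (W : Matrix (Fin d) (Fin d) ℂ) * (W : Matrix (Fin d) (Fin d) ℂ).map star = 1)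
    {A Q : Matrix (Fin d) (Fin d) ℂ} (f : ℝ → ℝ) (hf : ∀ x, 0 ≤ f x)
    (hdet : IsUnit (cfc f A))
    (hfW : antiunitaryConj W (cfc f A) = cfc f A) (hQ : cfc f A * Q = Q * cfc f A) :
    ∃ r : ℝ, 0 < r ∧ pfaffian (cfc f A * cfc f A * Q * (W : Matrix (Fin d) (Fin d) ℂ)) =
      r * pfaffian (Q * (W : Matrix (Fin d) (Fin d) ℂ)) := by
  obtain ⟨h1, h2⟩ := det_cfc_re_nonneg hf A
  refine ⟨(cfc f A).det.re, lt_of_le_of_ne h2 fun h => ?_, ?_⟩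
  · rw [← h] at h1
    exact ((Matrix.isUnit_iff_isUnit_det _).1 hdet).ne_zero (by simpa using h1)
  · rw [← h1, ← pfaffian_mul_mul_transpose]
    congr 1
    have hs : (cfc f A)ᴴ = cfc f A := (cfc_predicate f A : IsSelfAdjoint _).star_eq
    have := conjTranspose_mul_eq hW hfW
    rw [hs] at this
    rw [mul_assoc (cfc f A), hQ, mul_assoc, mul_assoc, mul_assoc, this]
    simp only [mul_assoc]

lemma flatten_eq_cfc {A : Matrix n n ℂ} (hA : IsSelfAdjoint A) :
    flatten A = cfc (fun x : ℝ => if x < 0 then -1 else 1) A := by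
  rw [flatten, fermiProjector, ← cfc_const_one ℝ A, ← cfc_const_mul _ _ _
    (continuousOn_matrix_spectrum _ _), ← cfc_sub _ _ _ (continuousOn_matrix_spectrum _ _)
    (continuousOn_matrix_spectrum _ _)]
  congr 1
  ext x
  split_ifs <;> norm_num

lemma isUnit_cfc_of_forall_ne {A : Matrix n n ℂ} (hA : IsSelfAdjoint A) {f : ℝ → ℝ}
    (hf : ∀ x ∈ spectrum ℝ A, f x ≠ 0) : IsUnit (cfc f A) :=
  (isUnit_cfc_iff f A (continuousOn_matrix_spectrum _ _)).2 hf

lemma antiunitaryConj_cfc {A : Matrix n n ℂ} (hA : IsSelfAdjoint A) (f : ℝ → ℝ) :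
    antiunitaryConj W (cfc f A) = cfc f (antiunitaryConj W A) :=
  StarAlgHomClass.map_cfc (S := ℝ) _ f A (continuousOn_matrix_spectrum _ _)
    (continuous_antiunitaryConj W) hA (hA.map _)

/-- The Pfaffian of a gapped Hamiltonian has the sign of that of its flat-band version. -/
lemma exists_pos_pfaffian_eq_flatten {d : ℕ} {W : Matrix.unitaryGroup (Fin d) ℂ}
    (hW : (W : Matrix (Fin d) (Fin d) ℂ) * (W : Matrix (Fin d) (Fin d) ℂ).map star = 1)
    {A : Matrix (Fin d) (Fin d) ℂ} (hA : IsSelfAdjoint A) (hA0 : IsUnit A)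
    (hAW : antiunitaryConj W A = -A) :
    ∃ r : ℝ, 0 < r ∧ pfaffian (A * (W : Matrix (Fin d) (Fin d) ℂ)) =
      r * pfaffian (flatten A * (W : Matrix (Fin d) (Fin d) ℂ)) := by
  have hc := fun f => continuousOn_matrix_spectrum f A
  have h := exists_pos_pfaffian_eq (A := A) (Q := flatten A) hW (fun x => √|x|)
    (fun x => Real.sqrt_nonneg _) (isUnit_cfc_of_forall_ne hA fun x hx => by
      have : x ≠ 0 := fun h => (spectrum.zero_notMem_iff ℝ).2 hA0 (h ▸ hx)
      positivity) ?_ ?_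
  -- `x = √|x| · √|x| · sgn x`, applied to the spectrum.
  · have hfac : cfc (fun x : ℝ => √|x|) A * cfc (fun x : ℝ => √|x|) A * flatten A = A := by
      rw [flatten_eq_cfc hA, ← cfc_mul _ _ _ (hc _) (hc _), ← cfc_mul _ _ _ (hc _) (hc _)]
      conv_rhs => rw [← cfc_id ℝ A]
      refine cfc_congr fun x _ => ?_
      simp only [id, Real.mul_self_sqrt (abs_nonneg x)]
      split_ifs with hx
      · rw [abs_of_neg hx]; ring
      · rw [abs_of_nonneg (not_lt.1 hx)]; ring
    rwa [hfac] at h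
  · rw [antiunitaryConj_cfc hA, hAW, ← cfc_comp_neg (fun x : ℝ => √|x|) A
      ((A.finite_real_spectrum.image _).continuousOn _)]
    simp only [abs_neg]
  · rw [flatten_eq_cfc hA]
    exact (cfc_commute_cfc (fun x : ℝ => √|x|) (fun x : ℝ => if x < 0 then -1 else 1) A).eq

/-- The sign of the determinant of a real intertwiner between the Fermi seas of two gapped
Hamiltonians is that of the ratio of their Pfaffians. -/
theorem det_re_neg_of_pfaffian_div_neg {d : ℕ} {W : Matrix.unitaryGroup (Fin d) ℂ}
    (hW : (W : Matrix (Fin d) (Fin d) ℂ) * (W : Matrix (Fin d) (Fin d) ℂ).map star = 1)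
    {A B u : Matrix (Fin d) (Fin d) ℂ} (hA : IsSelfAdjoint A) (hA0 : IsUnit A)
    (hAW : antiunitaryConj W A = -A) (hB : IsSelfAdjoint B) (hB0 : IsUnit B)
    (hBW : antiunitaryConj W B = -B) (hu : IsUnit u.det) (huW : antiunitaryConj W u = u)
    (huAB : u * flatten A = flatten B * u)
    (hneg : (pfaffian (A * (W : Matrix (Fin d) (Fin d) ℂ)) /
      pfaffian (B * (W : Matrix (Fin d) (Fin d) ℂ))).re < 0) : u.det.re < 0 := by
  obtain ⟨a, ha, hpa⟩ := exists_pos_pfaffian_eq_flatten hW hA hA0 hAW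
  obtain ⟨b, hb, hpb⟩ := exists_pos_pfaffian_eq_flatten hW hB hB0 hBW
  have hsa : ∀ X : Matrix (Fin d) (Fin d) ℂ, star (flatten X) = flatten X := fun X => by
    simp [flatten, (isSelfAdjoint_fermiProjector X).star_eq]
  -- This is `u u†`, written in the form `b† b` that has nonnegative spectrum. It commutes with
  -- `flatten B`, so its square root gives a congruence with positive determinant.
  set S := star (star u) * star u with hS
  have hSsa : IsSelfAdjoint S := IsSelfAdjoint.star_mul_self _
  have hadj : flatten A * star u = star u * flatten B := by
    have := congrArg star huAB
    rwa [star_mul, star_mul, hsa, hsa] at this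
  have hSB : S * flatten B = flatten B * S := by
    rw [hS, star_star, mul_assoc, ← hadj, ← mul_assoc, huAB, mul_assoc]
  have hSW : antiunitaryConj W S = S := by
    rw [hS, map_mul, map_star, map_star, huW]
  have hS0 : IsUnit S := by
    rw [Matrix.isUnit_iff_isUnit_det, hS, Matrix.det_mul, star_star]
    exact hu.mul (by rw [Matrix.star_eq_conjTranspose, Matrix.det_conjTranspose]; exact hu.star)
  have hc := fun f => continuousOn_matrix_spectrum f S
  have hSS : cfc (fun x => √|x|) S * cfc (fun x => √|x|) S = S := by
    rw [← cfc_mul _ _ _ (hc _) (hc _)]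
    conv_rhs => rw [← cfc_id ℝ S]
    refine cfc_congr fun x hx => ?_
    have := spectrum_star_mul_self_nonneg (b := star u) x hx
    simp [abs_of_nonneg this, Real.mul_self_sqrt this]
  obtain ⟨r, hr, hpr⟩ := exists_pos_pfaffian_eq (A := S) (Q := flatten B) hW (fun x => √|x|)
    (fun x => Real.sqrt_nonneg _) (isUnit_cfc_of_forall_ne hSsa fun x hx => by
      have : x ≠ 0 := fun h => (spectrum.zero_notMem_iff ℝ).2 hS0 (h ▸ hx)
      positivity) (by rw [antiunitaryConj_cfc hSsa, hSW])
    (Commute.cfc_real (show Commute S (flatten B) from hSB) _)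
  rw [hSS] at hpr
  have hudet := det_eq_ofReal_of_antiunitaryConj_eq huW
  have hpu := pfaffian_mul_mul_transpose (flatten A * (W : Matrix (Fin d) (Fin d) ℂ)) u
  have huW' := conjTranspose_mul_eq hW huW
  rw [mul_assoc, mul_assoc, ← huW', ← mul_assoc, ← mul_assoc, huAB, mul_assoc (flatten B),
    ← Matrix.star_eq_conjTranspose, show u * star u = S by rw [hS, star_star], ← hSB, hpr,
    hudet] at hpu
  rw [hpa, hpb] at hneg
  generalize pfaffian (flatten A * (W : Matrix (Fin d) (Fin d) ℂ)) = x at *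
  generalize pfaffian (flatten B * (W : Matrix (Fin d) (Fin d) ℂ)) = y at *
  have hu0 : u.det.re ≠ 0 := fun h => hu.ne_zero (by rw [hudet, h, Complex.ofReal_zero])
  generalize u.det.re = c at *
  have hy : y ≠ 0 := by
    rintro rfl
    simp at hneg
  -- From `u (flatten A) u† = S (flatten B)`: the Pfaffian of one side is `c x`, of the other `r y`,
  -- with `r > 0`.
  have hx : x = (r / c : ℝ) * y := by
    have : (c : ℂ) ≠ 0 := by exact_mod_cast hu0
    push_cast
    field_simp
    linear_combination -hpu
  have hxy : (a : ℂ) * x / (b * y) = ((a * r / (b * c) : ℝ) : ℂ) := by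
    have : (c : ℂ) ≠ 0 := by exact_mod_cast hu0
    have : (b : ℂ) ≠ 0 := by exact_mod_cast hb.ne'
    rw [hx]; push_cast
    field_simp
  rw [hxy, Complex.ofReal_re] at hneg
  by_contra! hcn
  exact absurd hneg (not_lt.2 (by positivity))

end PfaffianSign

/-! ### Rings pierced by a flux, and the parity of their flat-band Hamiltonians. -/

section Ring

open Kronecker

/-- The wave numbers of a ring of `l` cells pierced by a flux `θ`. -/
def ringMomentum (l : ℕ) (θ : ℝ) (m : Fin l) : ℝ := (2 * Real.pi * (m : ℕ) + θ) / l

/-- The projector onto the plane wave `k` in a segment of `l` cells. -/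
def planeWave (l : ℕ) (k : ℝ) : Matrix (Fin l) (Fin l) ℂ :=
  Matrix.of fun j j' => Complex.exp (Complex.I * k * (((j : ℕ) : ℂ) - ((j' : ℕ) : ℂ))) / l

/-- The discrete Fourier transform on a ring pierced by a flux. -/
def ringFourier (l : ℕ) (θ : ℝ) : Matrix (Fin l) (Fin l) ℂ :=
  Matrix.of fun j m => Complex.exp (Complex.I * ringMomentum l θ m * ((j : ℕ) : ℂ)) / (√(l : ℝ) : ℝ)

/-- The operator with Bloch matrices `A k` on a ring pierced by a flux. -/
def ringOp {d : ℕ} (l : ℕ) (θ : ℝ) (A : ℝ → Matrix (Fin d) (Fin d) ℂ) :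
    Matrix (Fin l × Fin d) (Fin l × Fin d) ℂ :=
  ∑ m : Fin l, planeWave l (ringMomentum l θ m) ⊗ₖ A (ringMomentum l θ m)

variable {d l : ℕ} {θ : ℝ}

lemma exp_I_mul_two_pi_int (n : ℤ) : Complex.exp (Complex.I * (2 * Real.pi) * n) = 1 := by
  rw [← Complex.exp_int_mul_two_pi_mul_I n]; congr 1; ring

lemma planeWave_periodic (l : ℕ) : Function.Periodic (planeWave l) (2 * Real.pi) := by
  intro k
  ext j j'
  simp only [planeWave, Matrix.of_apply]
  congr 1
  rw [← mul_one (Complex.exp (Complex.I * k * _)),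
    ← exp_I_mul_two_pi_int (((j : ℕ) : ℤ) - ((j' : ℕ) : ℤ)), ← Complex.exp_add]
  congr 1
  push_cast; ring

/-- A geometric sum of `l`-th roots of unity, up to the phase due to the flux. -/
lemma sum_exp_ringMomentum_int (hl : l ≠ 0) (θ : ℝ) (M : ℤ) :
    ∑ m : Fin l, Complex.exp (Complex.I * ringMomentum l θ m * M) =
      if (l : ℤ) ∣ M then l * Complex.exp (Complex.I * θ * M / l) else 0 := by
  have hl' : (l : ℂ) ≠ 0 := by exact_mod_cast hl
  set ζ : ℂ := Complex.exp (2 * Real.pi * Complex.I * M / l) with hζ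
  have hterm : ∀ m : Fin l, Complex.exp (Complex.I * ringMomentum l θ m * M) =
      Complex.exp (Complex.I * θ * M / l) * ζ ^ (m : ℕ) := by
    intro m
    rw [hζ, ← Complex.exp_nat_mul, ← Complex.exp_add]
    congr 1
    simp only [ringMomentum]
    push_cast
    field_simp
    ring
  have hone : ζ = 1 ↔ (l : ℤ) ∣ M := by
    rw [hζ, Complex.exp_eq_one_iff]
    refine exists_congr fun n => ?_
    rw [div_eq_iff hl']
    constructor
    · intro h
      have := mul_left_cancel₀ Complex.two_pi_I_ne_zero
        (show 2 * Real.pi * Complex.I * M = 2 * Real.pi * Complex.I * (l * n : ℂ) by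
          rw [h]; ring)
      exact_mod_cast this
    · intro h
      rw [h]
      push_cast; ring
  simp only [hterm]
  rw [← Finset.mul_sum, Fin.sum_univ_eq_sum_range (fun m => ζ ^ m)]
  split_ifs with h
  · rw [hone.2 h]
    simp [mul_comm]
  · have hpow : ζ ^ l = 1 := by
      rw [hζ, ← Complex.exp_nat_mul, ← exp_I_mul_two_pi_int M]
      congr 1
      field_simp
    rw [geom_sum_eq (mt hone.1 h), hpow]
    simp

lemma sum_exp_ringMomentum (hl : l ≠ 0) (j j' : Fin l) :
    ∑ m : Fin l, Complex.exp (Complex.I * ringMomentum l θ m *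
      (((j : ℕ) : ℂ) - ((j' : ℕ) : ℂ))) = if j = j' then (l : ℂ) else 0 := by
  have h := sum_exp_ringMomentum_int hl θ (((j : ℕ) : ℤ) - ((j' : ℕ) : ℤ))
  push_cast at h
  rw [h]
  by_cases hj : j = j'
  · simp [hj]
  · rw [if_neg hj, if_neg]
    intro hdvd
    refine hj (Fin.ext ?_)
    have h1 := j.isLt
    have h2 := j'.isLt
    have := Int.eq_zero_of_abs_lt_dvd hdvd (by rw [abs_lt]; omega)
    omega

lemma ringFourier_mem_unitary (hl : l ≠ 0) :
    ringFourier l θ ∈ Matrix.unitaryGroup (Fin l) ℂ := by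
  rw [Matrix.mem_unitaryGroup_iff]
  ext j j'
  have hs : ((√(l : ℝ) : ℝ) : ℂ) * (√(l : ℝ) : ℝ) = l := by
    rw [← Complex.ofReal_mul, Real.mul_self_sqrt (Nat.cast_nonneg l)]; simp
  have hl' : (l : ℂ) ≠ 0 := by exact_mod_cast hl
  rw [Matrix.mul_apply, Matrix.one_apply]
  have := sum_exp_ringMomentum (θ := θ) hl j j'
  have h2 : ∀ m, ringFourier l θ j m * star (ringFourier l θ) m j' =
      Complex.exp (Complex.I * ringMomentum l θ m * (((j : ℕ) : ℂ) - ((j' : ℕ) : ℂ))) / l := by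
    intro m
    simp only [ringFourier, Matrix.star_apply, Matrix.of_apply, RCLike.star_def, map_div₀,
      ← Complex.exp_conj, Complex.conj_ofReal, map_mul, Complex.conj_I, Complex.conj_natCast]
    rw [div_mul_div_comm, hs, ← Complex.exp_add]
    congr 2; ring
  simp only [h2]
  rw [← Finset.sum_div, this]
  split_ifs
  · exact div_self hl'
  · simp

lemma planeWave_eq (m : Fin l) : planeWave l (ringMomentum l θ m) =
    ringFourier l θ * Matrix.single m m 1 * star (ringFourier l θ) := by
  ext j j'
  have hs : ((√(l : ℝ) : ℝ) : ℂ) * (√(l : ℝ) : ℝ) = l := by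
    rw [← Complex.ofReal_mul, Real.mul_self_sqrt (Nat.cast_nonneg l)]; simp
  rw [Matrix.mul_apply, Finset.sum_eq_single m]
  · rw [Matrix.mul_single_apply_same, mul_one]
    simp only [planeWave, ringFourier, Matrix.star_apply, Matrix.of_apply, RCLike.star_def,
      map_div₀, ← Complex.exp_conj, Complex.conj_ofReal, map_mul, Complex.conj_I,
      Complex.conj_natCast]
    rw [div_mul_div_comm, hs, ← Complex.exp_add]
    congr 2; ring
  · intro b _ hb
    rw [Matrix.mul_single_apply_of_ne _ _ _ _ _ hb, zero_mul]
  · simp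

lemma ringFourier_star_mul_self (hl : l ≠ 0) : star (ringFourier l θ) * ringFourier l θ = 1 :=
  Matrix.mem_unitaryGroup_iff'.1 (ringFourier_mem_unitary hl)

/-- Momenta of one grid differ by multiples of `2π / l`, so their plane waves are orthogonal. This
is what makes `ringOp` multiplicative in the Bloch matrices. -/
lemma planeWave_mul_planeWave (hl : l ≠ 0) (m m' : Fin l) :
    planeWave l (ringMomentum l θ m) * planeWave l (ringMomentum l θ m') =
      if m = m' then planeWave l (ringMomentum l θ m) else 0 := by
  rw [planeWave_eq, planeWave_eq]
  have : ∀ F G : Matrix (Fin l) (Fin l) ℂ, ringFourier l θ * F * star (ringFourier l θ) *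
      (ringFourier l θ * G * star (ringFourier l θ)) =
      ringFourier l θ * (F * G) * star (ringFourier l θ) := by
    intro F G
    calc _ = ringFourier l θ * F * (star (ringFourier l θ) * ringFourier l θ) * G *
          star (ringFourier l θ) := by simp only [mul_assoc]
      _ = _ := by rw [ringFourier_star_mul_self hl, mul_one]; simp only [mul_assoc]
  rw [this]
  split_ifs with h
  · subst h; simp
  · rw [Matrix.single_mul_single_of_ne _ _ _ _ h]; simp

lemma ringOp_const (hl : l ≠ 0) (M : Matrix (Fin d) (Fin d) ℂ) :
    ringOp l θ (fun _ => M) = 1 ⊗ₖ M := by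
  have h1 : ∑ m, planeWave l (ringMomentum l θ m) = 1 := by
    simp only [planeWave_eq]
    rw [← Finset.sum_mul, ← Finset.mul_sum, Matrix.sum_single_one, mul_one]
    exact Matrix.mem_unitaryGroup_iff.1 (ringFourier_mem_unitary hl)
  rw [← h1, ringOp]
  ext ⟨i, a⟩ ⟨j, b⟩
  simp [Matrix.sum_apply, Finset.sum_mul]

lemma ringOp_mul (hl : l ≠ 0) (A B : ℝ → Matrix (Fin d) (Fin d) ℂ) :
    ringOp l θ A * ringOp l θ B = ringOp l θ (fun k => A k * B k) := by
  simp only [ringOp, Finset.sum_mul_sum, ← Matrix.mul_kronecker_mul, planeWave_mul_planeWave hl]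
  refine Finset.sum_congr rfl fun m _ => ?_
  rw [Finset.sum_eq_single m]
  · simp
  · intro b _ hb
    rw [if_neg hb.symm, Matrix.zero_kronecker]
  · simp

lemma star_ringOp (A : ℝ → Matrix (Fin d) (Fin d) ℂ) :
    star (ringOp l θ A) = ringOp l θ (fun k => star (A k)) := by
  simp only [ringOp, star_sum]
  refine Finset.sum_congr rfl fun m _ => ?_
  rw [Matrix.star_eq_conjTranspose, Matrix.conjTranspose_kronecker]
  congr 1
  ext j j'
  simp only [planeWave, Matrix.conjTranspose_apply, Matrix.of_apply, RCLike.star_def, map_div₀,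
    ← Complex.exp_conj, map_mul, Complex.conj_I, Complex.conj_ofReal, map_sub,
    Complex.conj_natCast]
  congr 2; ring

lemma det_ringOp (hl : l ≠ 0) (A : ℝ → Matrix (Fin d) (Fin d) ℂ) :
    (ringOp l θ A).det = ∏ m, (A (ringMomentum l θ m)).det := by
  have h1 : ringOp l θ A = (ringFourier l θ ⊗ₖ (1 : Matrix (Fin d) (Fin d) ℂ)) *
      (Matrix.blockDiagonal fun m => A (ringMomentum l θ m)).submatrix
        (Equiv.prodComm _ _) (Equiv.prodComm _ _) *
      (star (ringFourier l θ) ⊗ₖ (1 : Matrix (Fin d) (Fin d) ℂ)) := by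
    have h2 : (Matrix.blockDiagonal fun m => A (ringMomentum l θ m)).submatrix
        (Equiv.prodComm _ _) (Equiv.prodComm _ _) =
        ∑ m, Matrix.single m m (1 : ℂ) ⊗ₖ A (ringMomentum l θ m) := by
      ext ⟨i, a⟩ ⟨j, b⟩
      rw [Matrix.sum_apply, Finset.sum_eq_single i]
      · by_cases hij : i = j
        · subst hij; simp [Matrix.blockDiagonal_apply]
        · simp [Matrix.blockDiagonal_apply, hij]
      · intro m _ hm
        simp [hm]
      · simp
    rw [h2, Finset.mul_sum, Finset.sum_mul, ringOp]
    refine Finset.sum_congr rfl fun m _ => ?_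
    rw [← Matrix.mul_kronecker_mul, ← Matrix.mul_kronecker_mul, one_mul, mul_one, planeWave_eq]
  rw [h1, Matrix.det_mul_right_comm, ← Matrix.mul_kronecker_mul,
    Matrix.mem_unitaryGroup_iff.1 (ringFourier_mem_unitary hl), mul_one, Matrix.one_kronecker_one,
    one_mul, Matrix.det_submatrix_equiv_self, Matrix.det_blockDiagonal]

/-- For these two fluxes the grid is symmetric under `k ↦ -k` modulo `2π`: the index goes to `-m`
modulo `l` for flux 0 and to `l - 1 - m` for flux `π`. The particle-hole conjugation therefore acts
on the ring. -/
lemma sum_ringMomentum_neg {M : Type*} [AddCommMonoid M] {ψ : ℝ → M}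
    (hψ : Function.Periodic ψ (2 * Real.pi)) (hl : l ≠ 0) (hθ : θ = 0 ∨ θ = Real.pi) :
    ∑ m : Fin l, ψ (-ringMomentum l θ m) = ∑ m : Fin l, ψ (ringMomentum l θ m) := by
  have hl' : (l : ℝ) ≠ 0 := by exact_mod_cast hl
  rcases hθ with rfl | rfl
  · have : NeZero l := ⟨hl⟩
    rw [← Equiv.sum_comp (Equiv.neg (Fin l)) fun m => ψ (ringMomentum l 0 m)]
    refine Finset.sum_congr rfl fun m _ => ?_
    by_cases hm : (m : ℕ) = 0
    · have : m = 0 := Fin.ext hm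
      simp [this, ringMomentum]
    · have : ((-m : Fin l) : ℕ) = l - m := by
        rw [Fin.val_neg', Nat.mod_eq_of_lt]
        have := m.isLt; omega
      rw [← hψ]
      congr 1
      simp only [Equiv.neg_apply, ringMomentum, this]
      rw [Nat.cast_sub m.isLt.le]
      field_simp
      ring
  · rw [← Equiv.sum_comp (Fin.revPerm (n := l)) fun m => ψ (ringMomentum l Real.pi m)]
    refine Finset.sum_congr rfl fun m _ => ?_
    rw [← hψ]
    congr 1
    simp only [Fin.revPerm_apply, ringMomentum, Fin.val_rev]
    rw [Nat.cast_sub (by have := m.isLt; omega)]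
    push_cast
    field_simp
    ring

/-- The conjugation on the ring, acting cell by cell. -/
def ringConj (l : ℕ) (W : Matrix.unitaryGroup (Fin d) ℂ) :
    Matrix.unitaryGroup (Fin l × Fin d) ℂ :=
  ⟨1 ⊗ₖ (W : Matrix (Fin d) (Fin d) ℂ), Matrix.kronecker_mem_unitary (one_mem _) W.2⟩

lemma antiunitaryConj_ringOp (hl : l ≠ 0) (hθ : θ = 0 ∨ θ = Real.pi)
    (W : Matrix.unitaryGroup (Fin d) ℂ) {A : ℝ → Matrix (Fin d) (Fin d) ℂ}
    (hA : Function.Periodic A (2 * Real.pi)) :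
    antiunitaryConj (ringConj l W) (ringOp l θ A) =
      ringOp l θ (fun k => antiunitaryConj W (A (-k))) := by
  have hkr : ∀ k, antiunitaryConj (ringConj l W) (planeWave l k ⊗ₖ A k) =
      planeWave l (-k) ⊗ₖ antiunitaryConj W (A k) := by
    intro k
    have h1 : (planeWave l k ⊗ₖ A k).map star = planeWave l (-k) ⊗ₖ (A k).map star := by
      ext ⟨i, a⟩ ⟨j, b⟩
      simp only [planeWave, Matrix.map_apply, Matrix.kronecker_apply, Matrix.of_apply,
        RCLike.star_def, map_div₀, ← Complex.exp_conj, map_mul, Complex.conj_I,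
        Complex.conj_ofReal, map_sub, Complex.conj_natCast]
      congr 3
      push_cast; ring
    rw [antiunitaryConj_apply, antiunitaryConj_apply, h1]
    simp only [ringConj]
    rw [Matrix.conjTranspose_kronecker, ← Matrix.mul_kronecker_mul, ← Matrix.mul_kronecker_mul]
    simp
  have hper : Function.Periodic (fun k => planeWave l k ⊗ₖ antiunitaryConj W (A (-k)))
      (2 * Real.pi) := by
    intro k
    simp only
    rw [planeWave_periodic l k, neg_add, ← sub_eq_add_neg, hA.sub_eq]
  have := sum_ringMomentum_neg hper hl hθ
  simp only [neg_neg] at this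
  simp only [ringOp, map_sum, hkr]
  exact this

lemma prod_range_two_mul {M : Type*} [CommMonoid M] (f : ℕ → M) (l : ℕ) :
    (∏ m ∈ Finset.range l, f (2 * m)) * ∏ m ∈ Finset.range l, f (2 * m + 1) =
      ∏ n ∈ Finset.range (2 * l), f n := by
  induction l with
  | zero => simp
  | succ l ih =>
    rw [Finset.prod_range_succ, Finset.prod_range_succ, mul_mul_mul_comm, ih, mul_add, mul_one,
      Finset.prod_range_succ, Finset.prod_range_succ, mul_assoc]

/-- On the union of the two grids of wave numbers, `0` and `π` are the only ones that are not
paired by `k ↦ -k`. -/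
lemma prod_ringMomentum_mul_prod {f : ℝ → ℂ} (hf : Function.Periodic f (2 * Real.pi))
    (hconj : ∀ k, f (-k) = star (f k)) (hl : l ≠ 0) :
    ∃ r : ℝ, 0 ≤ r ∧ (∏ m : Fin l, f (ringMomentum l 0 m)) *
      ∏ m : Fin l, f (ringMomentum l Real.pi m) = r * (f 0 * f Real.pi) := by
  obtain ⟨p, rfl⟩ := Nat.exists_eq_succ_of_ne_zero hl
  set L : ℝ := ((p + 1 : ℕ) : ℝ) with hL
  have hL0 : L ≠ 0 := by positivity
  have h0 : ∏ m : Fin (p + 1), f (ringMomentum (p + 1) 0 m) =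
      ∏ m ∈ Finset.range (p + 1), (fun n : ℕ => f (Real.pi * n / L)) (2 * m) := by
    rw [← Fin.prod_univ_eq_prod_range (fun m => (fun n : ℕ => f (Real.pi * n / L)) (2 * m))]
    refine Finset.prod_congr rfl fun m _ => congrArg f ?_
    simp only [ringMomentum, hL]; push_cast; ring
  have h1 : ∏ m : Fin (p + 1), f (ringMomentum (p + 1) Real.pi m) =
      ∏ m ∈ Finset.range (p + 1), (fun n : ℕ => f (Real.pi * n / L)) (2 * m + 1) := by
    rw [← Fin.prod_univ_eq_prod_range (fun m => (fun n : ℕ => f (Real.pi * n / L)) (2 * m + 1))]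
    refine Finset.prod_congr rfl fun m _ => congrArg f ?_
    simp only [ringMomentum, hL]; push_cast; ring
  rw [h0, h1, prod_range_two_mul fun n : ℕ => f (Real.pi * n / L), two_mul, Finset.prod_range_add, Finset.prod_range_succ',
    Finset.prod_range_succ']
  -- The momenta beyond `π` are the reflections `2π - k` of those strictly between 0 and `π`, so
  -- they contribute conjugate factors.
  have h2 : ∏ n ∈ Finset.range p, f (Real.pi * ((p + 1 + (n + 1) : ℕ) : ℝ) / L) =
      ∏ n ∈ Finset.range p, star (f (Real.pi * ((n + 1 : ℕ) : ℝ) / L)) := by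
    rw [← Finset.prod_range_reflect]
    refine Finset.prod_congr rfl fun n hn => ?_
    rw [← hconj, ← hf (-(Real.pi * ((n + 1 : ℕ) : ℝ) / L))]
    have hn' : n + 1 ≤ p := Finset.mem_range.1 hn
    congr 1
    obtain ⟨q, rfl⟩ := Nat.exists_eq_add_of_le hn'
    rw [show n + 1 + q - 1 - n = q by omega]
    field_simp
    rw [hL]
    push_cast
    ring
  refine ⟨Complex.normSq (∏ n ∈ Finset.range p, f (Real.pi * ((n + 1 : ℕ) : ℝ) / L)),
    Complex.normSq_nonneg _, ?_⟩
  rw [h2, ← star_prod, ← Complex.mul_conj]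
  have h3 : Real.pi * (((p + 1 + 0 : ℕ)) : ℝ) / L = Real.pi := by
    rw [add_zero, ← hL]; field_simp
  rw [h3]
  simp only [Nat.cast_zero, mul_zero, zero_div]
  simp only [RCLike.star_def]
  ring

/-- Only values on finite grids will matter, so `V` need not be continuous: it is chosen freely
where `sin k > 0`, reflected by the conjugation where `sin k < 0`, and set to `1` and `u` at the two
fixed momenta. -/
lemma exists_periodic_intertwiner {W : Matrix.unitaryGroup (Fin d) ℂ}
    (hW : (W : Matrix (Fin d) (Fin d) ℂ) * (W : Matrix (Fin d) (Fin d) ℂ).map star = 1)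
    {Q : ℝ → Matrix (Fin d) (Fin d) ℂ} (hcont : Continuous Q)
    (hper : Function.Periodic Q (2 * Real.pi)) (hQ : ∀ k, Q k * Q k = 1)
    (hQW : ∀ k, antiunitaryConj W (Q k) = -Q (-k)) {u : Matrix (Fin d) (Fin d) ℂ}
    (hu : IsUnit u.det) (huW : antiunitaryConj W u = u) (huQ : u * Q 0 = Q Real.pi * u) :
    ∃ V : ℝ → Matrix (Fin d) (Fin d) ℂ, Function.Periodic V (2 * Real.pi) ∧
      (∀ k, IsUnit (V k).det) ∧ (∀ k, antiunitaryConj W (V k) = V (-k)) ∧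
      (∀ k, V k * Q 0 = Q k * V k) ∧ V 0 = 1 ∧ V Real.pi = u := by
  classical
  have hex : ∀ k, ∃ V : Matrix (Fin d) (Fin d) ℂ, IsUnit V.det ∧ V * Q 0 = Q k * V :=
    exists_intertwiner_of_continuous hcont hQ 0
  -- The choice depends on the matrix `Q k` and not on `k`, so that it inherits the periodicity of
  -- `Q`.
  set G : Matrix (Fin d) (Fin d) ℂ → Matrix (Fin d) (Fin d) ℂ := fun X =>
    if h : ∃ V : Matrix (Fin d) (Fin d) ℂ, IsUnit V.det ∧ V * Q 0 = X * V then h.choose else 1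
  have hG : ∀ k, IsUnit (G (Q k)).det ∧ G (Q k) * Q 0 = Q k * G (Q k) := by
    intro k
    simp only [G, dif_pos (hex k)]
    exact (hex k).choose_spec
  refine ⟨fun k => if 0 < Real.sin k then G (Q k) else if Real.sin k < 0 then
    antiunitaryConj W (G (Q (-k))) else if 0 < Real.cos k then 1 else u, ?_, ?_, ?_, ?_, ?_, ?_⟩
  · intro k
    simp only [Real.sin_add_two_pi, Real.cos_add_two_pi, hper k, neg_add, ← sub_eq_add_neg,
      hper.sub_eq]
  · intro k
    dsimp only
    split_ifs
    · exact (hG k).1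
    · rw [det_antiunitaryConj]; exact (hG (-k)).1.star
    · simp
    · exact hu
  · intro k
    dsimp only
    rw [Real.sin_neg, Real.cos_neg, neg_neg]
    rcases lt_trichotomy (Real.sin k) 0 with h | h | h
    · simp [h, h.not_gt, antiunitaryConj_antiunitaryConj hW]
    · rw [h]
      by_cases hc : 0 < Real.cos k <;> simp [hc, huW]
    · simp [h, h.not_gt]
  · intro k
    dsimp only
    split_ifs with h1 h2 h3
    · exact (hG k).2
    · have := congrArg (antiunitaryConj W) (hG (-k)).2
      rw [map_mul, map_mul, hQW, hQW, neg_neg, neg_zero] at this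
      simpa using this
    · have hs : Real.sin k = 0 := le_antisymm (not_lt.1 h1) (not_lt.1 h2)
      have hc : Real.cos k = 1 := (Real.sin_eq_zero_iff_cos_eq.1 hs).resolve_right (by linarith)
      obtain ⟨n, hn⟩ := (Real.cos_eq_one_iff k).1 hc
      rw [one_mul, mul_one, ← hn, ← hper.int_mul_eq n]
    · have hs : Real.sin k = 0 := le_antisymm (not_lt.1 h1) (not_lt.1 h2)
      have hc : Real.cos k = -1 := (Real.sin_eq_zero_iff_cos_eq.1 hs).resolve_left (by linarith)
      have hc' : Real.cos (k - Real.pi) = 1 := by rw [Real.cos_sub_pi, hc, neg_neg]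
      obtain ⟨n, hn⟩ := (Real.cos_eq_one_iff _).1 hc'
      have : Q k = Q Real.pi := by
        rw [show k = Real.pi + n * (2 * Real.pi) by linarith]
        exact hper.int_mul n _
      rw [this, huQ]
  · simp
  · simp

/-- The flat-band Hamiltonians of the periodic and the antiperiodic ring of a topologically
nontrivial chain have a singular sum. -/
theorem det_ringOp_add_ringOp_eq_zero {W : Matrix.unitaryGroup (Fin d) ℂ}
    (hW : (W : Matrix (Fin d) (Fin d) ℂ) * (W : Matrix (Fin d) (Fin d) ℂ).map star = 1)
    {Q : ℝ → Matrix (Fin d) (Fin d) ℂ} (hcont : Continuous Q)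
    (hper : Function.Periodic Q (2 * Real.pi)) (hQ : ∀ k, Q k * Q k = 1)
    (hQs : ∀ k, star (Q k) = Q k)
    (hQW : ∀ k, antiunitaryConj W (Q k) = -Q (-k)) {u : Matrix (Fin d) (Fin d) ℂ}
    (huW : antiunitaryConj W u = u) (huQ : u * Q 0 = Q Real.pi * u)
    (hu : u.det.re < 0) (hl : l ≠ 0) (hd : d ≠ 0) :
    (ringOp l 0 Q + ringOp l Real.pi Q).det = 0 := by
  have : NeZero l := ⟨hl⟩
  have : NeZero d := ⟨hd⟩
  have hu' : IsUnit u.det := isUnit_iff_ne_zero.2 fun h => by simp [h] at hu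
  obtain ⟨V, hVper, hV, hVW, hVQ, hV0, hVπ⟩ :=
    exists_periodic_intertwiner hW hcont hper hQ hQW hu' huW huQ
  have hone : ringOp l 0 (fun _ => (1 : Matrix (Fin d) (Fin d) ℂ)) = 1 ∧
      ringOp l Real.pi (fun _ => (1 : Matrix (Fin d) (Fin d) ℂ)) = 1 := by
    rw [ringOp_const hl, ringOp_const hl, Matrix.one_kronecker_one]; exact ⟨rfl, rfl⟩
  have hneg : ∀ θ, ringOp l θ (fun k => -Q k) = -ringOp l θ Q := by
    intro θ
    rw [eq_neg_iff_add_eq_zero, ringOp, ringOp, ← Finset.sum_add_distrib]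
    refine Finset.sum_eq_zero fun m _ => ?_
    rw [← Matrix.kronecker_add, neg_add_cancel, Matrix.kronecker_zero]
  refine det_add_eq_zero_of_intertwiners (W := ringConj l W) (M := 1 ⊗ₖ Q 0)
    (g := ringOp l 0 V) (g' := ringOp l Real.pi V) ?_ ?_ ?_ ?_ ?_ ?_ ?_ ?_ ?_ ?_ ?_ ?_ ?_
  · rw [ringOp_mul hl]; simp only [hQ, hone]
  · rw [star_ringOp]; simp only [hQs]
  · rw [antiunitaryConj_ringOp hl (Or.inl rfl) W hper]; simp only [hQW, neg_neg, hneg]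
  · rw [ringOp_mul hl]; simp only [hQ, hone]
  · rw [star_ringOp]; simp only [hQs]
  · rw [antiunitaryConj_ringOp hl (Or.inr rfl) W hper]; simp only [hQW, neg_neg, hneg]
  · rw [← Matrix.mul_kronecker_mul, hQ, one_mul, Matrix.one_kronecker_one]
  · rw [← ringOp_const (θ := 0) hl, antiunitaryConj_ringOp hl (Or.inl rfl) W (fun _ => rfl)]
    simp only [hQW, neg_zero]
    rw [ringOp_const hl, ringOp_const hl]
    rw [eq_neg_iff_add_eq_zero, ← Matrix.kronecker_add, neg_add_cancel, Matrix.kronecker_zero]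
  · rw [antiunitaryConj_ringOp hl (Or.inl rfl) W hVper]; simp only [hVW, neg_neg]
  · rw [← ringOp_const (θ := 0) hl, ringOp_mul hl, ringOp_mul hl]; simp only [hVQ]
  · rw [antiunitaryConj_ringOp hl (Or.inr rfl) W hVper]; simp only [hVW, neg_neg]
  · rw [← ringOp_const (θ := Real.pi) hl, ringOp_mul hl, ringOp_mul hl]; simp only [hVQ]
  · obtain ⟨r, hr, hprod⟩ := prod_ringMomentum_mul_prod (f := fun k => (V k).det)
      (fun k => by simp only [hVper k]) (fun k => by rw [← hVW, det_antiunitaryConj]) hl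
    rw [det_ringOp hl, det_ringOp hl, hprod, hV0, hVπ, Matrix.det_one, one_mul,
      Complex.re_ofReal_mul]
    -- `r` cannot vanish, because all the `V k` are invertible.
    refine mul_neg_of_pos_of_neg (lt_of_le_of_ne hr fun h => ?_) hu
    rw [← h, Complex.ofReal_zero, zero_mul] at hprod
    refine mul_ne_zero ?_ ?_ hprod <;>
    exact Finset.prod_ne_zero_iff.2 fun m _ => (hV _).ne_zero

end Ring

/-! ### Matrix-valued multiplication operators on `L²`. -/

section Multiplication

open Matrix (toEuclideanCLM)

variable {X : Type*} [TopologicalSpace X] [CompactSpace X] [MeasurableSpace X] [BorelSpace X]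
  (μ : Measure X) [IsFiniteMeasure μ] {d : ℕ}

/-- The pointwise action of matrix-valued `L^∞` functions on `ℂᵈ`-valued `L²` functions. -/
def matrixMulL (d : ℕ) : Lp (Matrix (Fin d) (Fin d) ℂ) ∞ μ →L[ℂ]
    Lp (EuclideanSpace ℂ (Fin d)) 2 μ →L[ℂ] Lp (EuclideanSpace ℂ (Fin d)) 2 μ :=
  (LinearMap.toContinuousLinearMap
    (toEuclideanCLM (n := Fin d) (𝕜 := ℂ)).toAlgEquiv.toLinearMap).holderL μ ∞ 2 2

lemma coeFn_matrixMulL (a : C(X, Matrix (Fin d) (Fin d) ℂ))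
    (f : Lp (EuclideanSpace ℂ (Fin d)) 2 μ) :
    matrixMulL μ d (ContinuousMap.toLp ∞ μ ℂ a) f =ᵐ[μ]
      fun x => toEuclideanCLM (n := Fin d) (𝕜 := ℂ) (a x) (f x) := by
  have h1 := ContinuousLinearMap.coeFn_holder (r := 2) (LinearMap.toContinuousLinearMap
    (toEuclideanCLM (n := Fin d) (𝕜 := ℂ)).toAlgEquiv.toLinearMap)
    (ContinuousMap.toLp ∞ μ ℂ a) f
  filter_upwards [h1, ContinuousMap.coeFn_toLp (p := ∞) (𝕜 := ℂ) μ a] with x hx hx'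
  rw [hx'] at hx
  exact hx

/-- The representation of continuous matrix-valued functions by multiplication operators. -/
def mulOp : C(X, Matrix (Fin d) (Fin d) ℂ) →⋆ₐ[ℂ]
    (Lp (EuclideanSpace ℂ (Fin d)) 2 μ →L[ℂ] Lp (EuclideanSpace ℂ (Fin d)) 2 μ) where
  toFun a := matrixMulL μ d (ContinuousMap.toLp ∞ μ ℂ a)
  map_one' := by
    ext1 f
    refine Lp.ext ?_
    filter_upwards [coeFn_matrixMulL μ 1 f] with x hx
    rw [hx]; simp
  map_mul' a b := by
    ext1 f
    refine Lp.ext ?_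
    filter_upwards [coeFn_matrixMulL μ (a * b) f, coeFn_matrixMulL μ b f,
      coeFn_matrixMulL μ a (matrixMulL μ d (ContinuousMap.toLp ∞ μ ℂ b) f)] with x h1 h2 h3
    rw [h1, mul_apply_eq_comp, h3, h2]; simp
  map_zero' := by rw [map_zero, map_zero]
  map_add' a b := by rw [map_add, map_add]
  commutes' c := by
    rw [Algebra.algebraMap_eq_smul_one, map_smul, map_smul, Algebra.algebraMap_eq_smul_one]
    congr 1
    ext1 f
    refine Lp.ext ?_
    filter_upwards [coeFn_matrixMulL μ 1 f] with x hx
    rw [hx]; simp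
  map_star' a := by
    rw [ContinuousLinearMap.star_eq_adjoint, ContinuousLinearMap.eq_adjoint_iff]
    intro f g
    rw [L2.inner_def, L2.inner_def]
    refine integral_congr_ae ?_
    filter_upwards [coeFn_matrixMulL μ (star a) f, coeFn_matrixMulL μ a g] with x h1 h2
    rw [h1, h2, ContinuousMap.star_apply, map_star, ContinuousLinearMap.star_eq_adjoint,
      ContinuousLinearMap.adjoint_inner_left]

lemma coeFn_mulOp (a : C(X, Matrix (Fin d) (Fin d) ℂ)) (f : Lp (EuclideanSpace ℂ (Fin d)) 2 μ) :
    mulOp μ a f =ᵐ[μ] fun x => toEuclideanCLM (n := Fin d) (𝕜 := ℂ) (a x) (f x) :=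
  coeFn_matrixMulL μ a f

end Multiplication

/-! ### Bloch waves and Laurent operators. -/

section Bloch

instance : Fact (0 < 2 * Real.pi) := ⟨Real.two_pi_pos⟩

variable {d : ℕ}

open AddCircle

/-- The Bloch waves of the empty chain. -/
def blochWave (p : ℤ × Fin d) :
    Lp (EuclideanSpace ℂ (Fin d)) 2 (haarAddCircle (T := 2 * Real.pi)) :=
  ContinuousMap.toLp 2 haarAddCircle ℂ
    ⟨fun x => fourier (-p.1) x • EuclideanSpace.single p.2 (1 : ℂ), by fun_prop⟩

lemma coeFn_blochWave (p : ℤ × Fin d) : blochWave p =ᵐ[haarAddCircle (T := 2 * Real.pi)]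
    fun x => fourier (-p.1) x • EuclideanSpace.single p.2 (1 : ℂ) :=
  ContinuousMap.coeFn_toLp _ _

lemma inner_blochWave_left (p : ℤ × Fin d)
    (f : Lp (EuclideanSpace ℂ (Fin d)) 2 (haarAddCircle (T := 2 * Real.pi))) :
    inner ℂ (blochWave p) f = fourierCoeff (fun x => f x p.2) (-p.1) := by
  rw [L2.inner_def, fourierCoeff]
  refine integral_congr_ae ?_
  filter_upwards [coeFn_blochWave p] with x hx
  rw [hx, inner_smul_left, EuclideanSpace.inner_single_left, ← fourier_neg]
  simp

lemma inner_blochWave_mulOp (g : C(AddCircle (2 * Real.pi), Matrix (Fin d) (Fin d) ℂ))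
    (p q : ℤ × Fin d) : inner ℂ (blochWave p) (mulOp haarAddCircle g (blochWave q)) =
      fourierCoeff (fun x => g x p.2 q.2) (q.1 - p.1) := by
  rw [inner_blochWave_left, fourierCoeff, fourierCoeff]
  refine integral_congr_ae ?_
  filter_upwards [coeFn_mulOp haarAddCircle g (blochWave q), coeFn_blochWave q] with x h1 h2
  rw [h1, h2, map_smul]
  have : (Matrix.toEuclideanCLM (n := Fin d) (𝕜 := ℂ) (g x) (EuclideanSpace.single q.2 (1 : ℂ)))
      p.2 = g x p.2 q.2 := by
    rw [Matrix.ofLp_toEuclideanCLM]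
    simp
  rw [PiLp.smul_apply, this, smul_smul, neg_sub, neg_neg, smul_eq_mul, smul_eq_mul,
    ← fourier_add, sub_eq_add_neg]

lemma orthonormal_blochWave : Orthonormal ℂ (blochWave (d := d)) := by
  classical
  rw [orthonormal_iff_ite]
  intro p q
  have h := inner_blochWave_mulOp (1 : C(AddCircle (2 * Real.pi), Matrix (Fin d) (Fin d) ℂ)) p q
  rw [map_one, one_apply_eq_self] at h
  rw [h]
  have h1 : (fun x : AddCircle (2 * Real.pi) =>
      (1 : C(AddCircle (2 * Real.pi), Matrix (Fin d) (Fin d) ℂ)) x p.2 q.2) =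
      (if p.2 = q.2 then (1 : ℂ) else 0) • ⇑(fourier (T := 2 * Real.pi) 0) := by
    ext x
    simp [Matrix.one_apply]
  rw [h1, fourierCoeff.const_smul, fourierCoeff_fourier, Pi.single_apply]
  simp only [Prod.ext_iff]
  by_cases ha : p.2 = q.2 <;> by_cases hb : p.1 = q.1 <;> simp [ha, hb, sub_eq_zero, eq_comm]

/-- A vector orthogonal to all Bloch waves has components with vanishing Fourier coefficients, so
completeness of the scalar Fourier basis applies to each component. -/
lemma span_blochWave_orthogonal : (Submodule.span ℂ (Set.range (blochWave (d := d))))ᗮ = ⊥ := by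
  rw [Submodule.eq_bot_iff]
  intro f hf
  have hf' : ∀ p, inner ℂ (blochWave p) f = 0 := fun p =>
    (Submodule.mem_orthogonal _ _).1 hf _ (Submodule.subset_span ⟨p, rfl⟩)
  have hcomp : ∀ a : Fin d, (EuclideanSpace.proj (𝕜 := ℂ) a : EuclideanSpace ℂ (Fin d) →L[ℂ] ℂ).compLp
      f = 0 := by
    intro a
    refine fourierBasis.repr.injective ?_
    rw [map_zero]
    refine lp.ext (funext fun n => (fourierBasis_repr _ n).trans ?_)
    have := hf' (-n, a)
    rw [inner_blochWave_left, neg_neg] at this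
    exact (congrFun (fourierCoeff_congr_ae (ContinuousLinearMap.coeFn_compLp' _ f)) n).trans this
  refine Lp.ext ?_
  have hall : ∀ᵐ x ∂(haarAddCircle (T := 2 * Real.pi)), ∀ a : Fin d, f x a = 0 := by
    rw [ae_all_iff]
    intro a
    have h1 := ContinuousLinearMap.coeFn_compLp'
      (EuclideanSpace.proj (𝕜 := ℂ) a : EuclideanSpace ℂ (Fin d) →L[ℂ] ℂ) f
    rw [hcomp a] at h1
    filter_upwards [h1, Lp.coeFn_zero ℂ 2 (haarAddCircle (T := 2 * Real.pi))] with x hx hx'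
    rw [hx'] at hx
    exact hx.symm
  filter_upwards [hall, Lp.coeFn_zero (EuclideanSpace ℂ (Fin d)) 2
    (haarAddCircle (T := 2 * Real.pi))] with x hx hx'
  rw [hx']
  ext a
  exact hx a

/-- The Bloch waves form a Hilbert basis. -/
def blochBasis (d : ℕ) : HilbertBasis (ℤ × Fin d) ℂ
    (Lp (EuclideanSpace ℂ (Fin d)) 2 (haarAddCircle (T := 2 * Real.pi))) :=
  HilbertBasis.mkOfOrthogonalEqBot orthonormal_blochWave span_blochWave_orthogonal

/-- The translation-invariant operator on the chain with a given continuous Bloch matrix. -/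
def laurentOp : C(AddCircle (2 * Real.pi), Matrix (Fin d) (Fin d) ℂ) →⋆ₐ[ℂ]
    (SingleParticle d →L[ℂ] SingleParticle d) :=
  ((blochBasis d).repr.conjStarAlgEquiv.toStarAlgHom).comp (mulOp haarAddCircle)

/-- The wave of site `j` is `fourier (-j)`, which gives the index `j' - j` and matches the
convention `Hₙ = ⟨0| H |n⟩`. -/
lemma block_laurentOp (g : C(AddCircle (2 * Real.pi), Matrix (Fin d) (Fin d) ℂ)) (j j' : ℤ)
    (a b : Fin d) :
    block (laurentOp g) j j' a b = fourierCoeff (fun x => g x a b) (j' - j) := by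
  have hs : ∀ (j : ℤ) (a : Fin d), site j a = (blochBasis d).repr (blochWave (j, a)) := by
    intro j a
    have h := (blochBasis d).repr_self (j, a)
    rw [blochBasis, HilbertBasis.coe_mkOfOrthogonalEqBot] at h
    rw [blochBasis, h, site]
  have h := inner_blochWave_mulOp g (j, a) (j', b)
  rw [← h, block, Matrix.of_apply, hs, hs]
  change inner ℂ _ ((blochBasis d).repr (mulOp haarAddCircle g ((blochBasis d).repr.symm _))) = _
  rw [LinearIsometryEquiv.symm_apply_apply, LinearIsometryEquiv.inner_map_map]

lemma continuous_laurentOp : Continuous (laurentOp (d := d)) :=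
  AddMonoidHomClass.continuous_of_bound laurentOp 1 fun g => by
    rw [one_mul]; exact NonUnitalStarAlgHom.norm_apply_le laurentOp g

lemma ext_block {T T' : SingleParticle d →L[ℂ] SingleParticle d}
    (h : ∀ j j', block T j j' = block T' j j') : T = T' := by
  set b : HilbertBasis (ℤ × Fin d) ℂ (SingleParticle d) :=
    HilbertBasis.ofRepr (LinearIsometryEquiv.refl ℂ _)
  have hb : ∀ p : ℤ × Fin d, b p = site p.1 p.2 := by
    intro p
    rw [← b.repr_symm_single, site]
    rfl
  refine ContinuousLinearMap.ext_on (s := Set.range b) ?_ ?_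
  · have := b.dense_span
    exact (Submodule.dense_iff_topologicalClosure_eq_top).2 this
  · rintro _ ⟨p, rfl⟩
    refine b.repr.injective ?_
    ext q
    rw [b.repr_apply_apply, b.repr_apply_apply, hb, hb]
    exact congrFun (congrFun (h q.1 p.1) q.2) p.2

end Bloch

/-! ### Symbols of the lattice Hamiltonians and of the evolved projector. -/

open AddCircle

/-- Asking only for a continuous ring homomorphism covers the antilinear conjugation. -/
lemma map_exp_complex {A B F : Type*} [NormedRing A] [NormedAlgebra ℂ A] [CompleteSpace A]
    [NormedRing B] [NormedAlgebra ℂ B] [FunLike F A B] [RingHomClass F A B] (φ : F)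
    (hφ : Continuous φ) (x : A) : φ (NormedSpace.exp x) = NormedSpace.exp (φ x) :=
  NormedSpace.map_exp_of_mem_ball (𝕂 := ℂ) φ hφ x
    ((NormedSpace.expSeries_radius_eq_top ℂ A).symm ▸ edist_lt_top _ _)

/-- Evaluation of continuous functions at a point. -/
def evalHom {X : Type*} [TopologicalSpace X] [CompactSpace X] (A : Type*) [CStarAlgebra A] (x : X) :
    C(X, A) →⋆ₐ[ℂ] A where
  toFun f := f x
  map_one' := rfl
  map_mul' _ _ := rfl
  map_zero' := rfl
  map_add' _ _ := rfl
  commutes' _ := rfl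
  map_star' _ := rfl

lemma map_fermiProjector_complex {A B : Type*} [CStarAlgebra A] [CStarAlgebra B]
    (φ : A →⋆ₐ[ℂ] B) (hφ : Continuous φ) {a : A} (ha : IsSelfAdjoint a) (h0 : IsUnit a) :
    φ (fermiProjector a) = fermiProjector (φ a) :=
  φ.map_cfc _ a (continuousOn_indicator_neg ((spectrum.zero_notMem_iff ℝ).2 h0)) hφ ha (ha.map φ)

namespace LatticeHamiltonian

variable {d : ℕ} (H : LatticeHamiltonian d)

lemma conjTranspose_hopping (n : ℤ) : (H.hopping n)ᴴ = H.hopping (-n) := by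
  have h := H.translation_invariant (-n) 0 n
  rw [zero_add, add_neg_cancel] at h
  ext a b
  rw [Matrix.conjTranspose_apply, hopping, hopping, ← h]
  simp only [block, Matrix.of_apply]
  rw [RCLike.star_def, inner_conj_symm, ← ContinuousLinearMap.adjoint_inner_right,
    ← ContinuousLinearMap.star_eq_adjoint, H.selfAdjoint.star_eq]

lemma fourier_coe_two_pi (n : ℤ) (k : ℝ) :
    fourier n (k : AddCircle (2 * Real.pi)) = Complex.exp (Complex.I * k * n) := by
  rw [fourier_coe_apply]
  congr 1
  have : (Real.pi : ℂ) ≠ 0 := by exact_mod_cast Real.pi_ne_zero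
  push_cast
  field_simp

/-- A single harmonic of the Bloch Hamiltonian. -/
def harmonic (n : ℤ) : C(AddCircle (2 * Real.pi), Matrix (Fin d) (Fin d) ℂ) :=
  ⟨fun x => fourier n x • H.hopping n, by fun_prop⟩

lemma norm_harmonic_le (n : ℤ) : ‖H.harmonic n‖ ≤ ‖H.hopping n‖ := by
  refine (ContinuousMap.norm_le _ (norm_nonneg _)).2 fun x => ?_
  change ‖fourier n x • H.hopping n‖ ≤ _
  rw [norm_smul, fourier_apply, Circle.norm_coe, one_mul]

lemma summable_harmonic : Summable H.harmonic :=
  Summable.of_norm_bounded H.summable_hopping H.norm_harmonic_le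

/-- The Bloch Hamiltonian as a continuous function on the Brillouin zone. -/
def symbol : C(AddCircle (2 * Real.pi), Matrix (Fin d) (Fin d) ℂ) := ∑' n, H.harmonic n

lemma symbol_coe (k : ℝ) : H.symbol k = H.bloch k := by
  rw [symbol, bloch, ← ContinuousMap.tsum_apply H.summable_harmonic]
  refine tsum_congr fun n => ?_
  change fourier n (k : AddCircle (2 * Real.pi)) • H.hopping n = _
  rw [fourier_coe_two_pi]

lemma isSelfAdjoint_symbol : IsSelfAdjoint H.symbol := by
  rw [IsSelfAdjoint, symbol, tsum_star, ← (Equiv.neg ℤ).tsum_eq H.harmonic]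
  refine tsum_congr fun n => ?_
  ext1 x
  change star (fourier n x • H.hopping n) = fourier (-n) x • H.hopping (-n)
  rw [star_smul, Matrix.star_eq_conjTranspose, conjTranspose_hopping, fourier_neg]
  rfl

lemma isSelfAdjoint_bloch (k : ℝ) : IsSelfAdjoint (H.bloch k) := by
  rw [← symbol_coe]
  exact congrArg (fun f : C(AddCircle (2 * Real.pi), Matrix (Fin d) (Fin d) ℂ) => f k)
    H.isSelfAdjoint_symbol

/-- The coefficient is a continuous additive functional of the symbol (an entry of its Laurent
operator), so it may be taken term by term in the series. -/
lemma fourierCoeff_symbol (a b : Fin d) (n : ℤ) :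
    fourierCoeff (fun x => H.symbol x a b) n = H.hopping n a b := by
  have hc : Continuous fun g : C(AddCircle (2 * Real.pi), Matrix (Fin d) (Fin d) ℂ) =>
      block (laurentOp g) 0 n a b := by
    have := continuous_laurentOp (d := d)
    simp only [block, Matrix.of_apply]
    fun_prop
  have hadd : ∀ g g' : C(AddCircle (2 * Real.pi), Matrix (Fin d) (Fin d) ℂ),
      block (laurentOp (g + g')) 0 n a b =
      block (laurentOp g) 0 n a b + block (laurentOp g') 0 n a b := by
    intro g g'
    simp [block]
  let L : C(AddCircle (2 * Real.pi), Matrix (Fin d) (Fin d) ℂ) →+ ℂ :=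
    AddMonoidHom.mk' (fun g => block (laurentOp g) 0 n a b) hadd
  have h1 : fourierCoeff (fun x => H.symbol x a b) n = L H.symbol := by
    change _ = block (laurentOp H.symbol) 0 n a b
    rw [block_laurentOp, sub_zero]
  have h2 : HasSum (fun m => L (H.harmonic m)) (L H.symbol) :=
    H.summable_harmonic.hasSum.map L hc
  have h3 : ∀ m, L (H.harmonic m) = if m = n then H.hopping n a b else 0 := by
    intro m
    change block (laurentOp (H.harmonic m)) 0 n a b = _
    rw [block_laurentOp, sub_zero]
    have : (fun x => H.harmonic m x a b) =
        (H.hopping m a b) • ⇑(fourier (T := 2 * Real.pi) m) := by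
      ext x
      change (fourier m x • H.hopping m) a b = _
      rw [Matrix.smul_apply, Pi.smul_apply, smul_eq_mul, smul_eq_mul, mul_comm]
    rw [this, fourierCoeff.const_smul, fourierCoeff_fourier, Pi.single_apply]
    by_cases hm : m = n
    · simp [hm]
    · simp [hm, Ne.symm hm]
  rw [h1, h2.unique (f := fun m => L (H.harmonic m)) (a₂ := H.hopping n a b)]
  simp only [h3]
  exact hasSum_ite_eq n _

lemma laurentOp_symbol : laurentOp H.symbol = H.op := by
  refine ext_block fun j j' => ?_
  ext a b
  rw [block_laurentOp, fourierCoeff_symbol, hopping]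
  have := H.translation_invariant j 0 (j' - j)
  rw [zero_add, sub_add_cancel] at this
  rw [this]

variable {H}

lemma Gapped.isUnit_bloch (hgap : H.Gapped) (k : ℝ) : IsUnit (H.bloch k) :=
  (spectrum.zero_notMem_iff ℂ).1 (hgap k)

lemma Gapped.isUnit_symbol (hgap : H.Gapped) : IsUnit H.symbol := by
  rw [ContinuousMap.isUnit_iff_forall_isUnit]
  intro x
  obtain ⟨k, rfl⟩ := QuotientAddGroup.mk_surjective x
  have := hgap.isUnit_bloch k
  rwa [← symbol_coe] at this

end LatticeHamiltonian

variable {d : ℕ}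

/-- The Bloch matrices `e^{-iH(k)t} P_{0<}(k) e^{iH(k)t}` of the evolved projector. -/
def evolvedSymbol (H₀ H : LatticeHamiltonian d) (t : ℝ) :
    C(AddCircle (2 * Real.pi), Matrix (Fin d) (Fin d) ℂ) :=
  NormedSpace.exp ((-(Complex.I * t)) • H.symbol) * fermiProjector H₀.symbol *
    NormedSpace.exp ((Complex.I * t) • H.symbol)

/-- Evaluation at `k` is a continuous star homomorphism, so it commutes with exponentials and,
thanks to the gap, with the Fermi projector. The same argument with `laurentOp` identifies the
operator on the chain. -/
lemma evolvedSymbol_coe {H₀ : LatticeHamiltonian d} (hgap : H₀.Gapped) (H : LatticeHamiltonian d)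
    (t k : ℝ) : evolvedSymbol H₀ H t k =
      NormedSpace.exp ((-(Complex.I * t)) • H.bloch k) * fermiProjector (H₀.bloch k) *
        NormedSpace.exp ((Complex.I * t) • H.bloch k) := by
  set φ := evalHom (Matrix (Fin d) (Fin d) ℂ) (k : AddCircle (2 * Real.pi))
  have hφ : Continuous φ := continuous_eval_const (k : AddCircle (2 * Real.pi))
  have hs : ∀ H : LatticeHamiltonian d, φ H.symbol = H.bloch k := fun H => H.symbol_coe k
  change φ (evolvedSymbol H₀ H t) = _
  rw [evolvedSymbol, map_mul, map_mul, map_exp_complex φ hφ, map_exp_complex φ hφ,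
    map_smul, map_smul, hs]
  have h := map_fermiProjector_complex φ hφ H₀.isSelfAdjoint_symbol
    hgap.isUnit_symbol
  rw [h, hs]

lemma laurentOp_evolvedSymbol {H₀ : LatticeHamiltonian d} (hgap : H₀.Gapped)
    (H : LatticeHamiltonian d) (t : ℝ) :
    laurentOp (evolvedSymbol H₀ H t) = evolvedProjector H₀ H t := by
  have hφ := continuous_laurentOp (d := d)
  rw [evolvedSymbol, map_mul, map_mul, map_exp_complex laurentOp hφ,
    map_exp_complex laurentOp hφ, map_smul, map_smul, LatticeHamiltonian.laurentOp_symbol,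
    evolvedProjector]
  have h := map_fermiProjector_complex laurentOp hφ H₀.isSelfAdjoint_symbol
    hgap.isUnit_symbol
  rw [h, LatticeHamiltonian.laurentOp_symbol]

lemma block_evolvedProjector {H₀ : LatticeHamiltonian d} (hgap : H₀.Gapped)
    (H : LatticeHamiltonian d) (t : ℝ) (j j' : ℤ) (a b : Fin d) :
    block (evolvedProjector H₀ H t) j j' a b =
      fourierCoeff (fun x => evolvedSymbol H₀ H t x a b) (j' - j) := by
  rw [← laurentOp_evolvedSymbol hgap, block_laurentOp]

/-! ### Shifting contours of periodic functions. -/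

section ContourShift

lemma mem_strip {κ : ℝ} {k : ℂ} : k ∈ strip κ ↔ |k.im| ≤ κ := Iff.rfl

lemma strip_periodic {κ : ℝ} {k : ℂ} : k + 2 * Real.pi ∈ strip κ ↔ k ∈ strip κ := by
  simp [strip]

/-- Shifting the contour of a periodic integrand across a horizontal strip. -/
theorem integral_eq_integral_add_I_mul {E : Type*} [NormedAddCommGroup E] [NormedSpace ℂ E]
    [CompleteSpace E] {f : ℂ → E} {κ : ℝ} (hκ : 0 < κ) (hc : ContinuousOn f (strip κ))
    (hd : DifferentiableOn ℂ f {k | |k.im| < κ})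
    (hper : ∀ k ∈ strip κ, f (k + 2 * Real.pi) = f k) :
    ∫ x in (-Real.pi)..Real.pi, f x =
      ∫ x in (-Real.pi)..Real.pi, f (x + Complex.I * κ) := by
  have h := Complex.integral_boundary_rect_eq_zero_of_continuousOn_of_differentiableOn f
    (-Real.pi : ℂ) (Real.pi + κ * Complex.I) (hc.mono ?_) (hd.mono ?_)
  · have hz : (-Real.pi : ℂ).im = 0 := by simp
    have hz' : (-Real.pi : ℂ).re = -Real.pi := by simp
    have hw : (Real.pi + κ * Complex.I : ℂ).im = κ := by simp
    have hw' : (Real.pi + κ * Complex.I : ℂ).re = Real.pi := by simp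
    rw [hz, hz', hw, hw'] at h
    -- The vertical sides of the rectangle cancel by periodicity.
    have hside : ∫ y in (0 : ℝ)..κ, f ((Real.pi : ℝ) + y * Complex.I) =
        ∫ y in (0 : ℝ)..κ, f ((-Real.pi : ℝ) + y * Complex.I) := by
      refine intervalIntegral.integral_congr fun y hy => ?_
      rw [uIcc_of_le hκ.le] at hy
      rw [← hper ((-Real.pi : ℝ) + y * Complex.I)]
      · congr 1
        push_cast; ring
      · simp only [strip, mem_ofPred_eq]
        simpa [abs_of_nonneg hy.1] using hy.2
    rw [hside, add_sub_cancel_right, sub_eq_zero] at h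
    simp only [Complex.ofReal_zero, zero_mul, add_zero] at h
    rw [h]
    refine intervalIntegral.integral_congr fun x _ => ?_
    simp only [mul_comm]
  · intro k hk
    have := hk.2
    simp only [Complex.neg_im, Complex.ofReal_im, neg_zero, Complex.add_im, Complex.mul_im,
      Complex.ofReal_re, Complex.I_im, mul_one, Complex.I_re, mul_zero, add_zero, zero_add,
      mem_preimage, uIcc_of_le hκ.le] at this
    simp only [strip, mem_ofPred_eq, abs_of_nonneg this.1, this.2]
  · intro k hk
    have := hk.2
    simp only [Complex.neg_im, Complex.ofReal_im, neg_zero, Complex.add_im, Complex.mul_im,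
      Complex.ofReal_re, Complex.I_im, mul_one, Complex.I_re, mul_zero, add_zero, zero_add,
      mem_preimage, min_eq_left hκ.le, max_eq_right hκ.le] at this
    simp only [mem_ofPred_eq, abs_of_pos this.1, this.2]

end ContourShift

/-! ### The Bloch Hamiltonian in the complex strip. -/

namespace LatticeHamiltonian

variable {d : ℕ} {H : LatticeHamiltonian d} {κ : ℝ}

/-- `H₋ₙ = Hₙ†` has the same norm, so one-sided summability is symmetric in `n`; this gives a
uniform majorant on the whole closed strip. -/
lemma BlochWellDefined.summable_exp_abs (hH : H.BlochWellDefined κ) :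
    Summable fun n : ℤ => Real.exp (κ * |(n : ℝ)|) * ‖H.hopping n‖ := by
  have h1 : Summable fun n : ℤ => Real.exp (κ * n) * ‖H.hopping n‖ := by
    have := (Equiv.neg ℤ).summable_iff.2 hH
    refine this.congr fun n => ?_
    simp only [Function.comp_apply, Equiv.neg_apply, Int.cast_neg, neg_mul, mul_neg, neg_neg]
    rw [← H.conjTranspose_hopping, Matrix.l2_opNorm_conjTranspose]
  refine Summable.of_nonneg_of_le (fun n => by positivity) (fun n => ?_) (h1.add hH)
  rw [← add_mul]
  refine mul_le_mul_of_nonneg_right ?_ (norm_nonneg _)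
  rcases abs_cases (n : ℝ) with ⟨h, -⟩ | ⟨h, -⟩ <;> rw [h]
  · exact le_add_of_nonneg_right (Real.exp_nonneg _)
  · rw [mul_neg, ← neg_mul]; exact le_add_of_nonneg_left (Real.exp_nonneg _)

lemma norm_bloch_term_le {k : ℂ} (hk : k ∈ strip κ) (n : ℤ) :
    ‖Complex.exp (Complex.I * k * n) • H.hopping n‖ ≤
      Real.exp (κ * |(n : ℝ)|) * ‖H.hopping n‖ := by
  rw [norm_smul, Complex.norm_exp]
  refine mul_le_mul_of_nonneg_right (Real.exp_le_exp.2 ?_) (norm_nonneg _)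
  have h : (Complex.I * k * n).re = -k.im * n := by simp
  rw [h]
  calc -k.im * n ≤ |-k.im * n| := le_abs_self _
    _ = |k.im| * |(n : ℝ)| := by rw [abs_mul, abs_neg]
    _ ≤ _ := mul_le_mul_of_nonneg_right hk (abs_nonneg _)

lemma BlochWellDefined.continuousOn_bloch (hH : H.BlochWellDefined κ) :
    ContinuousOn H.bloch (strip κ) := by
  refine continuousOn_tsum (fun n => ?_) hH.summable_exp_abs
    fun n k hk => norm_bloch_term_le hk n
  fun_prop

lemma BlochWellDefined.differentiableOn_bloch (hH : H.BlochWellDefined κ) :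
    DifferentiableOn ℂ H.bloch {k | |k.im| < κ} := by
  refine Complex.differentiableOn_tsum_of_summable_norm hH.summable_exp_abs (fun n => ?_) ?_
    fun n k hk => norm_bloch_term_le (mem_strip.2 (le_of_lt hk)) n
  · fun_prop
  · exact isOpen_lt (by fun_prop) continuous_const

lemma bloch_add_two_pi (H : LatticeHamiltonian d) (k : ℂ) :
    H.bloch (k + 2 * Real.pi) = H.bloch k := by
  rw [bloch, bloch]
  refine tsum_congr fun n => ?_
  congr 1
  rw [← mul_one (Complex.exp (Complex.I * k * n)), ← exp_I_mul_two_pi_int n, ← Complex.exp_add]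
  congr 1; ring

end LatticeHamiltonian

variable {d : ℕ}

/-- An analytic function on the strip that is `2π`-periodic on the real axis is `2π`-periodic. -/
lemma periodic_of_analyticOnNhd {E : Type*} [NormedAddCommGroup E] [NormedSpace ℂ E] {f : ℂ → E}
    {κ : ℝ} (hκ : 0 < κ) (hf : AnalyticOnNhd ℂ f (strip κ))
    (hper : ∀ k : ℝ, f (k + 2 * Real.pi) = f k) (k : ℂ) (hk : k ∈ strip κ) :
    f (k + 2 * Real.pi) = f k := by
  have hconv : Convex ℝ (strip κ) := by
    have : strip κ = Complex.imLm ⁻¹' Icc (-κ) κ := by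
      ext k; simp [strip, abs_le]
    rw [this]
    exact (convex_Icc _ _).linear_preimage Complex.imLm
  have h1 : AnalyticOnNhd ℂ (fun k => f (k + 2 * Real.pi)) (strip κ) := by
    intro z hz
    have : AnalyticAt ℂ f (z + 2 * Real.pi) := hf _ (strip_periodic.2 hz)
    exact this.comp_of_eq (by fun_prop) rfl
  have h0 : (0 : ℂ) ∈ strip κ := by simp [strip, hκ.le]
  -- Identity theorem on the convex strip: agreement at small positive reals, which accumulate at 0,
  -- is enough.
  refine h1.eqOn_of_preconnected_of_frequently_eq hf hconv.isPreconnected h0 ?_ hk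
  rw [Filter.frequently_iff]
  intro U hU
  rw [mem_nhdsWithin] at hU
  obtain ⟨V, hV, h0V, hVU⟩ := hU
  obtain ⟨ε, hε, hball⟩ := Metric.isOpen_iff.1 hV 0 h0V
  refine ⟨((ε / 2 : ℝ) : ℂ), hVU ⟨hball ?_, ?_⟩, hper _⟩
  · simp only [Metric.mem_ball, dist_zero_right, Complex.norm_real, Real.norm_eq_abs]
    rw [abs_of_pos (by positivity)]; linarith
  · simp [hε.ne']

/-- The continuation of the Bloch matrices of the evolved projector to complex wave numbers. -/
def evolvedExtension (P₀ : ℂ → Matrix (Fin d) (Fin d) ℂ) (H : LatticeHamiltonian d) (t : ℝ)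
    (k : ℂ) : Matrix (Fin d) (Fin d) ℂ :=
  NormedSpace.exp ((-(Complex.I * t)) • H.bloch k) * P₀ k *
    NormedSpace.exp ((Complex.I * t) • H.bloch k)

/-! ### Exponential decay of the Fourier coefficients. -/

section Decay

variable {P₀ : ℂ → Matrix (Fin d) (Fin d) ℂ} {H₀ H : LatticeHamiltonian d} {κ : ℝ}

lemma differentiable_exp_matrix :
    Differentiable ℂ (NormedSpace.exp : Matrix (Fin d) (Fin d) ℂ → _) := fun x =>
  (NormedSpace.exp_analytic (𝕂 := ℂ) x).differentiableAt

lemma continuousOn_exp_bloch (hH : H.BlochWellDefined κ) (c : ℂ) :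
    ContinuousOn (fun k => NormedSpace.exp (c • H.bloch k)) (strip κ) :=
  (differentiable_exp_matrix (d := d)).continuous.comp_continuousOn (hH.continuousOn_bloch.const_smul c)

lemma differentiableOn_exp_bloch (hH : H.BlochWellDefined κ) (c : ℂ) :
    DifferentiableOn ℂ (fun k => NormedSpace.exp (c • H.bloch k)) {k | |k.im| < κ} :=
  (differentiable_exp_matrix (d := d)).comp_differentiableOn (hH.differentiableOn_bloch.const_smul c)

lemma continuousOn_evolvedExtension (hP₀ : AnalyticOnNhd ℂ P₀ (strip κ))
    (hH : H.BlochWellDefined κ) (t : ℝ) :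
    ContinuousOn (evolvedExtension P₀ H t) (strip κ) :=
  ContinuousOn.mul (ContinuousOn.mul (continuousOn_exp_bloch hH _) hP₀.continuousOn)
    (continuousOn_exp_bloch hH _)

lemma differentiableOn_evolvedExtension (hP₀ : AnalyticOnNhd ℂ P₀ (strip κ))
    (hH : H.BlochWellDefined κ) (t : ℝ) :
    DifferentiableOn ℂ (evolvedExtension P₀ H t) {k | |k.im| < κ} := by
  have h2 : DifferentiableOn ℂ P₀ {k | |k.im| < κ} :=
    hP₀.differentiableOn.mono fun k hk => mem_strip.2 (le_of_lt hk)
  exact DifferentiableOn.mul (DifferentiableOn.mul (differentiableOn_exp_bloch hH _) h2)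
    (differentiableOn_exp_bloch hH _)

lemma fourierCoeff_evolvedSymbol (hκ : 0 < κ) (hgap : H₀.Gapped)
    (hP₀ : ∀ k : ℝ, P₀ k = fermiProjector (H₀.bloch k))
    (hP₀a : AnalyticOnNhd ℂ P₀ (strip κ)) (hH : H.BlochWellDefined κ) (t : ℝ) (n : ℤ) :
    fourierCoeff (evolvedSymbol H₀ H t) n = (1 / (2 * Real.pi)) •
      ∫ x in (-Real.pi)..Real.pi, Complex.exp (-(Complex.I * (x + Complex.I * κ) * n)) •
        evolvedExtension P₀ H t (x + Complex.I * κ) := by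
  rw [fourierCoeff_eq_intervalIntegral _ n (-Real.pi),
    show -Real.pi + 2 * Real.pi = Real.pi by ring]
  congr 1
  have hsh := integral_eq_integral_add_I_mul (f := fun k =>
    Complex.exp (-(Complex.I * k * n)) • evolvedExtension P₀ H t k) hκ ?_ ?_ ?_
  · rw [← hsh]
    refine intervalIntegral.integral_congr fun x _ => ?_
    rw [LatticeHamiltonian.fourier_coe_two_pi, evolvedSymbol_coe hgap, evolvedExtension, hP₀]
    congr 2
    push_cast; ring
  · have : ContinuousOn (fun k : ℂ => Complex.exp (-(Complex.I * k * n))) (strip κ) := by fun_prop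
    exact this.smul (continuousOn_evolvedExtension hP₀a hH t)
  · have : DifferentiableOn ℂ (fun k : ℂ => Complex.exp (-(Complex.I * k * n)))
        {k | |k.im| < κ} := by fun_prop
    exact this.smul (differentiableOn_evolvedExtension hP₀a hH t)
  · intro k hk
    have hper : P₀ (k + 2 * Real.pi) = P₀ k := by
      refine periodic_of_analyticOnNhd hκ hP₀a (fun k => ?_) k hk
      have := hP₀ (k + 2 * Real.pi)
      push_cast at this
      rw [this, hP₀, LatticeHamiltonian.bloch_add_two_pi]
    simp only [evolvedExtension, LatticeHamiltonian.bloch_add_two_pi, hper]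
    congr 1
    rw [← mul_one (Complex.exp (-(Complex.I * k * n))), ← exp_I_mul_two_pi_int (-n),
      ← Complex.exp_add]
    congr 1
    push_cast; ring

/-- The average of the norm of the evolved Bloch projectors on the shifted contour. -/
def contourMean (P₀ : ℂ → Matrix (Fin d) (Fin d) ℂ) (H : LatticeHamiltonian d) (κ t : ℝ) : ℝ :=
  1 / (2 * Real.pi) * ∫ x in (-Real.pi)..Real.pi, ‖evolvedExtension P₀ H t (x + Complex.I * κ)‖

lemma norm_fourierCoeff_evolvedSymbol_le (hκ : 0 < κ) (hgap : H₀.Gapped)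
    (hP₀ : ∀ k : ℝ, P₀ k = fermiProjector (H₀.bloch k))
    (hP₀a : AnalyticOnNhd ℂ P₀ (strip κ)) (hH : H.BlochWellDefined κ) (t : ℝ) (n : ℤ) :
    ‖fourierCoeff (evolvedSymbol H₀ H t) n‖ ≤ contourMean P₀ H κ t * Real.exp (κ * n) := by
  rw [fourierCoeff_evolvedSymbol hκ hgap hP₀ hP₀a hH, norm_smul, contourMean, mul_assoc,
    Real.norm_of_nonneg (by positivity)]
  refine mul_le_mul_of_nonneg_left ?_ (by positivity)
  refine (intervalIntegral.norm_integral_le_integral_norm (by linarith [Real.pi_pos])).trans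
    (le_of_eq ?_)
  rw [← intervalIntegral.integral_mul_const]
  refine intervalIntegral.integral_congr fun x _ => ?_
  rw [norm_smul, Complex.norm_exp, mul_comm]
  congr 2
  simp

lemma isSelfAdjoint_evolvedSymbol (H₀ H : LatticeHamiltonian d) (t : ℝ) :
    IsSelfAdjoint (evolvedSymbol H₀ H t) := by
  have h : ∀ c : ℂ, star (NormedSpace.exp (c • H.symbol)) =
      NormedSpace.exp (star c • H.symbol) := by
    intro c
    rw [NormedSpace.star_exp, star_smul, H.isSelfAdjoint_symbol.star_eq]
  rw [IsSelfAdjoint, evolvedSymbol, star_mul, star_mul, h, h,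
    (isSelfAdjoint_fermiProjector _).star_eq, ← mul_assoc]
  simp

/-- Taking a matrix entry, as a continuous linear map. -/
def entryCLM (a b : Fin d) : Matrix (Fin d) (Fin d) ℂ →L[ℂ] ℂ :=
  LinearMap.toContinuousLinearMap (Matrix.entryLinearMap ℂ ℂ a b)

lemma fourierCoeff_apply (p : C(AddCircle (2 * Real.pi), Matrix (Fin d) (Fin d) ℂ)) (n : ℤ)
    (a b : Fin d) : fourierCoeff p n a b = fourierCoeff (fun x => p x a b) n := by
  have hint : Integrable (fun x => fourier (-n) x • p x) (AddCircle.haarAddCircle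
      (T := 2 * Real.pi)) := by
    have : Continuous (fun x => fourier (-n) x • p x) := by fun_prop
    exact this.integrable_of_hasCompactSupport (HasCompactSupport.of_compactSpace _)
  exact (ContinuousLinearMap.integral_comp_comm (entryCLM a b) hint).symm

lemma fourierCoeff_neg_of_isSelfAdjoint
    {p : C(AddCircle (2 * Real.pi), Matrix (Fin d) (Fin d) ℂ)} (hp : IsSelfAdjoint p) (n : ℤ) :
    fourierCoeff p (-n) = (fourierCoeff p n)ᴴ := by
  ext a b
  rw [Matrix.conjTranspose_apply, fourierCoeff_apply, fourierCoeff_apply, fourierCoeff,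
    fourierCoeff, RCLike.star_def, ← integral_conj]
  refine integral_congr_ae (Filter.Eventually.of_forall fun x => ?_)
  have h : p x = (p x)ᴴ :=
    (congrArg (fun f : C(AddCircle (2 * Real.pi), Matrix (Fin d) (Fin d) ℂ) => f x) hp).symm
  have h' : p x a b = (starRingEnd ℂ) (p x b a) := by
    conv_lhs => rw [h]
    rfl
  simp only [smul_eq_mul, map_mul]
  rw [← h', ← fourier_neg]

/-- Raising the contour by `κ` gives the factor `exp (κ n)`, which decays only for negative `n`; for
positive `n` self-adjointness of the symbol exchanges `n` and `-n`. -/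
lemma norm_fourierCoeff_evolvedSymbol_le_exp_neg_abs (hκ : 0 < κ) (hgap : H₀.Gapped)
    (hP₀ : ∀ k : ℝ, P₀ k = fermiProjector (H₀.bloch k))
    (hP₀a : AnalyticOnNhd ℂ P₀ (strip κ)) (hH : H.BlochWellDefined κ) (t : ℝ) (n : ℤ) :
    ‖fourierCoeff (evolvedSymbol H₀ H t) n‖ ≤
      contourMean P₀ H κ t * Real.exp (-κ * |(n : ℝ)|) := by
  rcases abs_cases (n : ℝ) with ⟨h, -⟩ | ⟨h, -⟩ <;> rw [h]
  · have := norm_fourierCoeff_evolvedSymbol_le hκ hgap hP₀ hP₀a hH t (-n)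
    rw [fourierCoeff_neg_of_isSelfAdjoint (isSelfAdjoint_evolvedSymbol H₀ H t),
      Matrix.l2_opNorm_conjTranspose] at this
    simpa using this
  · simpa using norm_fourierCoeff_evolvedSymbol_le hκ hgap hP₀ hP₀a hH t n

end Decay

/-! ### Particle-hole symmetry under time evolution. -/

section ParticleHole

variable {d : ℕ} {W : Matrix.unitaryGroup (Fin d) ℂ} {H₀ H : LatticeHamiltonian d}

lemma exp_neg_mul_exp {A : Type*} [NormedRing A] [NormedAlgebra ℂ A] [CompleteSpace A] (x : A) :
    NormedSpace.exp (-x) * NormedSpace.exp x = 1 := by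
  let _ : NormedAlgebra ℚ A := NormedAlgebra.restrictScalars ℚ ℂ A
  rw [← NormedSpace.exp_add_of_commute (Commute.neg_left (Commute.refl x)), neg_add_cancel,
    NormedSpace.exp_zero]

lemma exp_mul_exp_neg {A : Type*} [NormedRing A] [NormedAlgebra ℂ A] [CompleteSpace A] (x : A) :
    NormedSpace.exp x * NormedSpace.exp (-x) = 1 := by
  simpa using exp_neg_mul_exp (-x)

namespace LatticeHamiltonian.ParticleHoleSymmetric

lemma antiunitaryConj_bloch (hH : H.ParticleHoleSymmetric W) (k : ℝ) :
    antiunitaryConj W (H.bloch k) = -H.bloch (-k : ℝ) := by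
  rw [antiunitaryConj_apply, hH k, Complex.ofReal_neg]

/-- The sign from conjugating `i` cancels the one in `H(k) ↦ -H(-k)`, so the evolution respects the
real structure. -/
lemma antiunitaryConj_exp (hH : H.ParticleHoleSymmetric W) (s k : ℝ) :
    antiunitaryConj W (NormedSpace.exp ((Complex.I * s) • H.bloch k)) =
      NormedSpace.exp ((Complex.I * s) • H.bloch (-k : ℝ)) := by
  rw [map_exp_complex _ (continuous_antiunitaryConj W), antiunitaryConj_smul,
    hH.antiunitaryConj_bloch]
  congr 1
  simp

end LatticeHamiltonian.ParticleHoleSymmetric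

lemma bloch_neg_pi (H : LatticeHamiltonian d) :
    H.bloch ((-Real.pi : ℝ) : ℂ) = H.bloch (Real.pi : ℝ) := by
  rw [← H.bloch_add_two_pi]
  congr 1
  push_cast; ring

/-- At a particle-hole symmetric wave number the evolution preserves the orientation. -/
lemma det_exp_bloch_pos (hH : H.ParticleHoleSymmetric W) {k : ℝ}
    (hk : H.bloch ((-k : ℝ) : ℂ) = H.bloch k) (s : ℝ) :
    ∃ r : ℝ, 0 < r ∧ (NormedSpace.exp ((Complex.I * s) • H.bloch k)).det = r := by
  -- The evolution over half the time is real, so the full determinant is the square of a nonzero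
  -- real number.
  set E := NormedSpace.exp ((Complex.I * (s / 2 : ℝ)) • H.bloch k) with hE
  have hEE : NormedSpace.exp ((Complex.I * s) • H.bloch k) = E * E := by
    let _ : NormedAlgebra ℚ (Matrix (Fin d) (Fin d) ℂ) := NormedAlgebra.restrictScalars ℚ ℂ _
    rw [hE, ← NormedSpace.exp_add_of_commute (Commute.refl _), ← add_smul]
    congr 2
    push_cast; ring
  have hEW : antiunitaryConj W E = E := by rw [hE, hH.antiunitaryConj_exp, hk]
  have hdet := det_eq_ofReal_of_antiunitaryConj_eq hEW
  have hne : E.det ≠ 0 := by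
    have := congrArg Matrix.det (exp_neg_mul_exp ((Complex.I * (s / 2 : ℝ)) • H.bloch k))
    rw [Matrix.det_mul, Matrix.det_one] at this
    exact right_ne_zero_of_mul (this ▸ one_ne_zero)
  refine ⟨E.det.re * E.det.re, ?_, ?_⟩
  · have : E.det.re ≠ 0 := fun h => hne (by rw [hdet, h, Complex.ofReal_zero])
    exact mul_self_pos.2 this
  · rw [hEE, Matrix.det_mul, Complex.ofReal_mul, ← hdet]

/-- The evolved flat-band Hamiltonian `1 - 2 P_<(k, t)`. -/
def evolvedFlat (H₀ H : LatticeHamiltonian d) (t k : ℝ) : Matrix (Fin d) (Fin d) ℂ :=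
  1 - (2 : ℝ) • evolvedSymbol H₀ H t (k : AddCircle (2 * Real.pi))

lemma continuous_evolvedFlat (t : ℝ) : Continuous (evolvedFlat H₀ H t) := by
  have h : Continuous fun k : ℝ => evolvedSymbol H₀ H t (k : AddCircle (2 * Real.pi)) :=
    (evolvedSymbol H₀ H t).continuous.comp (AddCircle.continuous_mk' _)
  exact continuous_const.sub ((continuous_const_smul (2 : ℝ)).comp h)

lemma evolvedFlat_periodic (t : ℝ) : Function.Periodic (evolvedFlat H₀ H t) (2 * Real.pi) := by
  intro k
  rw [evolvedFlat, AddCircle.coe_add_period, evolvedFlat]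

lemma star_evolvedFlat (t k : ℝ) : star (evolvedFlat H₀ H t k) = evolvedFlat H₀ H t k := by
  have h : star (evolvedSymbol H₀ H t (k : AddCircle (2 * Real.pi))) =
      evolvedSymbol H₀ H t (k : AddCircle (2 * Real.pi)) :=
    congrArg (fun f : C(AddCircle (2 * Real.pi), Matrix (Fin d) (Fin d) ℂ) => f k)
      (isSelfAdjoint_evolvedSymbol H₀ H t)
  simp [evolvedFlat, h]

lemma evolvedFlat_eq (hgap : H₀.Gapped) (t k : ℝ) : evolvedFlat H₀ H t k =
    NormedSpace.exp (-((Complex.I * t) • H.bloch k)) * flatten (H₀.bloch k) *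
      NormedSpace.exp ((Complex.I * t) • H.bloch k) := by
  rw [evolvedFlat, evolvedSymbol_coe hgap, flatten, mul_sub, sub_mul, mul_one, exp_neg_mul_exp,
    mul_smul_comm, smul_mul_assoc, neg_smul]

lemma flatten_mul_self {A : Type*} [CStarAlgebra A] {a : A} (h0 : IsUnit a) :
    flatten a * flatten a = 1 := by
  have := fermiProjector_mul_self ((spectrum.zero_notMem_iff ℝ).2 h0)
  rw [flatten, sub_mul, mul_sub, mul_sub, smul_mul_smul_comm, this, one_mul, one_mul, mul_one]
  module

lemma evolvedFlat_mul_self (hgap : H₀.Gapped) (t k : ℝ) :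
    evolvedFlat H₀ H t k * evolvedFlat H₀ H t k = 1 := by
  rw [evolvedFlat_eq hgap]
  set E := NormedSpace.exp ((Complex.I * t) • H.bloch k)
  set E' := NormedSpace.exp (-((Complex.I * t) • H.bloch k))
  have h1 : E' * E = 1 := exp_neg_mul_exp _
  have h2 : E * E' = 1 := exp_mul_exp_neg _
  set F := flatten (H₀.bloch k)
  have h3 : F * F = 1 := flatten_mul_self (hgap.isUnit_bloch k)
  calc E' * F * E * (E' * F * E) = E' * F * (E * E') * F * E := by simp only [mul_assoc]
    _ = E' * (F * F) * E := by rw [h2, mul_one]; simp only [mul_assoc]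
    _ = 1 := by rw [h3, mul_one, h1]

lemma antiunitaryConj_flatten (h₀C : H₀.ParticleHoleSymmetric W) (hgap : H₀.Gapped) (k : ℝ) :
    antiunitaryConj W (flatten (H₀.bloch k)) = -flatten (H₀.bloch (-k : ℝ)) := by
  rw [flatten, map_sub, map_one, map_smul, antiunitaryConj_fermiProjector
    (H₀.isSelfAdjoint_bloch k) (hgap.isUnit_bloch k) (h₀C.antiunitaryConj_bloch k), flatten]
  module

lemma antiunitaryConj_evolvedFlat (h₀C : H₀.ParticleHoleSymmetric W)
    (hC : H.ParticleHoleSymmetric W) (hgap : H₀.Gapped) (t k : ℝ) :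
    antiunitaryConj W (evolvedFlat H₀ H t k) = -evolvedFlat H₀ H t (-k) := by
  have h1 := hC.antiunitaryConj_exp t k
  have h2 := hC.antiunitaryConj_exp (-t) k
  simp only [Complex.ofReal_neg t, mul_neg, neg_smul] at h2
  rw [evolvedFlat_eq hgap, evolvedFlat_eq hgap, map_mul, map_mul, h1, h2,
    antiunitaryConj_flatten h₀C hgap]
  simp only [mul_neg, neg_mul]

/-- The flat-band Hamiltonians at `k = 0` and `k = π` of a topologically nontrivial chain are
related by an orientation-reversing real intertwiner, at all times. -/
lemma exists_intertwiner_evolvedFlat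
    (hW : (W : Matrix (Fin d) (Fin d) ℂ) * (W : Matrix (Fin d) (Fin d) ℂ).map star = 1)
    (h₀C : H₀.ParticleHoleSymmetric W) (hC : H.ParticleHoleSymmetric W) (hgap : H₀.Gapped)
    (htop : TopologicallyNontrivial H₀ W) (t : ℝ) :
    ∃ u : Matrix (Fin d) (Fin d) ℂ, antiunitaryConj W u = u ∧
      u * evolvedFlat H₀ H t 0 = evolvedFlat H₀ H t Real.pi * u ∧ u.det.re < 0 := by
  have hz : ((-0 : ℝ) : ℂ) = ((0 : ℝ) : ℂ) := by simp
  have h0 := h₀C.antiunitaryConj_bloch 0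
  have hπ := h₀C.antiunitaryConj_bloch Real.pi
  rw [hz] at h0
  rw [bloch_neg_pi] at hπ
  have hf0 := antiunitaryConj_flatten h₀C hgap 0
  have hfπ := antiunitaryConj_flatten h₀C hgap Real.pi
  rw [hz] at hf0
  rw [bloch_neg_pi] at hfπ
  obtain ⟨V, hV, hVM⟩ := exists_intertwiner_of_continuous (continuous_evolvedFlat (H₀ := H₀)
    (H := H) 0) (evolvedFlat_mul_self hgap 0) 0 Real.pi
  have hflat : ∀ k : ℝ, evolvedFlat H₀ H 0 k = flatten (H₀.bloch k) := by
    intro k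
    rw [evolvedFlat_eq hgap]
    simp [NormedSpace.exp_zero]
  rw [hflat, hflat] at hVM
  obtain ⟨u, hu, huW, huM⟩ := exists_real_intertwiner hW hf0 hfπ hV hVM
  have hneg := det_re_neg_of_pfaffian_div_neg hW (H₀.isSelfAdjoint_bloch 0) (hgap.isUnit_bloch 0)
    h0 (H₀.isSelfAdjoint_bloch Real.pi) (hgap.isUnit_bloch Real.pi) hπ hu huW huM
    (by simpa [TopologicallyNontrivial] using htop)
  have hE0 := hC.antiunitaryConj_exp t 0
  rw [hz] at hE0
  have hEπ := hC.antiunitaryConj_exp (-t) Real.pi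
  rw [bloch_neg_pi] at hEπ
  obtain ⟨r, hr, hrdet⟩ := det_exp_bloch_pos hC (k := 0) (by rw [hz]) t
  obtain ⟨s, hs, hsdet⟩ := det_exp_bloch_pos hC (k := Real.pi) (bloch_neg_pi H) (-t)
  simp only [Complex.ofReal_neg t, mul_neg, neg_smul] at hEπ hsdet
  rw [evolvedFlat_eq hgap, evolvedFlat_eq hgap]
  have h1 := exp_mul_exp_neg ((Complex.I * t) • H.bloch (0 : ℝ))
  have h2 := exp_mul_exp_neg ((Complex.I * t) • H.bloch Real.pi)
  set E0 := NormedSpace.exp ((Complex.I * t) • H.bloch (0 : ℝ))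
  set E0' := NormedSpace.exp (-((Complex.I * t) • H.bloch (0 : ℝ)))
  set Eπ := NormedSpace.exp ((Complex.I * t) • H.bloch Real.pi)
  set Eπ' := NormedSpace.exp (-((Complex.I * t) • H.bloch Real.pi))
  set F := flatten (H₀.bloch (0 : ℝ))
  set G := flatten (H₀.bloch Real.pi)
  -- The initial intertwiner is carried along by the evolutions at 0 and `π`, whose positive
  -- determinants preserve its sign.
  refine ⟨Eπ' * u * E0, by rw [map_mul, map_mul, hEπ, huW, hE0], ?_, ?_⟩
  · calc Eπ' * u * E0 * (E0' * F * E0) = Eπ' * u * (E0 * E0') * F * E0 := by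
          simp only [mul_assoc]
      _ = Eπ' * (u * F) * E0 := by rw [h1, mul_one]; simp only [mul_assoc]
      _ = Eπ' * G * 1 * u * E0 := by rw [huM, mul_one]; simp only [mul_assoc]
      _ = _ := by rw [← h2]; simp only [mul_assoc]
  · rw [Matrix.det_mul, Matrix.det_mul, hrdet, hsdet, mul_assoc, Complex.re_ofReal_mul,
      Complex.re_mul_ofReal]
    exact mul_neg_of_pos_of_neg hs (mul_neg_of_neg_of_pos hneg hr)

end ParticleHole

/-! ### Biorthogonal bands, the velocity and the prefactor. -/

section RankOne

variable {d : ℕ}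

lemma norm_rankOne_le (u v : EuclideanSpace ℂ (Fin d)) :
    ‖(Matrix.of fun a b => u a * star (v b) : Matrix (Fin d) (Fin d) ℂ)‖ ≤ ‖u‖ * ‖v‖ := by
  rw [Matrix.cstar_norm_def]
  refine ContinuousLinearMap.opNorm_le_bound _ (by positivity) fun x => ?_
  have h : Matrix.toEuclideanCLM (n := Fin d) (𝕜 := ℂ) (Matrix.of fun a b => u a * star (v b)) x =
      (inner ℂ v x) • u := by
    ext a
    rw [Matrix.ofLp_toEuclideanCLM]
    simp only [Matrix.mulVec, dotProduct, Matrix.of_apply, PiLp.smul_apply, smul_eq_mul,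
      PiLp.inner_apply, RCLike.inner_apply, RCLike.star_def, Finset.sum_mul]
    refine Finset.sum_congr rfl fun b _ => ?_
    ring
  rw [h, norm_smul, mul_comm (‖u‖), mul_right_comm]
  exact mul_le_mul_of_nonneg_right (norm_inner_le_norm v x) (norm_nonneg _)

namespace Diagonalization

variable {A : ℝ → Matrix (Fin d) (Fin d) ℂ} (D : Diagonalization A)

/-- The matrix of right eigenvectors. -/
def rightMatrix (k : ℝ) : Matrix (Fin d) (Fin d) ℂ := Matrix.of fun a α => D.right k α a

/-- The matrix of left eigenvectors. -/
def leftMatrix (k : ℝ) : Matrix (Fin d) (Fin d) ℂ := Matrix.of fun α a => star (D.left k α a)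

variable {k : ℝ}

lemma leftMatrix_mul_rightMatrix (hk : k ∈ Icc (-Real.pi) Real.pi) :
    D.leftMatrix k * D.rightMatrix k = 1 := by
  ext α β
  have := D.biorthonormal k hk α β
  rw [Matrix.one_apply, ← this, PiLp.inner_apply, Matrix.mul_apply]
  simp only [leftMatrix, rightMatrix, Matrix.of_apply, RCLike.inner_apply, RCLike.star_def]
  exact Finset.sum_congr rfl fun a _ => mul_comm _ _

lemma sum_smul_rankOne (f : Fin d → ℂ) :
    ∑ α, f α • Matrix.of (fun a b => D.right k α a * star (D.left k α b)) =
      D.rightMatrix k * Matrix.diagonal f * D.leftMatrix k := by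
  ext a b
  rw [Matrix.sum_apply, Matrix.mul_apply]
  refine Finset.sum_congr rfl fun α _ => ?_
  rw [Matrix.mul_diagonal]
  simp only [rightMatrix, leftMatrix, Matrix.smul_apply, Matrix.of_apply, smul_eq_mul]
  ring

lemma eq_mul_diagonal_mul (hk : k ∈ Icc (-Real.pi) Real.pi) :
    A k = D.rightMatrix k * Matrix.diagonal (D.energy k) * D.leftMatrix k := by
  rw [D.decomposition k hk, sum_smul_rankOne]

lemma rightMatrix_mul_leftMatrix (hk : k ∈ Icc (-Real.pi) Real.pi) :
    D.rightMatrix k * D.leftMatrix k = 1 :=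
  mul_eq_one_comm.1 (D.leftMatrix_mul_rightMatrix hk)

lemma exp_smul_eq (hk : k ∈ Icc (-Real.pi) Real.pi) (c : ℂ) :
    NormedSpace.exp (c • A k) = ∑ α, Complex.exp (c * D.energy k α) •
      Matrix.of (fun a b => D.right k α a * star (D.left k α b)) := by
  have hinv : (D.rightMatrix k)⁻¹ = D.leftMatrix k :=
    Matrix.inv_eq_left_inv (D.leftMatrix_mul_rightMatrix hk)
  have hunit : IsUnit (D.rightMatrix k) :=
    IsUnit.of_mul_eq_one _ (D.rightMatrix_mul_leftMatrix hk)
  have h1 : c • A k =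
      D.rightMatrix k * Matrix.diagonal (fun α => c * D.energy k α) * (D.rightMatrix k)⁻¹ := by
    rw [D.eq_mul_diagonal_mul hk, hinv, ← smul_mul_assoc, ← mul_smul_comm, ← Matrix.diagonal_smul]
    rfl
  rw [h1, Matrix.exp_conj _ _ hunit, Matrix.exp_diagonal, hinv, sum_smul_rankOne]
  congr 3
  ext α
  rw [Pi.coe_exp, Complex.exp_eq_exp_ℂ]

/-- Describing the energies as zeros of a determinant frees them from their labels, which need not
depend continuously on `k`. -/
lemma mem_spectrum_iff (hk : k ∈ Icc (-Real.pi) Real.pi) (z : ℂ) :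
    (Matrix.scalar (Fin d) z - A k).det = 0 ↔ ∃ α, z = D.energy k α := by
  have h : Matrix.scalar (Fin d) z - A k =
      D.rightMatrix k * Matrix.diagonal (fun α => z - D.energy k α) * D.leftMatrix k := by
    have h1 : Matrix.diagonal (fun α => z - D.energy k α) =
        Matrix.scalar (Fin d) z - Matrix.diagonal (D.energy k) := by
      rw [Matrix.scalar_apply, Matrix.diagonal_sub]
    rw [h1, mul_sub, sub_mul, ← D.eq_mul_diagonal_mul hk, ← (Matrix.scalar_commute z
      (fun _ => Commute.all _ _) _).eq, mul_assoc, D.rightMatrix_mul_leftMatrix hk, mul_one]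
  rw [h, Matrix.det_mul_right_comm, D.rightMatrix_mul_leftMatrix hk, one_mul, Matrix.det_diagonal,
    Finset.prod_eq_zero_iff]
  simp [sub_eq_zero]

/-- The bands at complex wave number depend continuously on `k`, so that the largest relative
velocity is attained. -/
theorem isGreatest_velocity (hA : ContinuousOn A (Icc (-Real.pi) Real.pi)) (hd : d ≠ 0) (κ : ℝ) :
    IsGreatest (relativeVelocities D κ) (velocity D κ) := by
  have : NeZero d := ⟨hd⟩
  set I := Icc (-Real.pi) Real.pi
  obtain ⟨C, hC⟩ := (isCompact_Icc.image_of_continuousOn hA).isBounded.exists_norm_le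
  have hbound : ∀ k ∈ I, ∀ α, ‖D.energy k α‖ ≤ C := by
    intro k hk α
    have h1 : D.energy k α ∈ spectrum ℂ (A k) := by
      rw [spectrum.mem_iff, Matrix.isUnit_iff_isUnit_det, isUnit_iff_ne_zero, not_not]
      exact (D.mem_spectrum_iff hk _).2 ⟨α, rfl⟩
    exact (spectrum.norm_le_norm_of_mem h1).trans (hC _ ⟨k, hk, rfl⟩)
  -- The velocities are the continuous image of the compact set of triples `(k, z, w)` with `z` and
  -- `w` both eigenvalues of `A k`.
  set K : Set (ℝ × ℂ × ℂ) := I ×ˢ (Metric.closedBall 0 C ×ˢ Metric.closedBall 0 C)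
  have hK : IsCompact K := isCompact_Icc.prod
    ((isCompact_closedBall _ _).prod (isCompact_closedBall _ _))
  set f : ℝ × ℂ × ℂ → ℂ × ℂ := fun p => ((Matrix.scalar (Fin d) p.2.1 - A p.1).det,
    (Matrix.scalar (Fin d) p.2.2 - A p.1).det)
  have hAK : ContinuousOn (fun p : ℝ × ℂ × ℂ => A p.1) K :=
    hA.comp continuousOn_fst fun p hp => hp.1
  have hsc : ∀ g : ℝ × ℂ × ℂ → ℂ, Continuous g → ContinuousOn
      (fun p => (Matrix.scalar (Fin d) (g p) - A p.1).det) K := by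
    intro g hg
    have h1 : Continuous fun p => Matrix.scalar (Fin d) (g p) := by
      simp only [Matrix.scalar_apply]
      exact Continuous.matrix_diagonal (continuous_pi fun _ => hg)
    exact (continuous_id.matrix_det).comp_continuousOn (h1.continuousOn.sub hAK)
  have hf : ContinuousOn f K :=
    (hsc _ (by fun_prop)).prodMk (hsc _ (by fun_prop))
  have hS : IsCompact (K ∩ f ⁻¹' {0}) :=
    hK.of_isClosed_subset (hf.preimage_isClosed_of_isClosed hK.isClosed isClosed_singleton)
      inter_subset_left
  have himage : relativeVelocities D κ =
      (fun p : ℝ × ℂ × ℂ => κ⁻¹ * (p.2.1 - p.2.2).im) '' (K ∩ f ⁻¹' {0}) := by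
    ext x
    constructor
    · rintro ⟨k, hk, α, β, rfl⟩
      refine ⟨(k, D.energy k α, D.energy k β), ⟨⟨hk, ?_, ?_⟩, ?_⟩, rfl⟩
      · simpa using hbound k hk α
      · simpa using hbound k hk β
      · exact Prod.ext ((D.mem_spectrum_iff hk _).2 ⟨α, rfl⟩)
          ((D.mem_spectrum_iff hk _).2 ⟨β, rfl⟩)
    · rintro ⟨⟨k, z, w⟩, ⟨⟨hk, -⟩, hf0⟩, rfl⟩
      obtain ⟨α, hα⟩ := (D.mem_spectrum_iff hk z).1 (congrArg Prod.fst hf0)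
      obtain ⟨β, hβ⟩ := (D.mem_spectrum_iff hk w).1 (congrArg Prod.snd hf0)
      exact ⟨k, hk, α, β, by simp only [hα, hβ]⟩
  have hcomp : IsCompact (relativeVelocities D κ) := by
    rw [himage]
    exact hS.image (by fun_prop)
  have hne : (relativeVelocities D κ).Nonempty :=
    ⟨_, 0, ⟨by linarith [Real.pi_pos], Real.pi_pos.le⟩, 0, 0, rfl⟩
  exact hcomp.isGreatest_sSup hne

end Diagonalization

variable {P₀ : ℂ → Matrix (Fin d) (Fin d) ℂ} {H : LatticeHamiltonian d} {κ : ℝ}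

/-- Expanding both exponentials in rank-one projectors, the pair `α, β` carries a phase of modulus
`exp (t Im (ε_α - ε_β))`, at most `exp (κ v t)` by the definition of the velocity. -/
lemma norm_evolvedExtension_le
    (D : Diagonalization fun k : ℝ => H.bloch (k + Complex.I * κ)) (hκ : 0 < κ)
    (hv : IsGreatest (relativeVelocities D κ) (velocity D κ)) {t : ℝ} (ht : 0 ≤ t) {k : ℝ}
    (hk : k ∈ Icc (-Real.pi) Real.pi) :
    ‖evolvedExtension P₀ H t (k + Complex.I * κ)‖ ≤ Real.exp (κ * velocity D κ * t) *
      ((∑ α, ‖D.right k α‖ * ‖D.left k α‖) ^ 2 * ‖P₀ (k + Complex.I * κ)‖) := by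
  rw [evolvedExtension, D.exp_smul_eq hk, D.exp_smul_eq hk]
  set R : Fin d → Matrix (Fin d) (Fin d) ℂ := fun α =>
    Matrix.of fun a b => D.right k α a * star (D.left k α b)
  set r : Fin d → ℝ := fun α => ‖D.right k α‖ * ‖D.left k α‖
  set P := P₀ (k + Complex.I * κ)
  rw [Finset.sum_mul, Finset.sum_mul_sum, sq, Finset.sum_mul_sum, Finset.sum_mul,
    Finset.mul_sum]
  refine (norm_sum_le _ _).trans (Finset.sum_le_sum fun α _ => ?_)
  rw [Finset.sum_mul, Finset.mul_sum]
  refine (norm_sum_le _ _).trans (Finset.sum_le_sum fun β _ => ?_)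
  rw [smul_mul_assoc, smul_mul_smul_comm, norm_smul]
  have h1 : ‖Complex.exp (-(Complex.I * t) * D.energy k α) *
      Complex.exp (Complex.I * t * D.energy k β)‖ ≤ Real.exp (κ * velocity D κ * t) := by
    rw [← Complex.exp_add, Complex.norm_exp]
    refine Real.exp_le_exp.2 ?_
    have h2 : κ⁻¹ * (D.energy k α - D.energy k β).im ≤ velocity D κ :=
      hv.2 ⟨k, hk, α, β, rfl⟩
    rw [inv_mul_le_iff₀ hκ] at h2
    have h3 : (-(Complex.I * t) * D.energy k α + Complex.I * t * D.energy k β).re =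
        (D.energy k α - D.energy k β).im * t := by
      simp; ring
    rw [h3]
    exact mul_le_mul_of_nonneg_right h2 ht
  have h4 : ‖R α * P * R β‖ ≤ r α * r β * ‖P‖ := by
    calc ‖R α * P * R β‖ ≤ ‖R α‖ * ‖P‖ * ‖R β‖ := norm_mul₃_le
      _ ≤ r α * ‖P‖ * r β := by
        gcongr
        · exact norm_rankOne_le _ _
        · exact norm_rankOne_le _ _
      _ = _ := by ring
  exact mul_le_mul h1 h4 (norm_nonneg _) (Real.exp_nonneg _)

/-- The comparison is made between lower integrals in `[0, ∞]`, as the eigenvectors need be neither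
measurable nor bounded in `k`. -/
lemma ofReal_contourMean_le (D : Diagonalization fun k : ℝ => H.bloch (k + Complex.I * κ))
    (hκ : 0 < κ) (hv : IsGreatest (relativeVelocities D κ) (velocity D κ)) {t : ℝ} (ht : 0 ≤ t)
    (hP₀a : AnalyticOnNhd ℂ P₀ (strip κ)) (hH : H.BlochWellDefined κ) :
    ENNReal.ofReal (contourMean P₀ H κ t) ≤
      ENNReal.ofReal (Real.exp (κ * velocity D κ * t)) * prefactor D P₀ κ := by
  have hcont : Continuous fun x : ℝ => evolvedExtension P₀ H t (x + Complex.I * κ) := by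
    refine (continuousOn_evolvedExtension hP₀a hH t).comp_continuous (by fun_prop) fun x => ?_
    simp [strip, abs_of_pos hκ]
  rw [contourMean, intervalIntegral.integral_of_le (by linarith [Real.pi_pos]),
    ← integral_Icc_eq_integral_Ioc, ← integral_const_mul,
    ofReal_integral_eq_lintegral_ofReal, prefactor, ← lintegral_const_mul' _ _ ENNReal.ofReal_ne_top]
  · refine setLIntegral_mono' measurableSet_Icc fun x hx => ?_
    rw [← ENNReal.ofReal_mul (Real.exp_nonneg _)]
    refine ENNReal.ofReal_le_ofReal ?_
    rw [one_div, inv_mul_eq_div, ← mul_div_assoc]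
    exact div_le_div_of_nonneg_right (norm_evolvedExtension_le D hκ hv ht hx) (by positivity)
  · exact ((continuous_const.mul hcont.norm).continuousOn).integrableOn_compact isCompact_Icc
  · exact Filter.Eventually.of_forall fun x => by positivity

end RankOne

/-! ### Schur test. -/

section SchurTest

variable {l d : ℕ}

/-- The Schur test for block matrices. -/
theorem norm_le_of_block_sums {M : Matrix (Fin l × Fin d) (Fin l × Fin d) ℂ}
    {e : Fin l → Fin l → ℝ} {ρ : ℝ}
    (he : ∀ i j, ‖(Matrix.of fun a b => M (i, a) (j, b) : Matrix (Fin d) (Fin d) ℂ)‖ ≤ e i j)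
    (hrow : ∀ i, ∑ j, e i j ≤ ρ) (hcol : ∀ j, ∑ i, e i j ≤ ρ) (hρ : 0 ≤ ρ) : ‖M‖ ≤ ρ := by
  have he0 : ∀ i j, 0 ≤ e i j := fun i j => (norm_nonneg _).trans (he i j)
  rw [Matrix.cstar_norm_def]
  refine ContinuousLinearMap.opNorm_le_bound _ hρ fun x => ?_
  set ξ : Fin l → EuclideanSpace ℂ (Fin d) := fun i => WithLp.toLp 2 fun a => x (i, a) with hξ
  set y := Matrix.toEuclideanCLM (n := Fin l × Fin d) (𝕜 := ℂ) M x with hy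
  set η : Fin l → EuclideanSpace ℂ (Fin d) := fun i => WithLp.toLp 2 fun a => y (i, a) with hη
  have hx2 : ‖x‖ ^ 2 = ∑ i, ‖ξ i‖ ^ 2 := by
    simp only [EuclideanSpace.norm_sq_eq, Fintype.sum_prod_type, hξ]
  have hy2 : ‖y‖ ^ 2 = ∑ i, ‖η i‖ ^ 2 := by
    simp only [EuclideanSpace.norm_sq_eq, Fintype.sum_prod_type, hη]
  have hηξ : ∀ i, η i = ∑ j, Matrix.toEuclideanCLM (n := Fin d) (𝕜 := ℂ)
      (Matrix.of fun a b => M (i, a) (j, b)) (ξ j) := by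
    intro i
    ext a
    rw [WithLp.ofLp_sum, Finset.sum_apply]
    simp only [Matrix.ofLp_toEuclideanCLM, hη, hy, Matrix.mulVec, dotProduct,
      Fintype.sum_prod_type, Matrix.of_apply, hξ]
  have hbound : ∀ i, ‖η i‖ ≤ ∑ j, e i j * ‖ξ j‖ := by
    intro i
    rw [hηξ]
    refine (norm_sum_le _ _).trans (Finset.sum_le_sum fun j _ => ?_)
    refine (ContinuousLinearMap.le_opNorm _ _).trans ?_
    exact mul_le_mul_of_nonneg_right (he i j) (norm_nonneg _)
  -- Cauchy–Schwarz with the weights `e i j`, followed by the row bound; the column bound enters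
  -- after summing over `i`.
  have hcs : ∀ i, ‖η i‖ ^ 2 ≤ ρ * ∑ j, e i j * ‖ξ j‖ ^ 2 := by
    intro i
    calc ‖η i‖ ^ 2 ≤ (∑ j, e i j * ‖ξ j‖) ^ 2 := pow_le_pow_left₀ (norm_nonneg _) (hbound i) 2
      _ ≤ (∑ j, e i j) * ∑ j, e i j * ‖ξ j‖ ^ 2 :=
        Finset.sum_sq_le_sum_mul_sum_of_sq_le_mul _ (fun j _ => he0 i j)
          (fun j _ => mul_nonneg (he0 i j) (sq_nonneg _)) fun j _ => le_of_eq (by ring)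
      _ ≤ _ := mul_le_mul_of_nonneg_right (hrow i)
        (Finset.sum_nonneg fun j _ => mul_nonneg (he0 i j) (sq_nonneg _))
  refine le_of_sq_le_sq ?_ (by positivity)
  calc ‖y‖ ^ 2 ≤ ∑ i, ρ * ∑ j, e i j * ‖ξ j‖ ^ 2 := by
        rw [hy2]; exact Finset.sum_le_sum fun i _ => hcs i
    _ = ρ * ∑ j, (∑ i, e i j) * ‖ξ j‖ ^ 2 := by
        rw [← Finset.mul_sum, Finset.sum_comm]
        simp only [Finset.sum_mul]
    _ ≤ ρ * ∑ j, ρ * ‖ξ j‖ ^ 2 :=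
        mul_le_mul_of_nonneg_left (Finset.sum_le_sum fun j _ =>
          mul_le_mul_of_nonneg_right (hcol j) (sq_nonneg _)) hρ
    _ = (ρ * ‖x‖) ^ 2 := by rw [← Finset.mul_sum, ← hx2]; ring

end SchurTest

/-! ### Perturbation of an eigenvalue. -/

section Perturbation

variable {n : Type*} [Fintype n] [DecidableEq n]

/-- A self-adjoint matrix at distance at most `ρ` from a matrix with the eigenvalue `c` has
an eigenvalue at distance at most `ρ` from `c`. -/
theorem sInf_abs_sub_le {T S : Matrix n n ℂ} {c ρ : ℝ} (hT : IsSelfAdjoint T) (hρ : 0 ≤ ρ)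
    (hS : ¬ IsUnit (S - algebraMap ℝ (Matrix n n ℂ) c)) (hTS : ‖T - S‖ ≤ ρ) :
    sInf ((fun ξ : ℝ => |ξ - c|) '' spectrum ℝ T) ≤ ρ := by
  by_contra! hlt
  set δ := sInf ((fun ξ : ℝ => |ξ - c|) '' spectrum ℝ T)
  have hδ : 0 < δ := hρ.trans_lt hlt
  have hmin : ∀ ξ ∈ spectrum ℝ T, δ ≤ |ξ - c| := fun ξ hξ =>
    csInf_le ⟨0, by rintro _ ⟨x, -, rfl⟩; exact abs_nonneg _⟩ ⟨ξ, hξ, rfl⟩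
  have hc := fun f => continuousOn_matrix_spectrum f T
  -- The resolvent of `T` at `c`, of norm at most `1/δ`. A Neumann series would then invert `S - c`,
  -- because `ρ < δ`.
  set R := cfc (fun x : ℝ => (x - c)⁻¹) T with hR
  have hRn : ‖R‖ ≤ δ⁻¹ := by
    refine norm_cfc_le (by positivity) fun x hx => ?_
    rw [norm_inv, Real.norm_eq_abs]
    exact inv_anti₀ hδ (hmin x hx)
  have hTc : T - algebraMap ℝ (Matrix n n ℂ) c = cfc (fun x : ℝ => x - c) T := by
    rw [cfc_sub _ _ _ (hc _) (hc _), cfc_id' ℝ T, cfc_const c T]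
  have hTR : (T - algebraMap ℝ (Matrix n n ℂ) c) * R = 1 := by
    rw [hTc, hR, ← cfc_mul _ _ _ (hc _) (hc _), ← cfc_const_one ℝ T]
    refine cfc_congr fun x hx => ?_
    have : x - c ≠ 0 := fun h => by
      have := hmin x hx
      rw [h, abs_zero] at this
      linarith
    exact mul_inv_cancel₀ this
  have hlt1 : ‖R * (T - S)‖ < 1 := by
    calc ‖R * (T - S)‖ ≤ ‖R‖ * ‖T - S‖ := norm_mul_le _ _
      _ ≤ δ⁻¹ * ρ := mul_le_mul hRn hTS (norm_nonneg _) (by positivity)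
      _ < 1 := by rw [inv_mul_lt_iff₀ hδ, mul_one]; exact hlt
  have hu := isUnit_one_sub_of_norm_lt_one hlt1
  have hTu : IsUnit (T - algebraMap ℝ (Matrix n n ℂ) c) := IsUnit.of_mul_eq_one _ hTR
  refine hS ?_
  have : S - algebraMap ℝ (Matrix n n ℂ) c =
      (T - algebraMap ℝ (Matrix n n ℂ) c) * (1 - R * (T - S)) := by
    rw [mul_sub, mul_one, ← mul_assoc, hTR, one_mul]
    abel
  rw [this]
  exact hTu.mul hu

end Perturbation

/-! ### Sums over images. -/

section ImageSum

variable {l : ℕ}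

/-- The sum over the images of a lattice vector under translations by `2 l`. -/
lemma hasSum_exp_neg_abs_images {κ : ℝ} (hκ : 0 < κ) (hl : l ≠ 0) {n : ℤ} (hn : |n| < 2 * l) :
    HasSum (fun m : ℤ => if m = 0 then 0 else Real.exp (-κ * |((n + 2 * l * m : ℤ) : ℝ)|))
      (Real.exp (-(2 * κ * l)) / (1 - Real.exp (-(2 * κ * l))) *
        (Real.exp (-κ * n) + Real.exp (κ * n))) := by
  set q := Real.exp (-(2 * κ * l)) with hq
  have hl0 : 0 < (l : ℝ) := by exact_mod_cast Nat.pos_of_ne_zero hl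
  have hq1 : q < 1 := by
    rw [hq, Real.exp_lt_one_iff]
    have := mul_pos hκ hl0
    linarith
  have hgeo := hasSum_geometric_of_lt_one (Real.exp_nonneg _) hq1
  rw [abs_lt] at hn
  have hn1 : -(2 * (l : ℝ)) < n := by exact_mod_cast hn.1
  have hn2 : (n : ℝ) < 2 * l := by exact_mod_cast hn.2
  have hpow : ∀ m : ℕ, q ^ m = Real.exp (-(2 * κ * l) * m) := by
    intro m; rw [hq, ← Real.exp_nat_mul]; congr 1; ring
  rw [mul_add]
  -- Since `|n| < 2 l`, the sign of `n + 2 l m` is that of `m` for `m ≠ 0`, so each half is a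
  -- geometric series in `q`.
  refine HasSum.of_nat_of_neg_add_one ?_ ?_
  · have h := (hasSum_nat_add_iff (f := fun m : ℕ => if (m : ℤ) = 0 then 0 else
      Real.exp (-κ * |((n + 2 * l * (m : ℤ) : ℤ) : ℝ)|)) 1
      (g := q / (1 - q) * Real.exp (-κ * n))).1 ?_
    · simpa using h
    · have hval : q / (1 - q) * Real.exp (-κ * n) = q * Real.exp (-κ * n) * (1 - q)⁻¹ := by
        rw [div_eq_mul_inv]; ring
      rw [hval]
      refine (hgeo.mul_left _).congr_fun fun m => ?_
      have hpos : (0 : ℝ) ≤ ((n + 2 * l * ((m + 1 : ℕ) : ℤ) : ℤ) : ℝ) := by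
        push_cast
        nlinarith [mul_nonneg hl0.le (Nat.cast_nonneg (α := ℝ) m)]
      rw [if_neg (by positivity), abs_of_nonneg hpos, hpow, hq, ← Real.exp_add, ← Real.exp_add]
      congr 1
      push_cast; ring
  · have hval : q / (1 - q) * Real.exp (κ * n) = q * Real.exp (κ * n) * (1 - q)⁻¹ := by
      rw [div_eq_mul_inv]; ring
    rw [hval]
    refine (hgeo.mul_left _).congr_fun fun m => ?_
    have hneg : ((n + 2 * l * (-((m : ℤ) + 1)) : ℤ) : ℝ) ≤ 0 := by
      push_cast
      nlinarith [mul_nonneg hl0.le (Nat.cast_nonneg (α := ℝ) m)]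
    rw [if_neg (by omega), abs_of_nonpos hneg, hpow, hq, ← Real.exp_add, ← Real.exp_add]
    congr 1
    push_cast; ring

/-- The row sums of the images are largest at the ends of the segment. -/
lemma sum_images_le {κ : ℝ} (hκ : 0 < κ) (hl : l ≠ 0) (i : Fin l) :
    ∑ j : Fin l, Real.exp (-(2 * κ * l)) / (1 - Real.exp (-(2 * κ * l))) *
      (Real.exp (-κ * ((j : ℕ) - (i : ℕ) : ℤ)) + Real.exp (κ * ((j : ℕ) - (i : ℕ) : ℤ))) ≤
      Real.exp (-κ * l) / Real.sinh κ := by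
  set x := Real.exp (-κ) with hx
  have hx0 : 0 < x := Real.exp_pos _
  have hx1 : x < 1 := by rw [hx, Real.exp_lt_one_iff]; linarith
  set y := x ^ l with hy
  have hy0 : 0 < y := by positivity
  have hyx : y ≤ x := by
    calc y ≤ x ^ 1 := pow_le_pow_of_le_one hx0.le hx1.le (Nat.one_le_iff_ne_zero.2 hl)
      _ = x := pow_one x
  have hpow : ∀ m : ℕ, Real.exp (-κ * m) = x ^ m := fun m => by
    rw [hx, ← Real.exp_nat_mul]; congr 1; ring
  have hq : Real.exp (-(2 * κ * l)) = y ^ 2 := by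
    rw [hy, ← pow_mul, ← hpow]; congr 1; push_cast; ring
  have hsinh : Real.sinh κ = (1 - x ^ 2) / (2 * x) := by
    have : Real.exp κ = x⁻¹ := by rw [hx, Real.exp_neg, inv_inv]
    rw [Real.sinh_eq, this, ← hx]
    field_simp
  set a := x ^ (i : ℕ) with ha
  have ha0 : 0 < a := by positivity
  have ha1 : a ≤ 1 := pow_le_one₀ hx0.le hx1.le
  have hay : y ≤ x * a := by
    rw [ha, ← pow_succ', hy]
    exact pow_le_pow_of_le_one hx0.le hx1.le i.isLt
  have hterm : ∀ j : Fin l, Real.exp (-κ * ((j : ℕ) - (i : ℕ) : ℤ)) +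
      Real.exp (κ * ((j : ℕ) - (i : ℕ) : ℤ)) = a⁻¹ * x ^ (j : ℕ) + a * (x⁻¹) ^ (j : ℕ) := by
    intro j
    rw [ha, inv_pow, ← hpow, ← hpow, ← Real.exp_neg, ← Real.exp_neg, ← Real.exp_add,
      ← Real.exp_add]
    congr 2 <;> push_cast <;> ring
  have hsum1 : ∑ j : Fin l, x ^ (j : ℕ) = (1 - y) / (1 - x) := by
    rw [Fin.sum_univ_eq_sum_range (fun j => x ^ j), geom_sum_eq hx1.ne, ← neg_div_neg_eq]
    ring
  have hsum2 : ∑ j : Fin l, (x⁻¹) ^ (j : ℕ) = x * (1 - y) / (y * (1 - x)) := by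
    have hne : x⁻¹ ≠ 1 := by rw [ne_eq, inv_eq_one]; exact hx1.ne
    have h1 : 1 - x ≠ 0 := by linarith
    rw [Fin.sum_univ_eq_sum_range (fun j => (x⁻¹) ^ j), geom_sum_eq hne, inv_pow, ← hy,
      div_eq_div_iff (by rw [sub_ne_zero]; exact hne) (by positivity)]
    field_simp
  simp only [hterm]
  rw [← Finset.mul_sum, Finset.sum_add_distrib, ← Finset.mul_sum, ← Finset.mul_sum, hsum1, hsum2,
    hq, hpow, ← hy, hsinh]
  have hy1 : y < 1 := hyx.trans_lt hx1
  have h1x : 0 < 1 - x := by linarith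
  have h1y : 0 < 1 - y := by linarith
  -- The difference is `(1 - a) (x a - y) / (a y)`, which vanishes at both ends of the segment, `i =
  -- 0` and `i = l - 1`.
  have hA : a⁻¹ + a * x / y ≤ 1 + x / y := by
    rw [← sub_nonneg]
    have : 1 + x / y - (a⁻¹ + a * x / y) = (1 - a) * (x * a - y) / (a * y) := by
      field_simp; ring
    rw [this]
    exact div_nonneg (mul_nonneg (by linarith) (by linarith)) (by positivity)
  calc y ^ 2 / (1 - y ^ 2) * (a⁻¹ * ((1 - y) / (1 - x)) + a * (x * (1 - y) / (y * (1 - x))))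
      = y ^ 2 / ((1 + y) * (1 - x)) * (a⁻¹ + a * x / y) := by
        have : 1 - y ^ 2 = (1 - y) * (1 + y) := by ring
        rw [this]
        field_simp
    _ ≤ y ^ 2 / ((1 + y) * (1 - x)) * (1 + x / y) :=
        mul_le_mul_of_nonneg_left hA (by positivity)
    _ = y * (x + y) / ((1 + y) * (1 - x)) := by field_simp; ring
    _ ≤ y / ((1 - x ^ 2) / (2 * x)) := by
        have : 1 - x ^ 2 = (1 - x) * (1 + x) := by ring
        rw [this, div_div_eq_mul_div, div_le_div_iff₀ (by positivity) (by positivity)]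
        -- This is `(x - y) (1 - x) ≥ 0`, with equality for `l = 1`.
        have key : (x + y) * (1 + x) ≤ 2 * x * (1 + y) := by
          nlinarith [mul_nonneg (sub_nonneg.2 hyx) h1x.le]
        nlinarith [mul_le_mul_of_nonneg_left key (mul_nonneg hy0.le h1x.le)]

end ImageSum

/-! ### From the segment to the mean of the two rings. -/

section Periodization

variable {l d : ℕ} {κ K : ℝ} {p : C(AddCircle (2 * Real.pi), Matrix (Fin d) (Fin d) ℂ)}

/-- The block Toeplitz matrix of a symbol. -/
def toeplitz (l : ℕ) (p : C(AddCircle (2 * Real.pi), Matrix (Fin d) (Fin d) ℂ)) :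
    Matrix (Fin l × Fin d) (Fin l × Fin d) ℂ :=
  Matrix.of fun x y => fourierCoeff p (((y.1 : ℕ) : ℤ) - ((x.1 : ℕ) : ℤ)) x.2 y.2

/-- The mean of the operators of a symbol on the periodic and on the antiperiodic ring. -/
def ringMean (l : ℕ) (p : C(AddCircle (2 * Real.pi), Matrix (Fin d) (Fin d) ℂ)) :
    Matrix (Fin l × Fin d) (Fin l × Fin d) ℂ :=
  (1 / 2 : ℂ) • (ringOp l 0 (fun k => p k) + ringOp l Real.pi (fun k => p k))

lemma summable_exp_neg_abs (hκ : 0 < κ) : Summable fun n : ℤ => Real.exp (-κ * |(n : ℝ)|) := by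
  have h : Summable fun n : ℕ => Real.exp (-κ * n) := by
    have := summable_geometric_of_lt_one (Real.exp_nonneg (-κ))
      (by rw [Real.exp_lt_one_iff]; linarith)
    refine this.congr fun n => ?_
    rw [← Real.exp_nat_mul]; congr 1; ring
  refine Summable.of_nat_of_neg ?_ ?_ <;> simpa using h

/-- At odd multiples of `l` the antiperiodic ring has the opposite sign and cancels the periodic
one. Averaging thus doubles the distance of the images from `l` to `2 l`. -/
lemma sum_exp_ringMomentum_zero_add_pi (hl : l ≠ 0) (M : ℤ) :
    ∑ m : Fin l, Complex.exp (Complex.I * ringMomentum l 0 m * M) +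
      ∑ m : Fin l, Complex.exp (Complex.I * ringMomentum l Real.pi m * M) =
      if (2 * l : ℤ) ∣ M then 2 * (l : ℂ) else 0 := by
  have hl' : (l : ℂ) ≠ 0 := by exact_mod_cast hl
  have hlz : (l : ℤ) ≠ 0 := by exact_mod_cast hl
  rw [sum_exp_ringMomentum_int hl, sum_exp_ringMomentum_int hl]
  by_cases h : (l : ℤ) ∣ M
  · obtain ⟨c, rfl⟩ := h
    have h0 : (2 * l : ℤ) ∣ l * c ↔ 2 ∣ c := by
      rw [mul_comm (2 : ℤ), mul_dvd_mul_iff_left hlz]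
    rw [if_pos (dvd_mul_right _ _), if_pos (dvd_mul_right _ _)]
    simp only [h0]
    have h1 : Complex.exp (Complex.I * Real.pi * ((l * c : ℤ) : ℂ) / l) =
        Complex.exp (Complex.I * Real.pi * c) := by
      congr 1; push_cast; field_simp
    have h2 : ∀ e : ℤ, Complex.exp (Complex.I * Real.pi * ((2 * e : ℤ) : ℂ)) = 1 := by
      intro e
      rw [← exp_I_mul_two_pi_int e]; congr 1; push_cast; ring
    rw [h1]
    obtain ⟨e, rfl | rfl⟩ := Int.even_or_odd' c
    · rw [if_pos (dvd_mul_right _ _), h2]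
      simp; ring
    · have h3 : Complex.exp (Complex.I * Real.pi * ((2 * e + 1 : ℤ) : ℂ)) = -1 := by
        calc _ = Complex.exp (Complex.I * Real.pi * ((2 * e : ℤ) : ℂ)) *
              Complex.exp (Real.pi * Complex.I) := by
              rw [← Complex.exp_add]; congr 1; push_cast; ring
          _ = -1 := by rw [h2, Complex.exp_pi_mul_I, one_mul]
      rw [if_neg (by omega), h3]
      simp
  · rw [if_neg h, if_neg h, if_neg fun h' => h ((dvd_mul_left _ _).trans h'), add_zero]

lemma hasSum_entry (hκ : 0 < κ)
    (hp : ∀ n, ‖fourierCoeff p n‖ ≤ K * Real.exp (-κ * |(n : ℝ)|)) (k : ℝ) (a b : Fin d) :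
    HasSum (fun n : ℤ => fourierCoeff p n a b * Complex.exp (Complex.I * k * n))
      (p (k : AddCircle (2 * Real.pi)) a b) := by
  let f : C(AddCircle (2 * Real.pi), ℂ) := ⟨fun x => p x a b, by fun_prop⟩
  have hf : ∀ n, fourierCoeff f n = fourierCoeff p n a b := fun n =>
    (fourierCoeff_apply p n a b).symm
  have hs : Summable (fourierCoeff f) :=
    ((entryCLM a b).summable
      (Summable.of_norm_bounded ((summable_exp_neg_abs hκ).mul_left K) hp)).congr
      fun n => (hf n).symm
  have := has_pointwise_sum_fourier_series_of_summable hs (k : AddCircle (2 * Real.pi))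
  simp only [hf, LatticeHamiltonian.fourier_coe_two_pi, smul_eq_mul] at this
  exact this

/-- Poisson summation: the mean of the two rings is a sum over images at distances `2 l`. -/
lemma hasSum_ringMean (hκ : 0 < κ) (hl : l ≠ 0)
    (hp : ∀ n, ‖fourierCoeff p n‖ ≤ K * Real.exp (-κ * |(n : ℝ)|)) (i j : Fin l) (a b : Fin d) :
    HasSum (fun m : ℤ => fourierCoeff p (((j : ℕ) : ℤ) - ((i : ℕ) : ℤ) + 2 * l * m) a b)
      (ringMean l p (i, a) (j, b)) := by
  have hl' : (l : ℂ) ≠ 0 := by exact_mod_cast hl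
  set s : ℤ := ((j : ℕ) : ℤ) - ((i : ℕ) : ℤ) with hs
  have hring : ∀ θ, HasSum (fun N : ℤ => fourierCoeff p N a b / l *
      ∑ m : Fin l, Complex.exp (Complex.I * ringMomentum l θ m * ((N - s : ℤ) : ℂ)))
      (ringOp l θ (fun k => p k) (i, a) (j, b)) := by
    intro θ
    rw [ringOp, Matrix.sum_apply]
    have h := hasSum_sum (s := Finset.univ) fun (m : Fin l) _ =>
      (hasSum_entry hκ hp (ringMomentum l θ m) a b).mul_left
        (planeWave l (ringMomentum l θ m) i j)
    refine h.congr_fun fun N => ?_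
    rw [Finset.mul_sum]
    refine Finset.sum_congr rfl fun m _ => ?_
    have : Complex.exp (Complex.I * ringMomentum l θ m * ((N - s : ℤ) : ℂ)) =
        Complex.exp (Complex.I * ringMomentum l θ m * (((i : ℕ) : ℂ) - ((j : ℕ) : ℂ))) *
          Complex.exp (Complex.I * ringMomentum l θ m * N) := by
      rw [← Complex.exp_add, hs]
      congr 1; push_cast; ring
    rw [this, planeWave, Matrix.of_apply]
    ring
  have hsum := ((hring 0).add (hring Real.pi)).mul_left (1 / 2 : ℂ)
  have hinj : Function.Injective fun m : ℤ => s + 2 * l * m := by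
    intro m m' h
    have h0 : (2 * l : ℤ) ≠ 0 := by simpa using hl
    exact mul_left_cancel₀ h0 (add_left_cancel h)
  have hval : ∀ N : ℤ, (1 / 2 : ℂ) * (fourierCoeff p N a b / l *
      ∑ m : Fin l, Complex.exp (Complex.I * ringMomentum l 0 m * ((N - s : ℤ) : ℂ)) +
      fourierCoeff p N a b / l *
      ∑ m : Fin l, Complex.exp (Complex.I * ringMomentum l Real.pi m * ((N - s : ℤ) : ℂ))) =
      if (2 * l : ℤ) ∣ N - s then fourierCoeff p N a b else 0 := by
    intro N
    rw [← mul_add, sum_exp_ringMomentum_zero_add_pi hl]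
    split_ifs
    · field_simp
    · simp
  simp only [hval] at hsum
  rw [← hinj.hasSum_iff] at hsum
  · refine hsum.congr_fun fun m => ?_
    simp
  · intro N hN
    rw [if_neg]
    rintro ⟨m, hm⟩
    exact hN ⟨m, by simp only; linarith⟩

/-- The block Toeplitz matrix of a symbol with exponentially decaying coefficients is close to the
mean of the two ring operators. -/
theorem norm_toeplitz_sub_ringMean_le (hκ : 0 < κ) (hl : l ≠ 0)
    (hp : ∀ n, ‖fourierCoeff p n‖ ≤ K * Real.exp (-κ * |(n : ℝ)|)) :
    ‖toeplitz l p - ringMean l p‖ ≤ K * (Real.exp (-κ * l) / Real.sinh κ) := by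
  have hK : 0 ≤ K := by simpa using (norm_nonneg _).trans (hp 0)
  have hsinh : 0 < Real.sinh κ := Real.sinh_pos_iff.2 hκ
  set q := Real.exp (-(2 * κ * l)) / (1 - Real.exp (-(2 * κ * l)))
  set e : Fin l → Fin l → ℝ := fun i j => K * (q *
    (Real.exp (-κ * (((j : ℕ) : ℤ) - ((i : ℕ) : ℤ) : ℤ)) +
      Real.exp (κ * (((j : ℕ) : ℤ) - ((i : ℕ) : ℤ) : ℤ)))) with he
  have hsymm : ∀ i j, e i j = e j i := by
    intro i j
    simp only [he]
    rw [add_comm]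
    congr 4 <;> push_cast <;> ring
  have hrow : ∀ i, ∑ j, e i j ≤ K * (Real.exp (-κ * l) / Real.sinh κ) := by
    intro i
    rw [← Finset.mul_sum]
    exact mul_le_mul_of_nonneg_left (sum_images_le hκ hl i) hK
  refine norm_le_of_block_sums (e := e) (fun i j => ?_) hrow
    (fun j => by simpa only [hsymm _ j] using hrow j) (by positivity)
  set s : ℤ := ((j : ℕ) : ℤ) - ((i : ℕ) : ℤ) with hs
  have hsl : |s| < 2 * l := by
    have := i.isLt
    have := j.isLt
    rw [abs_lt]; omega
  have h1 : HasSum (fun m : ℤ => fourierCoeff p (s + 2 * l * m))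
      (Matrix.of fun a b => ringMean l p (i, a) (j, b)) :=
    Pi.hasSum.2 fun a => Pi.hasSum.2 fun b => hasSum_ringMean hκ hl hp i j a b
  -- Subtracting the `m = 0` image leaves exactly the nontrivial images in the difference of the
  -- matrices.
  have h2 := (hasSum_ite_eq (0 : ℤ) (fourierCoeff p s)).sub h1
  have h3 : (Matrix.of fun a b => (toeplitz l p - ringMean l p) (i, a) (j, b)) =
      fourierCoeff p s - Matrix.of fun a b => ringMean l p (i, a) (j, b) := by
    ext a b
    simp [toeplitz, hs]
  rw [h3]
  refine h2.norm_le_of_bounded ((hasSum_exp_neg_abs_images hκ hl hsl).mul_left K) fun m => ?_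
  by_cases hm : m = 0
  · simp [hm]
  · simpa [hm] using hp (s + 2 * l * m)

lemma isSelfAdjoint_toeplitz (hp : IsSelfAdjoint p) : IsSelfAdjoint (toeplitz l p) := by
  rw [IsSelfAdjoint]
  ext ⟨i, a⟩ ⟨j, b⟩
  have h := congrFun (congrFun (fourierCoeff_neg_of_isSelfAdjoint hp
    (((i : ℕ) : ℤ) - ((j : ℕ) : ℤ))) a) b
  rw [neg_sub, Matrix.conjTranspose_apply] at h
  simp only [Matrix.star_apply, toeplitz, Matrix.of_apply]
  exact h.symm

lemma ringOp_one_sub_two_smul (hl : l ≠ 0) (θ : ℝ) (A : ℝ → Matrix (Fin d) (Fin d) ℂ) :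
    ringOp l θ (fun k => 1 - (2 : ℝ) • A k) = 1 - (2 : ℝ) • ringOp l θ A := by
  rw [eq_sub_iff_add_eq, ← Matrix.one_kronecker_one, ← ringOp_const (θ := θ) hl]
  simp only [ringOp]
  rw [Finset.smul_sum, ← Finset.sum_add_distrib]
  refine Finset.sum_congr rfl fun m _ => ?_
  rw [← Matrix.kronecker_smul, ← Matrix.kronecker_add, sub_add_cancel]

/-- Translates `Q = 1 - 2 P`: a kernel of the sum of the flat Hamiltonians is an eigenvalue 1/2 of
the mean projector. -/
lemma ringMean_sub_half (hl : l ≠ 0) (H₀ H : LatticeHamiltonian d) (t : ℝ) :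
    ringOp l 0 (evolvedFlat H₀ H t) + ringOp l Real.pi (evolvedFlat H₀ H t) =
      (-4 : ℂ) • (ringMean l (evolvedSymbol H₀ H t) - algebraMap ℝ _ (1 / 2)) := by
  have h : evolvedFlat H₀ H t = fun k : ℝ => 1 - (2 : ℝ) • evolvedSymbol H₀ H t k := rfl
  rw [h, ringOp_one_sub_two_smul hl, ringOp_one_sub_two_smul hl, ringMean,
    Algebra.algebraMap_eq_smul_one]
  ext x y
  simp only [Matrix.add_apply, Matrix.sub_apply, Matrix.smul_apply, smul_eq_mul, Complex.real_smul]
  push_cast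
  ring

end Periodization

/-! ### The entanglement gap. -/

section EntanglementGap

variable {l d : ℕ} {W : Matrix (Fin d) (Fin d) ℂ} {H₀ H : LatticeHamiltonian d} {κ : ℝ}
  {P₀ : ℂ → Matrix (Fin d) (Fin d) ℂ}

/-- In dimension 0 both Pfaffians are the empty product 1, so their ratio is positive. -/
lemma TopologicallyNontrivial.dim_ne_zero (htop : TopologicallyNontrivial H₀ W) : d ≠ 0 := by
  rintro rfl
  simp [TopologicallyNontrivial, pfaffian] at htop
  linarith

lemma segmentMatrix_evolvedProjector (hgap : H₀.Gapped) (H : LatticeHamiltonian d) (t : ℝ) :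
    segmentMatrix (evolvedProjector H₀ H t) l = toeplitz l (evolvedSymbol H₀ H t) := by
  ext x y
  rw [segmentMatrix, toeplitz, Matrix.of_apply, Matrix.of_apply, block_evolvedProjector hgap,
    fourierCoeff_apply, add_sub_add_right_eq_sub]

/-- The entanglement gap is bounded by the mean of the evolved Bloch projectors on the shifted
contour. -/
theorem entanglementGap_le (hW : IsInvolutoryConjugation W) (h₀C : H₀.ParticleHoleSymmetric W)
    (hC : H.ParticleHoleSymmetric W) (hgap : H₀.Gapped) (htop : TopologicallyNontrivial H₀ W)
    (hκ : 0 < κ) (hP₀ : ∀ k : ℝ, P₀ k = fermiProjector (H₀.bloch k))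
    (hP₀a : AnalyticOnNhd ℂ P₀ (strip κ)) (hH : H.BlochWellDefined κ) (hl : l ≠ 0) (t : ℝ) :
    entanglementGap (evolvedProjector H₀ H t) l ≤
      2 * (contourMean P₀ H κ t * (Real.exp (-κ * l) / Real.sinh κ)) := by
  have hdecay := norm_fourierCoeff_evolvedSymbol_le_exp_neg_abs hκ hgap hP₀ hP₀a hH t
  have hnorm := norm_toeplitz_sub_ringMean_le hκ hl hdecay
  let V : Matrix.unitaryGroup (Fin d) ℂ := ⟨W, hW.1⟩
  have h₀V : H₀.ParticleHoleSymmetric V := h₀C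
  have hV : H.ParticleHoleSymmetric V := hC
  obtain ⟨u, huW, huQ, hu⟩ := exists_intertwiner_evolvedFlat (W := V) hW.2 h₀V hV hgap htop t
  have hdet := det_ringOp_add_ringOp_eq_zero (W := V) hW.2 (continuous_evolvedFlat t)
    (evolvedFlat_periodic t) (evolvedFlat_mul_self hgap t) (star_evolvedFlat t)
    (antiunitaryConj_evolvedFlat h₀V hV hgap t) huW huQ hu hl htop.dim_ne_zero
  rw [ringMean_sub_half hl, Matrix.det_smul] at hdet
  rw [entanglementGap, entanglementSpectrum, segmentMatrix_evolvedProjector hgap]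
  refine mul_le_mul_of_nonneg_left ?_ zero_le_two
  refine sInf_abs_sub_le (isSelfAdjoint_toeplitz (isSelfAdjoint_evolvedSymbol H₀ H t))
    ((norm_nonneg _).trans hnorm) ?_ hnorm
  rw [Matrix.isUnit_iff_isUnit_det, isUnit_iff_ne_zero, not_not]
  exact (mul_eq_zero.1 hdet).resolve_left (pow_ne_zero _ (by norm_num))

end EntanglementGap

end FreeFermion

end

/-! ### The theorem. -/

theorem theorem1 {d : ℕ} (W : Matrix (Fin d) (Fin d) ℂ)
    (hW : FreeFermion.IsInvolutoryConjugation W)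
    (H₀ H : FreeFermion.LatticeHamiltonian d)
    (h₀C : H₀.ParticleHoleSymmetric W) (hC : H.ParticleHoleSymmetric W)
    (hgap : H₀.Gapped) (htop : FreeFermion.TopologicallyNontrivial H₀ W)
    (κ : ℝ) (hκ : 0 < κ)
    (P₀ : ℂ → Matrix (Fin d) (Fin d) ℂ)
    (hP₀ : ∀ k : ℝ, P₀ k = FreeFermion.fermiProjector (H₀.bloch k))
    (hP₀_analytic : AnalyticOnNhd ℂ P₀ (FreeFermion.strip κ))
    (hH : H.BlochWellDefined κ)
    (D : FreeFermion.Diagonalization (fun k : ℝ => H.bloch (k + Complex.I * κ))) :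
    IsGreatest (FreeFermion.relativeVelocities D κ) (FreeFermion.velocity D κ) ∧
    ∀ (l : ℕ) (t : ℝ), 1 ≤ l → 0 ≤ t →
      ENNReal.ofReal
          (FreeFermion.entanglementGap (FreeFermion.evolvedProjector H₀ H t) l) ≤
        ENNReal.ofReal (2 / Real.sinh κ) * FreeFermion.prefactor D P₀ κ *
          ENNReal.ofReal (Real.exp (-κ * (l - FreeFermion.velocity D κ * t))) := by
  have hA : ContinuousOn (fun k : ℝ => H.bloch (k + Complex.I * κ))
      (Icc (-Real.pi) Real.pi) := by
    refine hH.continuousOn_bloch.comp (by fun_prop) fun k _ => ?_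
    simp [FreeFermion.strip, abs_of_pos hκ]
  have hv := D.isGreatest_velocity hA htop.dim_ne_zero κ
  refine ⟨hv, fun l t hl ht => ?_⟩
  have hsinh : 0 < Real.sinh κ := Real.sinh_pos_iff.2 hκ
  have hgapl := FreeFermion.entanglementGap_le hW h₀C hC hgap htop hκ hP₀ hP₀_analytic hH
    (Nat.one_le_iff_ne_zero.1 hl) t
  have hmean := FreeFermion.ofReal_contourMean_le D hκ hv ht hP₀_analytic hH
  set v := FreeFermion.velocity D κ
  have hexp : Real.exp (-κ * (l - v * t)) = Real.exp (κ * v * t) * Real.exp (-κ * l) := by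
    rw [← Real.exp_add]; congr 1; ring
  calc ENNReal.ofReal (FreeFermion.entanglementGap (FreeFermion.evolvedProjector H₀ H t) l)
      ≤ ENNReal.ofReal (2 / Real.sinh κ * FreeFermion.contourMean P₀ H κ t *
          Real.exp (-κ * l)) :=
        ENNReal.ofReal_le_ofReal (hgapl.trans (le_of_eq (by ring)))
    _ = ENNReal.ofReal (2 / Real.sinh κ) * ENNReal.ofReal (FreeFermion.contourMean P₀ H κ t) *
          ENNReal.ofReal (Real.exp (-κ * l)) := by
        rw [ENNReal.ofReal_mul' (Real.exp_nonneg _), ENNReal.ofReal_mul (by positivity)]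
    _ ≤ ENNReal.ofReal (2 / Real.sinh κ) * (ENNReal.ofReal (Real.exp (κ * v * t)) *
          FreeFermion.prefactor D P₀ κ) * ENNReal.ofReal (Real.exp (-κ * l)) := by gcongr
    _ = _ := by
        rw [hexp, ENNReal.ofReal_mul (Real.exp_nonneg _)]
        ring
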